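/- Let $p$ be a prime number, let $f(x)=x^4+ax^2+bx+c\in\mathbb Z[x]$ be irreducible, let $\theta$ be a root of $f$ and $K=\mathbb Q(\theta)$. Write $v_p$ for the $p$-adic valuation ($v_p(0)=\infty$), $\Delta=v_p(\operatorname{disc}f)$, and for $s\in\mathbb Z$ put $$\alpha_s=\theta^3+s\theta^2+(a+s^2)\theta+s^3+as+b .$$ A family of elements of $K$ is a *$p$-integral basis* if it is a $\mathbb Z_{(p)}$-basis of $\mathbb Z_K\otimes\mathbb Z_{(p)}\subset K$. For $s\in\mathbb Z$ write $f(x)=\sum_i a_i(x-s)^i$ and $u_i=v_p(a_i)$. The principal $(x-s)$-polygon of $f$ consists of the sides of negative slope of the lower convex envelope of the points $(i,u_i)$, $u_i<\infty$. The residual polynomial of a side of slope $-h/e$ (in lowest terms) with end points of abscissas $i<j$ is $\sum_{k=0}^{(j-i)/e}c_{i+ke}y^k\in\mathbb F_p[y]$, where $c_m$ is $a_m/p^{u_m}$ modulo $p$ if $(m,u_m)$ lies on the side, and $0$ otherwise. The integer $s$ is *regular* if the residual polynomials of all sides of the principal polygon are separable. Then the following hold. **(1)** Let $p>2$ and let $f$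 be modulo $p$ the square of an irreducible quadratic polynomial. There are integers $s$ with $2v_p(a-2s)>v_p(4c-a^2)$ or $a=2s$, and for each such $s$ a $p$-integral basis is $$1,\ \theta,\ \frac{\theta^2+s}{p^{\lfloor\nu\rfloor}},\ \frac{\theta^3+s\theta}{p^{\lfloor\nu\rfloor}},\qquad \nu=\tfrac12\min\{v_p(b),v_p(4c-a^2)\}.$$ **(2)** Let $p=2$ and let $f$ be modulo $2$ the square of an irreducible quadratic polynomial. Then $\mu=\min\{v_2(b+1-a),v_2(c-a)\}\ge 1$. A $2$-integral basis is $1,\theta,\theta^2,\theta^3$ if $\mu=1$, and $1,\theta,\frac{\theta^2+\theta+1}2,\frac{\theta^3+\theta^2+\theta}2$ if $\mu>1$. **(3)** Let $f$ have only one double root modulo $p$: $f\equiv(x-s_0)^2g\pmod p$ with $g$ separable modulo $p$ and $p\nmid g(s_0)$. There are integers $s\equiv s_0\pmod p$ with $v_p(f'(s))>\Delta/2$, and for each such $s$ a $p$-integral basis is $1,\ \theta,\ \theta^2,\ \alpha_s/p^{\lfloor\Delta/2\rfloor}$. **(4)** Let $p=2$ and let $f$ have two different double roots modulo $2$. A $2$-integral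 basis is given by the table below, where $s$ is any regular integer of the indicated parity and $\nu=\min\{v_2(f(s))/2,\,v_2(f'(s))\}$; such an $s$ exists. | $v_2(c)$ | $v_2(a+b+c+1)$ | $s$ | basis | |---|---|---|---| | $1$ | $1$ | | $1,\theta,\theta^2,\theta^3$ | | $1$ | $>1$ | odd | $1,\theta,\theta^2,\alpha_s/2^{\lfloor\nu\rfloor}$ | | $>1$ | $1$ | even | $1,\theta,\theta^2,\alpha_s/2^{\lfloor\nu\rfloor}$ | | $>1$ | $>1$ | odd if $a\equiv1$, even if $a\equiv3\pmod 4$ | $1,\theta,\frac{\theta^2+\theta}2,\alpha_s/2^{\lfloor\nu\rfloor}$ | **(5)** Let $p$ divide $a,b,c$, and suppose that $v_p(a)=1$ or $v_p(b)\le2$ or $v_p(c)\le3$. Some row of the following table applies, and each row that applies gives a $p$-integral basis. In rows 7 and 8, $s$ is any regular integer divisible by $p$ (such an $s$ exists), $u_0=v_2(f(s))$ and $u_1=v_2(f'(s))$. An empty cell means no condition. | row | $v_p(c)$ | $v_p(b)$ | $v_p(a)$ | $p$ | $\nu$ | basis | |---|---|---|---|---|---|---| | 1 | $1$ | | | | |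 $1,\theta,\theta^2,\theta^3$ | | 2 | $>1$ | $1$ | | | | $1,\theta,\theta^2,\theta^3/p$ | | 3 | $2$ | $>1$ | $1$ | $>2$ | $\frac12\min\{v_p(b),v_p(a^2-4c)\}$ | $1,\theta,\frac{\theta^2+a/2}{p^{\lfloor\nu\rfloor}},\frac{\theta^3+(a/2)\theta}{p^{\lfloor\nu+1/2\rfloor}}$ | | 4 | $2$ | $>1$ | $1$ | $2$ | | $1,\theta,\theta^2/2,\theta^3/2$ | | 5 | $2$ | $>1$ | $>1$ | $>2$ | | $1,\theta,\theta^2/p,\theta^3/p$ | | 6 | $2$ | $>1$ | $>1$ | $2$ | below | $1,\theta,\frac{Q(\theta)}{2^{\lfloor\nu\rfloor}},\frac{\theta Q(\theta)}{2^{\lfloor\nu+1/2\rfloor}}$, $Q$ below | | 7 | $>2$ | $>1$ | $1$ | $>2$ | $\lfloor(\Delta-1)/2\rfloor-1$ | $1,\theta,\theta^2/p,\alpha_s/p^\nu$ | | 8 | $>2$ | $>1$ | $1$ | $2$ | $\lfloor\min\{\frac12(u_0+1),u_1\}\rfloor$ | $1,\theta,\theta^2/2,\alpha_s/2^\nu$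 | | 9 | $>2$ | $2$ | $>1$ | | | $1,\theta,\theta^2/p,\theta^3/p^2$ | | 10 | $3$ | $>2$ | $>1$ | | | $1,\theta,\theta^2/p,\theta^3/p^2$ | In row 6, $Q$ and $\nu$ are: | $v_2(a)$ | $v_2(b)$ | $v_2(2a+c-4)$ | $v_2(2a+b)$ | $Q(x)$ | $\nu$ | |---|---|---|---|---|---| | | $2$ | | | $x^2$ | $5/4$ | | | $3$ | $3$ | | $x^2+2$ | $7/4$ | | $2$ | $3$ | $\ge4$ | | $x^2+2x+2$ | $2$ | | $\ge3$ | $3$ | $\ge4$ | | $x^2+2$ | $7/4$ | | $2$ | $\ge4$ | $\ge4$ | | $x^2+2$ | $7/4$ | | $2$ | $\ge4$ | $3$ | | next table | next table | | $\ge3$ | $\ge4$ | $3$ | | $x^2+2$ | $2$ | | $\ge3$ | $\ge4$ | $4$ | $>4$ | $x^2+2x+2$ | $9/4$ | | $\ge3$ | $\ge4$ | $4$ | $4$ | $x^2+2x-2$ | $5/2$ | | $\ge3$ | $\ge4$ | $\ge5$ | $4$ | $x^2+2x+2$ | $9/4$ | | $\ge3$ | $\ge4$ | $\ge5$ | $>4$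 | $x^2+2x+2$ | $5/2$ | If $v_2(a)=2$, $v_2(b)\ge4$, $v_2(2a+c-4)=3$, put $u=v_2(b)$, $v=v_2(c-a^2/4)$ and $d=(c-a^2/4)/2^v$ modulo $4$: | $u,v$ | $d$ mod $4$ | $Q(x)$ | $\nu$ | |---|---|---|---| | $u\le v$ | | $x^2+\frac a2$ | $\frac{2u+1}4$ | | $u-1=v=2w$ | $-1$ | $x^2+\frac a2+2^w$ | $w+\frac34$ | | $u-1>v=2w$ | $-1$ | $x^2+\frac a2+2^w$ | $w+1$ | | $u-1=v=2w$ | $1$ | $x^2+2^wx+\frac a2+2^w$ | $w+1$ | | $u-1>v=2w$ | $1$ | $x^2+\frac a2+2^w$ | $w+\frac34$ | | $u-1=v=2w+1$, $w\ge3$ | $\frac a4$ | $x^2+2^wx+\frac a2$ | $w+\frac54$ | | $u-1>v=2w+1$, $w\ge3$ | $\frac a4$ | $x^2+2^wx+\frac a2$ | $w+\frac32$ | | $u-1=v=2w+1$, $w\ge3$ | $-\frac a4$ | $x^2+2^wx+\frac a2+2^{w+1}$ | $w+\frac32$ | | $u-1>v=2w+1$, $w\ge3$ | $-\frac a4$ |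 $x^2+2^wx+\frac a2$ | $w+\frac54$ | | $u-1>v=5$ | $\frac a4$ | $x^2+4x+\frac a2$ | $\frac{13}4$ | | $u-1=v=5$ | $\frac a4$ | $x^2+4x+\frac a2$ | $\frac72$ | | $u-1>v=5$ | $-\frac a4$ | $x^2+4x+\frac a2+8$ | $\frac72$ | | $u-1=v=5$ | $-\frac a4$ | $x^2+4x+\frac a2$ | $\frac{13}4$ | (Always $v\ge 4$ when $u>v$ here, so that $w\ge2$ in all rows.) -/

import Mathlib

open Polynomial

/-- The quartic polynomial `x⁴ + a x² + b x + c`. -/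
noncomputable def quartic (a b c : ℤ) : ℤ[X] := X ^ 4 + C a * X ^ 2 + C b * X + C c

/-- The `p`-adic valuation on `ℤ`, with values in `ℕ ∪ {∞}` and `v_p(0) = ∞`. -/
noncomputable def vp (p : ℕ) (x : ℤ) : ℕ∞ := emultiplicity (p : ℤ) x

/-- `½ · min {x, y}`, as a rational number. It is only used where the minimum is finite. -/
noncomputable def halfMin (x y : ℕ∞) : ℚ := ((min x y).toNat : ℚ) / 2

/-- `Δ = v_p(disc f)`. It is only used for `f` with `disc f ≠ 0`. -/
noncomputable def discVal (p : ℕ) (f : ℤ[X]) : ℕ := (vp p f.discr).toNat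

/-- The family `v` is a `p`-integral basis of the number field `K`: it is a `ℚ`-linearly
independent family, and its `ℤ_(p)`-span is `ℤ_K ⊗ ℤ_(p)`, viewed inside `K` as the set of all
`x` such that `m x` is an algebraic integer for some natural number `m` prime to `p`.
The elements of `ℤ_(p)` are the rational numbers whose denominator is prime to `p`. -/
def IsPIntegralBasis (p : ℕ) {K : Type*} [Field K] [NumberField K] {ι : Type*} [Fintype ι]
    (v : ι → K) : Prop :=
  LinearIndependent ℚ v ∧
    ∀ x : K, (∃ m : ℕ, ¬ p ∣ m ∧ IsIntegral ℤ ((m : K) * x)) ↔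
      ∃ r : ι → ℚ, (∀ i, ¬ p ∣ (r i).den) ∧ x = ∑ i, r i • v i

/-! ### Newton polygons with respect to `x - s` -/

/-- The coefficient `a_i` in the `(x - s)`-adic development `f = ∑ a_i (x - s)^i`. -/
noncomputable def devCoeff (f : ℤ[X]) (s : ℤ) (i : ℕ) : ℤ := (taylor s f).coeff i

/-- The ordinate `u_i = v_p(a_i)` of the `i`-th point of the `(x - s)`-Newton polygon. -/
noncomputable def devVal (p : ℕ) (f : ℤ[X]) (s : ℤ) (i : ℕ) : ℕ∞ := vp p (devCoeff f s i)

/-- The lower convex envelope of the points `(k, u_k)` has a side of negative slope `-h/e`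
(in lowest terms) whose end points have abscissas `i < j`: both end points lie on a common line
of that slope, no point lies below this line, and no point outside of the segment lies on it. -/
structure IsPrincipalSide (p : ℕ) (f : ℤ[X]) (s : ℤ) (i j h e : ℕ) : Prop where
  lt : i < j
  h_pos : 0 < h
  e_pos : 0 < e
  coprime : Nat.Coprime h e
  finite_left : devVal p f s i ≠ ⊤
  finite_right : devVal p f s j ≠ ⊤
  on_line : (e : ℕ∞) * devVal p f s j + (h * j : ℕ) = e * devVal p f s i + (h * i : ℕ)
  above : ∀ k : ℕ, (e : ℕ∞) * devVal p f s i + (h * i : ℕ) ≤ e * devVal p f s k + (h * k : ℕ)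
  strictly_above : ∀ k : ℕ, k < i ∨ j < k →
    (e : ℕ∞) * devVal p f s i + (h * i : ℕ) < e * devVal p f s k + (h * k : ℕ)

open Classical in
/-- The residual coefficient `c_k ∈ 𝔽_p` at an abscissa `k` of the side of slope `-h/e` that
starts at the abscissa `i`: it is `a_k / p ^ u_k` modulo `p` if the point `(k, u_k)` lies on the
side, and `0` if this point lies strictly above the side. -/
noncomputable def residualCoeff (p : ℕ) (f : ℤ[X]) (s : ℤ) (i h e k : ℕ) : ZMod p :=
  if (e : ℕ∞) * devVal p f s k + (h * k : ℕ) = e * devVal p f s i + (h * i : ℕ) then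
    ((devCoeff f s k / (p : ℤ) ^ (devVal p f s k).toNat : ℤ) : ZMod p)
  else 0

/-- The residual polynomial `c_i + c_{i+e} y + ⋯ + c_{i+de} y^d`, `d = (j - i) / e`, of the side
of slope `-h/e` with end points of abscissas `i` and `j`. -/
noncomputable def residualPoly (p : ℕ) (f : ℤ[X]) (s : ℤ) (i j h e : ℕ) : (ZMod p)[X] :=
  ∑ k ∈ Finset.range ((j - i) / e + 1), C (residualCoeff p f s i h e (i + k * e)) * X ^ k

/-- The integer `s` is regular (for `f` and `p`): `f` is `(x - s)`-regular, that is, the residual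
polynomial of every side of the principal `(x - s)`-polygon of `f` is separable. -/
def IsRegularInt (p : ℕ) (f : ℤ[X]) (s : ℤ) : Prop :=
  ∀ i j h e : ℕ, IsPrincipalSide p f s i j h e → (residualPoly p f s i j h e).Separable

/-! ### Factorization types modulo `p` -/

/-- `f` is modulo `p` the square of an irreducible quadratic polynomial. -/
def IsSquareOfIrredQuadMod (p : ℕ) (f : ℤ[X]) : Prop :=
  ∃ g : (ZMod p)[X], Irreducible g ∧ g.natDegree = 2 ∧ f.map (Int.castRingHom (ZMod p)) = g ^ 2

/-- `s` is modulo `p` a double root of `f`, and `f` has no other multiple factor modulo `p`. -/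
def IsOnlyDoubleRootMod (p : ℕ) (f : ℤ[X]) (s : ℤ) : Prop :=
  ∃ g : (ZMod p)[X], g.Separable ∧ g.eval (s : ZMod p) ≠ 0 ∧
    f.map (Int.castRingHom (ZMod p)) = (X - C (s : ZMod p)) ^ 2 * g

/-- `f` is modulo `p` the product of the squares of two different linear polynomials. -/
def HasTwoDoubleRootsMod (p : ℕ) (f : ℤ[X]) : Prop :=
  ∃ r t : ZMod p, r ≠ t ∧ f.map (Int.castRingHom (ZMod p)) = (X - C r) ^ 2 * (X - C t) ^ 2

/-! ### The bases -/

/-- `α = θ³ + s θ² + (a + s²) θ + s³ + a s + b`. -/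
def quotElt {K : Type*} [Field K] (a b s : ℤ) (θ : K) : K :=
  θ ^ 3 + (s : K) * θ ^ 2 + ((a : K) + (s : K) ^ 2) * θ + ((s : K) ^ 3 + (a : K) * s + b)

/-- `ν = min {v₂(f(s)) / 2, v₂(f'(s))}` for `f = x⁴ + a x² + b x + c`. -/
noncomputable def nuDouble (a b c s : ℤ) : ℚ :=
  halfMin (vp 2 ((quartic a b c).eval s)) (2 * vp 2 ((derivative (quartic a b c)).eval s))

/-- The rows of the table of bases for `p = 2` when `x⁴ + a x² + b x + c` has two double roots
modulo `2`. -/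
inductive TwoDoubleRootsRow {K : Type*} [Field K] (a b c : ℤ) (θ : K) : (Fin 4 → K) → Prop
  | row1 (hc : vp 2 c = 1) (h1 : vp 2 (a + b + c + 1) = 1) :
      TwoDoubleRootsRow a b c θ ![1, θ, θ ^ 2, θ ^ 3]
  | row2 (hc : vp 2 c = 1) (h1 : 1 < vp 2 (a + b + c + 1))
      (s : ℤ) (hs : Odd s) (hreg : IsRegularInt 2 (quartic a b c) s) :
      TwoDoubleRootsRow a b c θ
        ![1, θ, θ ^ 2, quotElt a b s θ / 2 ^ ⌊nuDouble a b c s⌋₊]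
  | row3 (hc : 1 < vp 2 c) (h1 : vp 2 (a + b + c + 1) = 1)
      (s : ℤ) (hs : Even s) (hreg : IsRegularInt 2 (quartic a b c) s) :
      TwoDoubleRootsRow a b c θ
        ![1, θ, θ ^ 2, quotElt a b s θ / 2 ^ ⌊nuDouble a b c s⌋₊]
  | row4 (hc : 1 < vp 2 c) (h1 : 1 < vp 2 (a + b + c + 1))
      (s : ℤ) (hs1 : a ≡ 1 [ZMOD 4] → Odd s) (hs3 : a ≡ 3 [ZMOD 4] → Even s)
      (hreg : IsRegularInt 2 (quartic a b c) s) :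
      TwoDoubleRootsRow a b c θ
        ![1, θ, (θ ^ 2 + θ) / 2, quotElt a b s θ / 2 ^ ⌊nuDouble a b c s⌋₊]

/-- The integer `D = c - a²/4` (the division is exact where this is used, `a` being even). -/
def redConst (a c : ℤ) : ℤ := c - (a / 2) ^ 2

/-- The polynomials `Q` and the rational numbers `ν` of the irregular case
`p = 2`, `v₂(a) > 1`, `v₂(b) > 1`, `v₂(c) = 2`.

The rows `sub*` are the subcase `v₂(a) = 2`, `v₂(b) ≥ 4`, `v₂(2a + c - 4) = 3`. In their
hypotheses `u = v₂(b)`, `v = v₂(D)` and `d = D / 2^v`, where `D = c - a²/4`; the divisions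
`a / 2`, `a / 4` and `D / 2^v` are exact. -/
inductive IrregularRow (a b c : ℤ) : ℤ[X] → ℚ → Prop
  | row1 (hb : vp 2 b = 2) : IrregularRow a b c (X ^ 2) (5 / 4)
  | row2 (hb : vp 2 b = 3) (h : vp 2 (2 * a + c - 4) = 3) :
      IrregularRow a b c (X ^ 2 + 2) (7 / 4)
  | row3 (ha : vp 2 a = 2) (hb : vp 2 b = 3) (h : 4 ≤ vp 2 (2 * a + c - 4)) :
      IrregularRow a b c (X ^ 2 + 2 * X + 2) 2
  | row4 (ha : 3 ≤ vp 2 a) (hb : vp 2 b = 3) (h : 4 ≤ vp 2 (2 * a + c - 4)) :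
      IrregularRow a b c (X ^ 2 + 2) (7 / 4)
  | row5 (ha : vp 2 a = 2) (hb : 4 ≤ vp 2 b) (h : 4 ≤ vp 2 (2 * a + c - 4)) :
      IrregularRow a b c (X ^ 2 + 2) (7 / 4)
  | row7 (ha : 3 ≤ vp 2 a) (hb : 4 ≤ vp 2 b) (h : vp 2 (2 * a + c - 4) = 3) :
      IrregularRow a b c (X ^ 2 + 2) 2
  | row8 (ha : 3 ≤ vp 2 a) (hb : 4 ≤ vp 2 b) (h : vp 2 (2 * a + c - 4) = 4)
      (h' : 4 < vp 2 (2 * a + b)) :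
      IrregularRow a b c (X ^ 2 + 2 * X + 2) (9 / 4)
  | row9 (ha : 3 ≤ vp 2 a) (hb : 4 ≤ vp 2 b) (h : vp 2 (2 * a + c - 4) = 4)
      (h' : vp 2 (2 * a + b) = 4) :
      IrregularRow a b c (X ^ 2 + 2 * X - 2) (5 / 2)
  | row10 (ha : 3 ≤ vp 2 a) (hb : 4 ≤ vp 2 b) (h : 5 ≤ vp 2 (2 * a + c - 4))
      (h' : vp 2 (2 * a + b) = 4) :
      IrregularRow a b c (X ^ 2 + 2 * X + 2) (9 / 4)
  | row11 (ha : 3 ≤ vp 2 a) (hb : 4 ≤ vp 2 b) (h : 5 ≤ vp 2 (2 * a + c - 4))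
      (h' : 4 < vp 2 (2 * a + b)) :
      IrregularRow a b c (X ^ 2 + 2 * X + 2) (5 / 2)
  | sub1 (ha : vp 2 a = 2) (hb : 4 ≤ vp 2 b) (h : vp 2 (2 * a + c - 4) = 3)
      (u : ℕ) (hu : vp 2 b = u) (huv : (u : ℕ∞) ≤ vp 2 (redConst a c)) :
      IrregularRow a b c (X ^ 2 + C (a / 2)) ((2 * u + 1) / 4)
  | sub2 (ha : vp 2 a = 2) (hb : 4 ≤ vp 2 b) (h : vp 2 (2 * a + c - 4) = 3)
      (w : ℕ) (hv : vp 2 (redConst a c) = (2 * w : ℕ)) (hu : vp 2 b = (2 * w + 1 : ℕ))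
      (hd : redConst a c / 2 ^ (2 * w) ≡ -1 [ZMOD 4]) :
      IrregularRow a b c (X ^ 2 + C (a / 2 + 2 ^ w)) (w + 3 / 4)
  | sub3 (ha : vp 2 a = 2) (hb : 4 ≤ vp 2 b) (h : vp 2 (2 * a + c - 4) = 3)
      (w : ℕ) (hv : vp 2 (redConst a c) = (2 * w : ℕ)) (hu : (2 * w + 1 : ℕ) < vp 2 b)
      (hd : redConst a c / 2 ^ (2 * w) ≡ -1 [ZMOD 4]) :
      IrregularRow a b c (X ^ 2 + C (a / 2 + 2 ^ w)) (w + 1)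
  | sub4 (ha : vp 2 a = 2) (hb : 4 ≤ vp 2 b) (h : vp 2 (2 * a + c - 4) = 3)
      (w : ℕ) (hv : vp 2 (redConst a c) = (2 * w : ℕ)) (hu : vp 2 b = (2 * w + 1 : ℕ))
      (hd : redConst a c / 2 ^ (2 * w) ≡ 1 [ZMOD 4]) :
      IrregularRow a b c (X ^ 2 + C (2 ^ w) * X + C (a / 2 + 2 ^ w)) (w + 1)
  | sub5 (ha : vp 2 a = 2) (hb : 4 ≤ vp 2 b) (h : vp 2 (2 * a + c - 4) = 3)
      (w : ℕ) (hv : vp 2 (redConst a c) = (2 * w : ℕ)) (hu : (2 * w + 1 : ℕ) < vp 2 b)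
      (hd : redConst a c / 2 ^ (2 * w) ≡ 1 [ZMOD 4]) :
      IrregularRow a b c (X ^ 2 + C (a / 2 + 2 ^ w)) (w + 3 / 4)
  | sub6 (ha : vp 2 a = 2) (hb : 4 ≤ vp 2 b) (h : vp 2 (2 * a + c - 4) = 3)
      (w : ℕ) (hw : 3 ≤ w) (hv : vp 2 (redConst a c) = (2 * w + 1 : ℕ))
      (hu : vp 2 b = (2 * w + 2 : ℕ))
      (hd : redConst a c / 2 ^ (2 * w + 1) ≡ a / 4 [ZMOD 4]) :
      IrregularRow a b c (X ^ 2 + C (2 ^ w) * X + C (a / 2)) (w + 5 / 4)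
  | sub7 (ha : vp 2 a = 2) (hb : 4 ≤ vp 2 b) (h : vp 2 (2 * a + c - 4) = 3)
      (w : ℕ) (hw : 3 ≤ w) (hv : vp 2 (redConst a c) = (2 * w + 1 : ℕ))
      (hu : (2 * w + 2 : ℕ) < vp 2 b)
      (hd : redConst a c / 2 ^ (2 * w + 1) ≡ a / 4 [ZMOD 4]) :
      IrregularRow a b c (X ^ 2 + C (2 ^ w) * X + C (a / 2)) (w + 3 / 2)
  | sub8 (ha : vp 2 a = 2) (hb : 4 ≤ vp 2 b) (h : vp 2 (2 * a + c - 4) = 3)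
      (w : ℕ) (hw : 3 ≤ w) (hv : vp 2 (redConst a c) = (2 * w + 1 : ℕ))
      (hu : vp 2 b = (2 * w + 2 : ℕ))
      (hd : redConst a c / 2 ^ (2 * w + 1) ≡ -(a / 4) [ZMOD 4]) :
      IrregularRow a b c (X ^ 2 + C (2 ^ w) * X + C (a / 2 + 2 ^ (w + 1))) (w + 3 / 2)
  | sub9 (ha : vp 2 a = 2) (hb : 4 ≤ vp 2 b) (h : vp 2 (2 * a + c - 4) = 3)
      (w : ℕ) (hw : 3 ≤ w) (hv : vp 2 (redConst a c) = (2 * w + 1 : ℕ))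
      (hu : (2 * w + 2 : ℕ) < vp 2 b)
      (hd : redConst a c / 2 ^ (2 * w + 1) ≡ -(a / 4) [ZMOD 4]) :
      IrregularRow a b c (X ^ 2 + C (2 ^ w) * X + C (a / 2)) (w + 5 / 4)
  -- the case `v = 5`, that is `w = 2`
  | sub6_five (ha : vp 2 a = 2) (hb : 6 < vp 2 b) (h : vp 2 (2 * a + c - 4) = 3)
      (hv : vp 2 (redConst a c) = 5) (hd : redConst a c / 2 ^ 5 ≡ a / 4 [ZMOD 4]) :
      IrregularRow a b c (X ^ 2 + 4 * X + C (a / 2)) (2 + 5 / 4)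
  | sub7_five (ha : vp 2 a = 2) (hb : vp 2 b = 6) (h : vp 2 (2 * a + c - 4) = 3)
      (hv : vp 2 (redConst a c) = 5) (hd : redConst a c / 2 ^ 5 ≡ a / 4 [ZMOD 4]) :
      IrregularRow a b c (X ^ 2 + 4 * X + C (a / 2)) (2 + 3 / 2)
  | sub8_five (ha : vp 2 a = 2) (hb : 6 < vp 2 b) (h : vp 2 (2 * a + c - 4) = 3)
      (hv : vp 2 (redConst a c) = 5) (hd : redConst a c / 2 ^ 5 ≡ -(a / 4) [ZMOD 4]) :
      IrregularRow a b c (X ^ 2 + 4 * X + C (a / 2 + 8)) (2 + 3 / 2)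
  | sub9_five (ha : vp 2 a = 2) (hb : vp 2 b = 6) (h : vp 2 (2 * a + c - 4) = 3)
      (hv : vp 2 (redConst a c) = 5) (hd : redConst a c / 2 ^ 5 ≡ -(a / 4) [ZMOD 4]) :
      IrregularRow a b c (X ^ 2 + 4 * X + C (a / 2)) (2 + 5 / 4)

/-- The rows of the table of bases when `p` divides `a`, `b` and `c`. -/
inductive QuadrupleRootRow (p : ℕ) {K : Type*} [Field K] (a b c : ℤ) (θ : K) :
    (Fin 4 → K) → Prop
  | row1 (hc : vp p c = 1) : QuadrupleRootRow p a b c θ ![1, θ, θ ^ 2, θ ^ 3]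
  | row2 (hc : 1 < vp p c) (hb : vp p b = 1) :
      QuadrupleRootRow p a b c θ ![1, θ, θ ^ 2, θ ^ 3 / p]
  | row3 (hc : vp p c = 2) (hb : 1 < vp p b) (ha : vp p a = 1) (hp : 2 < p)
      (ν : ℚ) (hν : ν = halfMin (vp p b) (vp p (a ^ 2 - 4 * c))) :
      QuadrupleRootRow p a b c θ
        ![1, θ, (θ ^ 2 + (a : K) / 2) / (p : K) ^ ⌊ν⌋₊,
          (θ ^ 3 + (a : K) / 2 * θ) / (p : K) ^ ⌊ν + 1 / 2⌋₊]
  | row4 (hc : vp p c = 2) (hb : 1 < vp p b) (ha : vp p a = 1) (hp : p = 2) :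
      QuadrupleRootRow p a b c θ ![1, θ, θ ^ 2 / 2, θ ^ 3 / 2]
  | row5 (hc : vp p c = 2) (hb : 1 < vp p b) (ha : 1 < vp p a) (hp : 2 < p) :
      QuadrupleRootRow p a b c θ ![1, θ, θ ^ 2 / p, θ ^ 3 / p]
  | row6 (hc : vp p c = 2) (hb : 1 < vp p b) (ha : 1 < vp p a) (hp : p = 2)
      (Q : ℤ[X]) (ν : ℚ) (hQ : IrregularRow a b c Q ν) :
      QuadrupleRootRow p a b c θ
        ![1, θ, aeval θ Q / 2 ^ ⌊ν⌋₊, θ * aeval θ Q / 2 ^ ⌊ν + 1 / 2⌋₊]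
  | row7 (hc : 2 < vp p c) (hb : 1 < vp p b) (ha : vp p a = 1) (hp : 2 < p)
      (s : ℤ) (hs : (p : ℤ) ∣ s) (hreg : IsRegularInt p (quartic a b c) s) :
      QuadrupleRootRow p a b c θ
        ![1, θ, θ ^ 2 / p,
          quotElt a b s θ / (p : K) ^ ((discVal p (quartic a b c) - 1) / 2 - 1)]
  | row8 (hc : 2 < vp p c) (hb : 1 < vp p b) (ha : vp p a = 1) (hp : p = 2)
      (s : ℤ) (hs : (p : ℤ) ∣ s) (hreg : IsRegularInt p (quartic a b c) s)
      (ν : ℚ) (hν : ν = halfMin (vp 2 ((quartic a b c).eval s) + 1)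
        (2 * vp 2 ((derivative (quartic a b c)).eval s))) :
      QuadrupleRootRow p a b c θ ![1, θ, θ ^ 2 / 2, quotElt a b s θ / 2 ^ ⌊ν⌋₊]
  | row9 (hc : 2 < vp p c) (hb : vp p b = 2) (ha : 1 < vp p a) :
      QuadrupleRootRow p a b c θ ![1, θ, θ ^ 2 / p, θ ^ 3 / p ^ 2]
  | row10 (hc : vp p c = 3) (hb : 2 < vp p b) (ha : 1 < vp p a) :
      QuadrupleRootRow p a b c θ ![1, θ, θ ^ 2 / p, θ ^ 3 / p ^ 2]

/-! A family 1, v₁, v₂, v₃ that spans a ring L of algebraic integers is a p-integral basis exactly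
when L is p-maximal, and p-maximality is tested as in the Round 2 method of Zassenhaus. Let I be an
ideal of L that contains pL and is radical (x² ∈ I implies x ∈ I). Suppose some x integral at p lies
outside L. Multiplying by powers of p and of elements e ∈ I that are nilpotent modulo p, one reaches
an x ∉ L with px ∈ L and all ex ∈ L. An integral equation of x shows that powers of px and ex (up to
an integer prime to p) lie in I, so px and ex lie in I. Hence l = px satisfies l ∈ I and el ∈ pI; if
this forces l ∈ pL, then x ∈ L, a contradiction. In coordinates this is linear algebra modulo p and
p² on a multiplication table, stated in `isPIntegralBasis_of_mulTable`.

The bases of the theorem come from three kinds of tables. Towers: for a monic quadratic φ put ψ =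
φ(θ)/pᵐ. The φ-adic development of f, divided by p²ᵐ, is a quadratic equation for ψ over ℤ[θ], and
its reduction tells whether ψ (or θψ/p) is a unit generating a separable residue algebra, or a
uniformizer. This gives (1), (2) and rows 3–6 of (5). In the irregular tables Q is such a φ,
possibly changed by an element that does not affect the span, and the fractional part of ν =
v₂(φ(θ)) selects the type of tower. Quotients: with y = θ − s the element δ = (f(θ) − f(s))/(Py) has
integral products with the other basis elements when v(f(s)) and v(f'(s)) are large enough. This
gives (3), (4) and rows 7, 8 of (5). Powers of θ divided by powers of p: these suffice in rows 1, 2,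
9, 10 of (5), where the Newton polygon at 0 already determines the order.

Regularity of s is translated into two explicit alternatives, `UnramifiedShift` and `RamifiedShift`,
on f(s) and f'(s). Regular shifts exist (`exists_shift`): while neither alternative holds, the
quadratic part of f at s has a double root modulo p, and translating s by it raises the valuations.
An infinite process would make disc f divisible by every power of p. The exponents involving Δ come
from writing disc f in the Taylor coefficients of f at s (`discr_quartic_shift`), where it has the
shape f(s)·X + f'(s)²·Y. -/

/-! ### Rings with a multiplication table, and elements that are integral at p -/

section Core

variable {K : Type*} [Field K]

/-- `x` is integral at `p`: some multiple of `x` by an integer prime to `p` is integral. -/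
def PInt (p : ℕ) (x : K) : Prop := ∃ m : ℕ, ¬ p ∣ m ∧ IsIntegral ℤ ((m : K) * x)

/-- The element with integer coordinates `x` in the family `1, v₁, v₂, v₃`. -/
def evalCoord (v₁ v₂ v₃ : K) (x : Fin 4 → ℤ) : K :=
  (x 0 : K) + (x 1 : K) * v₁ + (x 2 : K) * v₂ + (x 3 : K) * v₃

/-- A multiplication table for a family `1, v₁, v₂, v₃`: the coordinates of the products. -/
structure MulTable where
  t11 : Fin 4 → ℤ
  t12 : Fin 4 → ℤ
  t13 : Fin 4 → ℤ
  t22 : Fin 4 → ℤ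
  t23 : Fin 4 → ℤ
  t33 : Fin 4 → ℤ

/-- Multiplication of coordinate vectors. -/
def MulTable.mul (t : MulTable) (x y : Fin 4 → ℤ) : Fin 4 → ℤ := fun i =>
  (![x 0 * y 0, x 0 * y 1 + x 1 * y 0, x 0 * y 2 + x 2 * y 0, x 0 * y 3 + x 3 * y 0] : Fin 4 → ℤ) i
    + x 1 * y 1 * t.t11 i + (x 1 * y 2 + x 2 * y 1) * t.t12 i + (x 1 * y 3 + x 3 * y 1) * t.t13 i
    + x 2 * y 2 * t.t22 i + (x 2 * y 3 + x 3 * y 2) * t.t23 i + x 3 * y 3 * t.t33 i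

/-- The table `t` describes the products of the elements `v₁, v₂, v₃`. -/
structure MulTable.Holds (t : MulTable) (v₁ v₂ v₃ : K) : Prop where
  h11 : v₁ * v₁ = evalCoord v₁ v₂ v₃ t.t11
  h12 : v₁ * v₂ = evalCoord v₁ v₂ v₃ t.t12
  h13 : v₁ * v₃ = evalCoord v₁ v₂ v₃ t.t13
  h22 : v₂ * v₂ = evalCoord v₁ v₂ v₃ t.t22
  h23 : v₂ * v₃ = evalCoord v₁ v₂ v₃ t.t23
  h33 : v₃ * v₃ = evalCoord v₁ v₂ v₃ t.t33

lemma MulTable.Holds.eval_mul {t : MulTable} {v₁ v₂ v₃ : K} (h : t.Holds v₁ v₂ v₃)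
    (x y : Fin 4 → ℤ) :
    evalCoord v₁ v₂ v₃ (t.mul x y) = evalCoord v₁ v₂ v₃ x * evalCoord v₁ v₂ v₃ y := by
  have h11 := h.h11
  have h12 := h.h12
  have h13 := h.h13
  have h22 := h.h22
  have h23 := h.h23
  have h33 := h.h33
  simp only [evalCoord, MulTable.mul, Matrix.cons_val] at *
  push_cast
  linear_combination -(x 1 * y 1 : K) * h11 - (x 1 * y 2 + x 2 * y 1 : K) * h12
    - (x 1 * y 3 + x 3 * y 1 : K) * h13 - (x 2 * y 2 : K) * h22 - (x 2 * y 3 + x 3 * y 2 : K) * h23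
    - (x 3 * y 3 : K) * h33

lemma evalCoord_add (v₁ v₂ v₃ : K) (x y : Fin 4 → ℤ) :
    evalCoord v₁ v₂ v₃ (x + y) = evalCoord v₁ v₂ v₃ x + evalCoord v₁ v₂ v₃ y := by
  simp only [evalCoord, Pi.add_apply]; push_cast; ring

lemma evalCoord_smul (v₁ v₂ v₃ : K) (n : ℤ) (x : Fin 4 → ℤ) :
    evalCoord v₁ v₂ v₃ (n • x) = n * evalCoord v₁ v₂ v₃ x := by
  simp only [evalCoord, Pi.smul_apply, smul_eq_mul]; push_cast; ring

/-- The subring with basis `1, v₁, v₂, v₃`. -/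
def MulTable.Holds.subring {t : MulTable} {v₁ v₂ v₃ : K} (h : t.Holds v₁ v₂ v₃) : Subring K where
  carrier := Set.range (evalCoord v₁ v₂ v₃)
  mul_mem' := by
    rintro _ _ ⟨x, rfl⟩ ⟨y, rfl⟩
    exact ⟨_, h.eval_mul x y⟩
  one_mem' := ⟨![1, 0, 0, 0], by simp [evalCoord]⟩
  add_mem' := by
    rintro _ _ ⟨x, rfl⟩ ⟨y, rfl⟩
    exact ⟨_, evalCoord_add _ _ _ x y⟩
  zero_mem' := ⟨0, by simp [evalCoord]⟩
  neg_mem' := by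
    rintro _ ⟨x, rfl⟩
    exact ⟨(-1 : ℤ) • x, by rw [evalCoord_smul]; simp⟩

/-- The ring spanned by 1, v₁, v₂, v₃ is a finitely generated ℤ-module, so all its elements are
integral. -/
lemma MulTable.Holds.isIntegral {t : MulTable} {v₁ v₂ v₃ : K} (h : t.Holds v₁ v₂ v₃)
    (n : Fin 4 → ℤ) : IsIntegral ℤ (evalCoord v₁ v₂ v₃ n) := by
  let A : Subalgebra ℤ K := subalgebraOfSubring h.subring
  have hA : A.toSubmodule.FG := by
    refine Submodule.fg_def.2 ⟨{1, v₁, v₂, v₃}, by simp, le_antisymm ?_ ?_⟩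
    · rw [Submodule.span_le]
      intro x hx
      simp only [Set.mem_insert_iff, Set.mem_singleton_iff] at hx
      rcases hx with rfl | rfl | rfl | rfl
      · exact ⟨![1, 0, 0, 0], by simp [evalCoord]⟩
      · exact ⟨![0, 1, 0, 0], by simp [evalCoord]⟩
      · exact ⟨![0, 0, 1, 0], by simp [evalCoord]⟩
      · exact ⟨![0, 0, 0, 1], by simp [evalCoord]⟩
    · rintro _ ⟨n, rfl⟩
      have : evalCoord v₁ v₂ v₃ n = n 0 • (1 : K) + n 1 • v₁ + n 2 • v₂ + n 3 • v₃ := by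
        simp [evalCoord]
      rw [this]
      refine add_mem (add_mem (add_mem ?_ ?_) ?_) ?_ <;>
      · refine Submodule.smul_mem _ _ (Submodule.subset_span ?_)
        simp
  exact IsIntegral.of_mem_of_fg A hA _ ⟨n, rfl⟩

lemma PInt.mul_isIntegral {p : ℕ} {x e : K} (hx : PInt p x) (he : IsIntegral ℤ e) :
    PInt p (e * x) := by
  obtain ⟨m, hm, h⟩ := hx
  exact ⟨m, hm, by rw [mul_left_comm]; exact he.mul h⟩

lemma PInt.pow_mul_isIntegral {p : ℕ} {x e : K} (hx : PInt p x) (he : IsIntegral ℤ e) (n : ℕ) :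
    PInt p (e ^ n * x) := hx.mul_isIntegral (he.pow n)

/-- The least n with eⁿx ∈ L is positive because x ∉ L; take j = n − 1. -/
lemma exists_pow_mul_notMem (L : Subring K) {x e : K} (hx : x ∉ L) {N : ℕ} (h : e ^ N * x ∈ L) :
    ∃ j, e ^ j * x ∉ L ∧ e * (e ^ j * x) ∈ L := by
  classical
  have hex : ∃ n, e ^ n * x ∈ L := ⟨N, h⟩
  have h0 : Nat.find hex ≠ 0 := by
    intro h0
    have := Nat.find_spec hex
    rw [h0] at this
    exact hx (by simpa using this)
  obtain ⟨j, hj⟩ := Nat.exists_eq_succ_of_ne_zero h0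
  refine ⟨j, Nat.find_min hex (by omega), ?_⟩
  have := Nat.find_spec hex
  rw [hj, pow_succ] at this
  rwa [← mul_assoc, mul_comm e]

/-- If `x` is integral at `p` but outside of `L`, then it has a multiple outside of `L` that is
moved into `L` by `p` and by finitely many given elements that are nilpotent modulo `p L`. -/
lemma exists_notMem_forall_mul_mem {p : ℕ} (L : Subring K) (hL : ∀ x ∈ L, IsIntegral ℤ x)
    {x : K} (hx : PInt p x) (hxL : x ∉ L) {N : ℕ} (hN : (p : K) ^ N * x ∈ L) (E : List K)
    (hEL : ∀ e ∈ E, e ∈ L) (hE : ∀ e ∈ E, ∃ M : ℕ, ∃ k ∈ L, e ^ M = p * k) :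
    ∃ x', PInt p x' ∧ x' ∉ L ∧ (p : K) * x' ∈ L ∧ ∀ e ∈ E, e * x' ∈ L := by
  induction E with
  | nil =>
    obtain ⟨j, h1, h2⟩ := exists_pow_mul_notMem L hxL hN
    exact ⟨_, hx.pow_mul_isIntegral (hL _ (natCast_mem L p)) j, h1, h2, by simp⟩
  | cons e E ih =>
    obtain ⟨y, hy, hyL, hpy, hEy⟩ := ih (fun e' he' => hEL e' (List.mem_cons_of_mem _ he'))
      (fun e' he' => hE e' (List.mem_cons_of_mem _ he'))
    have heL := hEL e (by simp)
    obtain ⟨M, k, hk, hM⟩ := hE e (by simp)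
    have h : e ^ M * y ∈ L := by
      rw [hM, mul_comm (p : K), mul_assoc]
      exact L.mul_mem hk hpy
    obtain ⟨j, h1, h2⟩ := exists_pow_mul_notMem L hyL h
    refine ⟨_, hy.pow_mul_isIntegral (hL _ heL) j, h1, ?_, ?_⟩
    · rw [mul_left_comm]
      exact L.mul_mem (L.pow_mem heL j) hpy
    · intro e' he'
      rcases List.mem_cons.1 he' with rfl | he'
      · exact h2
      · rw [mul_left_comm]
        exact L.mul_mem (L.pow_mem heL j) (hEy e' he')

/-- From yⁿ ∈ I one gets (y^⌈n/2⌉)² ∈ I, hence y^⌈n/2⌉ ∈ I, and the exponent descends to 1. -/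
lemma mem_of_sq_mem {I : Set K} (L : Subring K) (hIL : ∀ x ∈ L, ∀ y ∈ I, x * y ∈ I)
    (hsq : ∀ x ∈ L, x * x ∈ I → x ∈ I) {y : K} (hy : y ∈ L) {n : ℕ} (h : y ^ n ∈ I) :
    y ∈ I := by
  induction n using Nat.strong_induction_on with
  | _ n ih =>
    rcases Nat.lt_or_ge n 2 with hn | hn
    · interval_cases n
      · simpa using hIL y hy _ h
      · simpa using h
    · refine ih ((n + 1) / 2) (by omega) (hsq _ (L.pow_mem hy _) ?_)
      rw [← pow_add]
      obtain h' | h' : (n + 1) / 2 + (n + 1) / 2 = n ∨ (n + 1) / 2 + (n + 1) / 2 = n + 1 := by omega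
      · rwa [h']
      · rw [h', pow_succ']
        exact hIL y hy _ h

/-- If `x` is integral at `p` and `e x ∈ L` for an element `e` of a radical ideal `I ∋ p` of `L`,
then `e x ∈ I`. -/
lemma mul_mem_of_pInt {p : ℕ} (hp : p.Prime) {I : Set K} (L : Subring K)
    (hI0 : (0 : K) ∈ I) (hadd : ∀ x ∈ I, ∀ y ∈ I, x + y ∈ I) (hIL : ∀ x ∈ L, ∀ y ∈ I, x * y ∈ I)
    (hpI : ∀ x ∈ L, (p : K) * x ∈ I)
    (hsq : ∀ x ∈ L, x * x ∈ I → x ∈ I) {x e : K} (hx : PInt p x) (heI : e ∈ I) (heL : e ∈ L)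
    (hex : e * x ∈ L) : e * x ∈ I := by
  obtain ⟨m, hm, q, hq, hqx⟩ := hx
  have hsum : ∀ (s : Finset ℕ) (f : ℕ → K), (∀ i ∈ s, f i ∈ I) → ∑ i ∈ s, f i ∈ I := by
    intro s f hf
    classical
    induction s using Finset.induction_on with
    | empty => simpa using hI0
    | insert a s ha ih =>
      rw [Finset.sum_insert ha]
      exact hadd _ (hf _ (by simp)) _ (ih fun i hi => hf i (by simp [hi]))
  set n := q.natDegree with hn
  set y := (m : K) * (e * x) with hy
  have hyL : y ∈ L := L.mul_mem (natCast_mem L m) hex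
  have hyn : y ^ n ∈ I := by
    have h1 : ((m : K) * x) ^ n = -∑ i ∈ Finset.range n, (q.coeff i : K) * ((m : K) * x) ^ i := by
      have h2 : eval₂ (algebraMap ℤ K) ((m : K) * x) q = 0 := hqx
      rw [eval₂_eq_sum_range, Finset.sum_range_succ, ← hn, hq.coeff_natDegree] at h2
      simp only [algebraMap_int_eq, eq_intCast, Int.cast_one, one_mul] at h2
      exact eq_neg_of_add_eq_zero_right h2
    -- Multiplying the integral equation of mx by eⁿ leaves a factor e ∈ I in every lower term.
    have h3 : y ^ n = ∑ i ∈ Finset.range n, (-(q.coeff i : K) * e ^ (n - i - 1) * y ^ i) * e := by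
      have : y = e * ((m : K) * x) := by rw [hy]; ring
      rw [this, mul_pow, h1, mul_neg, Finset.mul_sum, ← Finset.sum_neg_distrib]
      refine Finset.sum_congr rfl fun i hi => ?_
      have hi' : n = (n - i - 1) + 1 + i := by
        have := Finset.mem_range.1 hi
        omega
      rw [mul_pow e]
      conv_lhs => rw [hi', pow_add, pow_add]
      ring
    rw [h3]
    refine hsum _ _ fun i _ => hIL _ ?_ _ heI
    exact L.mul_mem (L.mul_mem (L.neg_mem (intCast_mem L _)) (L.pow_mem heL _)) (L.pow_mem hyL _)
  have hyI : y ∈ I := mem_of_sq_mem L hIL hsq hyL hyn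
  -- The integer m is invertible modulo p and p·(ex) ∈ I, so the factor m in y can be removed.
  have hcop : IsCoprime (m : ℤ) (p : ℤ) :=
    Nat.isCoprime_iff_coprime.2 ((Nat.coprime_comm.1 ((Nat.Prime.coprime_iff_not_dvd hp).2 hm)))
  obtain ⟨u, w, huw⟩ := hcop
  have huw' : (u : K) * m + w * p = 1 := by exact_mod_cast congrArg (Int.cast : ℤ → K) huw
  have : e * x = (u : K) * y + (p : K) * ((w : K) * (e * x)) := by
    rw [hy]; linear_combination -(e * x) * huw'
  rw [this]
  exact hadd _ (hIL _ (intCast_mem L _) _ hyI) _ (hpI _ (L.mul_mem (intCast_mem L _) hex))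

end Core

/-! ### The criterion for p-maximality and p-integral changes of basis -/

section Criterion

variable {K : Type*} [Field K]

lemma exists_int_of_den (r : Fin 4 → ℚ) {m : ℤ} (hm : ∀ i, ((r i).den : ℤ) ∣ m) :
    ∃ n : Fin 4 → ℤ, ∀ i, (n i : ℚ) = m * r i := by
  have : ∀ i, ∃ k : ℤ, (k : ℚ) = m * r i := by
    intro i
    obtain ⟨d, hd⟩ := hm i
    refine ⟨d * (r i).num, ?_⟩
    conv_rhs => rw [hd, ← Rat.num_div_den (r i)]
    have : ((r i).den : ℚ) ≠ 0 := by exact_mod_cast (r i).den_nz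
    push_cast
    rw [Rat.num_div_den]
    conv_lhs => rw [show ((r i).num : ℚ) = (r i).den * r i by rw [mul_comm, Rat.mul_den_eq_num]]
    ring
  choose n hn using this
  exact ⟨n, hn⟩

lemma evalCoord_eq_sum [CharZero K] (v₁ v₂ v₃ : K) (n : Fin 4 → ℤ) :
    evalCoord v₁ v₂ v₃ n = ∑ i, (n i : ℚ) • (![1, v₁, v₂, v₃] : Fin 4 → K) i := by
  simp [evalCoord, Fin.sum_univ_four, Algebra.smul_def]

lemma evalCoord_of_rat [CharZero K] (v₁ v₂ v₃ : K) (r : Fin 4 → ℚ) {m : ℤ} {n : Fin 4 → ℤ}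
    (h : ∀ i, (n i : ℚ) = m * r i) :
    evalCoord v₁ v₂ v₃ n = m * ∑ i, r i • (![1, v₁, v₂, v₃] : Fin 4 → K) i := by
  rw [evalCoord_eq_sum, Finset.mul_sum]
  refine Finset.sum_congr rfl fun i _ => ?_
  rw [h i, Algebra.smul_def, Algebra.smul_def]
  simp only [eq_ratCast, Rat.cast_mul, Rat.cast_intCast]
  ring

lemma evalCoord_injective [CharZero K] {v₁ v₂ v₃ : K} (hli : LinearIndependent ℚ ![1, v₁, v₂, v₃])
    {x y : Fin 4 → ℤ} (h : evalCoord v₁ v₂ v₃ x = evalCoord v₁ v₂ v₃ y) : x = y := by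
  have h' := evalCoord_eq_sum v₁ v₂ v₃ (x - y)
  have h0 : evalCoord v₁ v₂ v₃ (x - y) = 0 := by
    have := evalCoord_add v₁ v₂ v₃ (x - y) y
    rw [sub_add_cancel, h] at this
    exact right_eq_add.1 this
  rw [h0] at h'
  have := Fintype.linearIndependent_iff.1 hli _ h'.symm
  funext i
  have := this i
  rw [Pi.sub_apply] at this
  exact sub_eq_zero.1 (by exact_mod_cast this)

lemma exists_intCast_mul_eq_evalCoord [NumberField K] {v₁ v₂ v₃ : K}
    (hli : LinearIndependent ℚ ![1, v₁, v₂, v₃]) (hfr : Module.finrank ℚ K = 4) (x : K) :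
    ∃ d : ℕ, d ≠ 0 ∧ ∃ n, evalCoord v₁ v₂ v₃ n = d * x := by
  have hsp := hli.span_eq_top_of_card_eq_finrank (by simp [hfr])
  have hx : x ∈ Submodule.span ℚ (Set.range ![1, v₁, v₂, v₃]) := hsp ▸ Submodule.mem_top
  obtain ⟨r, rfl⟩ := (Submodule.mem_span_range_iff_exists_fun ℚ).1 hx
  have hd : ∀ i, ((r i).den : ℤ) ∣ ((∏ j, (r j).den : ℕ) : ℤ) := fun i =>
    Int.natCast_dvd_natCast.2 (Finset.dvd_prod_of_mem _ (Finset.mem_univ i))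
  obtain ⟨n, hn⟩ := exists_int_of_den r hd
  refine ⟨∏ j, (r j).den, Finset.prod_ne_zero_iff.2 fun i _ => (r i).den_nz, n, ?_⟩
  exact_mod_cast evalCoord_of_rat v₁ v₂ v₃ r hn

/-- Criterion for `1, v₁, v₂, v₃` to be a `p`-integral basis, in terms of a multiplication table
and of coordinates modulo `p` and `p²`. The ideal `I` of the elements whose coordinates in `S`
vanish modulo `p` is a radical ideal, it contains the elements `E`, which are nilpotent modulo `p`,
and no element outside of the ring moves `p` and `E` into `I`. -/
theorem isPIntegralBasis_of_mulTable [NumberField K] {p : ℕ} (hp : p.Prime) {v₁ v₂ v₃ : K}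
    (hli : LinearIndependent ℚ ![1, v₁, v₂, v₃]) (hfr : Module.finrank ℚ K = 4)
    {t : MulTable} (ht : t.Holds v₁ v₂ v₃) (S : Finset (Fin 4)) (E : List (Fin 4 → ℤ))
    (hideal : ∀ x y : Fin 4 → ℤ, (∀ i ∈ S, (y i : ZMod p) = 0) →
      ∀ i ∈ S, (t.mul x y i : ZMod p) = 0)
    (hsq : ∀ x : Fin 4 → ℤ, (∀ i ∈ S, (t.mul x x i : ZMod p) = 0) → ∀ i ∈ S, (x i : ZMod p) = 0)
    (hES : ∀ e ∈ E, ∀ i ∈ S, (e i : ZMod p) = 0)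
    (hnil : ∀ e ∈ E, ∀ i, (t.mul (t.mul e e) (t.mul e e) i : ZMod p) = 0)
    (hcol : ∀ l : Fin 4 → ℤ, (∀ i ∈ S, (p : ℤ) ∣ l i) →
      (∀ e ∈ E, ∃ k : Fin 4 → ℤ, (∀ i, t.mul e l i = p * k i) ∧ ∀ i ∈ S, (k i : ZMod p) = 0) →
      ∀ i, (l i : ZMod p) = 0) :
    IsPIntegralBasis p ![1, v₁, v₂, v₃] := by
  set L := ht.subring with hLdef
  set ev := evalCoord v₁ v₂ v₃ with hev
  have hLint : ∀ x ∈ L, IsIntegral ℤ x := by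
    rintro _ ⟨n, rfl⟩
    exact ht.isIntegral n
  have hp0 : (p : K) ≠ 0 := by exact_mod_cast hp.ne_zero
  have hdiv : ∀ n : Fin 4 → ℤ, (∀ i, (n i : ZMod p) = 0) → ∃ k, n = (p : ℤ) • k := by
    intro n hn
    have : ∀ i, ∃ k, n i = p * k := fun i => (ZMod.intCast_zmod_eq_zero_iff_dvd _ _).1 (hn i)
    choose k hk using this
    exact ⟨k, funext hk⟩
  set I : Set K := {x | ∃ n, ev n = x ∧ ∀ i ∈ S, (n i : ZMod p) = 0} with hI
  have hI0 : (0 : K) ∈ I := ⟨0, by simp [hev, evalCoord], by simp⟩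
  have hadd : ∀ x ∈ I, ∀ y ∈ I, x + y ∈ I := by
    rintro _ ⟨x, rfl, hx⟩ _ ⟨y, rfl, hy⟩
    refine ⟨x + y, evalCoord_add _ _ _ _ _, fun i hi => ?_⟩
    simp [hx i hi, hy i hi]
  have hIL : ∀ x ∈ L, ∀ y ∈ I, x * y ∈ I := by
    rintro _ ⟨x, rfl⟩ _ ⟨y, rfl, hy⟩
    exact ⟨t.mul x y, ht.eval_mul x y, hideal x y hy⟩
  have hpI : ∀ x ∈ L, (p : K) * x ∈ I := by
    rintro _ ⟨x, rfl⟩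
    exact ⟨(p : ℤ) • x, by rw [hev, evalCoord_smul]; simp, fun i _ => by simp⟩
  have hsqK : ∀ x ∈ L, x * x ∈ I → x ∈ I := by
    rintro _ ⟨x, rfl⟩ ⟨y, hy, hyS⟩
    rw [← ht.eval_mul] at hy
    rw [evalCoord_injective hli hy] at hyS
    exact ⟨x, rfl, hsq x hyS⟩
  -- The multiplier argument: for a minimal y outside of L, the coordinates l of py satisfy the
  -- hypotheses of `hcol`. Then p divides l, and y ∈ L.
  have key : ∀ x : K, PInt p x → ∀ N : ℕ, (p : K) ^ N * x ∈ L → x ∈ L := by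
    intro x hx N hN
    by_contra hxL
    obtain ⟨y, hy, hyL, hpy, hEy⟩ := exists_notMem_forall_mul_mem L hLint hx hxL hN (E.map ev)
      (by simp only [List.mem_map]; rintro _ ⟨e, -, rfl⟩; exact ⟨e, rfl⟩)
      (by
        simp only [List.mem_map]
        rintro _ ⟨e, he, rfl⟩
        obtain ⟨k, hk⟩ := hdiv _ (hnil e he)
        refine ⟨4, ev k, ⟨k, rfl⟩, ?_⟩
        have h1 := ht.eval_mul (t.mul e e) (t.mul e e)
        rw [ht.eval_mul e e, hk, evalCoord_smul] at h1
        push_cast at h1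
        rw [h1]
        ring)
    obtain ⟨l, hl⟩ := hpy
    have h1 : (p : K) * y ∈ I := by
      refine mul_mem_of_pInt hp L hI0 hadd hIL hpI hsqK hy ?_ (natCast_mem L p) ⟨l, hl⟩
      simpa using hpI 1 L.one_mem
    obtain ⟨l', hl', hlS⟩ := h1
    rw [← hl] at hl'
    rw [evalCoord_injective hli hl'] at hlS
    have h2 := hcol l (fun i hi => (ZMod.intCast_zmod_eq_zero_iff_dvd _ _).1 (hlS i hi)) (by
      intro e he
      have heI : ev e ∈ I := ⟨e, rfl, hES e he⟩
      have := mul_mem_of_pInt hp L hI0 hadd hIL hpI hsqK hy heI ⟨e, rfl⟩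
        (hEy _ (List.mem_map_of_mem he))
      obtain ⟨k, hk, hkS⟩ := this
      refine ⟨k, fun i => congrFun (evalCoord_injective hli (y := (p : ℤ) • k) ?_) i, hkS⟩
      rw [ht.eval_mul, evalCoord_smul, hl, ← hev, hk]
      push_cast
      ring)
    obtain ⟨k, rfl⟩ := hdiv l h2
    rw [evalCoord_smul, Int.cast_natCast] at hl
    exact hyL ⟨k, mul_left_cancel₀ hp0 hl⟩
  refine ⟨hli, fun x => ⟨fun hx => ?_, ?_⟩⟩
  · obtain ⟨d, hd, n, hn⟩ := exists_intCast_mul_eq_evalCoord hli hfr x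
    -- The p-part of the denominator is removed by `key`; the remaining factor m is a unit of ℤ_(p).
    obtain ⟨N, m, hm, rfl⟩ := Nat.exists_eq_pow_mul_and_not_dvd hd p hp.ne_one
    have hmx : PInt p ((m : K) * x) := PInt.mul_isIntegral hx (isIntegral_natCast _)
    obtain ⟨k, hk⟩ := key _ hmx N ⟨n, by rw [hn]; push_cast; ring⟩
    have hm0 : m ≠ 0 := by rintro rfl; simp at hm
    refine ⟨fun i => (k i : ℚ) / m, fun i h => hm ?_, ?_⟩
    · have := Rat.den_dvd (k i) m
      have h3 : (p : ℤ) ∣ (m : ℤ) := (Int.natCast_dvd_natCast.2 h).trans (by exact_mod_cast this)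
      exact_mod_cast h3
    · have hmK : (m : K) ≠ 0 := by exact_mod_cast hm0
      have hmQ : (m : ℚ) ≠ 0 := by exact_mod_cast hm0
      refine mul_left_cancel₀ hmK ?_
      rw [← hk]
      have := evalCoord_of_rat v₁ v₂ v₃ (fun i => (k i : ℚ) / m) (m := m) (n := k)
        (fun i => by field_simp; simp)
      exact_mod_cast this
  · rintro ⟨r, hr, rfl⟩
    have hd : ∀ i, ((r i).den : ℤ) ∣ ((∏ j, (r j).den : ℕ) : ℤ) := fun i =>
      Int.natCast_dvd_natCast.2 (Finset.dvd_prod_of_mem _ (Finset.mem_univ i))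
    obtain ⟨n, hn⟩ := exists_int_of_den r hd
    refine ⟨∏ j, (r j).den, ?_, ?_⟩
    · rw [hp.prime.dvd_finsetProd_iff]
      rintro ⟨i, -, hi⟩
      exact hr i hi
    · have := evalCoord_of_rat v₁ v₂ v₃ r hn
      rw [Int.cast_natCast] at this
      rw [← this]
      exact ht.isIntegral n

lemma not_dvd_den_add {p : ℕ} (hp : p.Prime) {x y : ℚ} (hx : ¬ p ∣ x.den) (hy : ¬ p ∣ y.den) :
    ¬ p ∣ (x + y).den := fun h =>
  ((Nat.Prime.dvd_mul hp).1 (h.trans (Rat.add_den_dvd x y))).elim hx hy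

lemma not_dvd_den_mul {p : ℕ} (hp : p.Prime) {x y : ℚ} (hx : ¬ p ∣ x.den) (hy : ¬ p ∣ y.den) :
    ¬ p ∣ (x * y).den := fun h =>
  ((Nat.Prime.dvd_mul hp).1 (h.trans (Rat.mul_den_dvd x y))).elim hx hy

lemma not_dvd_den_intCast {p : ℕ} (hp : p.Prime) (n : ℤ) : ¬ p ∣ (n : ℚ).den := by
  simpa using hp.ne_one

lemma not_dvd_den_sum {p : ℕ} (hp : p.Prime) {ι : Type*} (s : Finset ι) {f : ι → ℚ}
    (hf : ∀ i, ¬ p ∣ (f i).den) : ¬ p ∣ (∑ i ∈ s, f i).den := by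
  classical
  induction s using Finset.induction_on with
  | empty => simpa using hp.ne_one
  | insert a s ha ih =>
    rw [Finset.sum_insert ha]
    exact not_dvd_den_add hp (hf a) ih

/-- A `p`-integral change of basis. -/
theorem IsPIntegralBasis.of_change [NumberField K] {p : ℕ} (hp : p.Prime) {v w : Fin 4 → K}
    (hv : IsPIntegralBasis p v) (A B : Fin 4 → Fin 4 → ℚ) (hA : ∀ i j, ¬ p ∣ (A i j).den)
    (hB : ∀ i j, ¬ p ∣ (B i j).den) (hw : ∀ i, w i = ∑ j, A i j • v j)
    (hvw : ∀ i, v i = ∑ j, B i j • w j) : IsPIntegralBasis p w := by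
  obtain ⟨hli, hv⟩ := hv
  have trans : ∀ (u u' : Fin 4 → K) (C : Fin 4 → Fin 4 → ℚ) (_ : ∀ i j, ¬ p ∣ (C i j).den)
      (_ : ∀ i, u i = ∑ j, C i j • u' j) (x : K),
      (∃ r : Fin 4 → ℚ, (∀ i, ¬ p ∣ (r i).den) ∧ x = ∑ i, r i • u i) →
      ∃ r : Fin 4 → ℚ, (∀ i, ¬ p ∣ (r i).den) ∧ x = ∑ i, r i • u' i := by
    rintro u u' C hC hu x ⟨r, hr, rfl⟩
    refine ⟨fun j => ∑ i, r i * C i j,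
      fun j => not_dvd_den_sum hp _ fun i => not_dvd_den_mul hp (hr i) (hC i j), ?_⟩
    simp_rw [hu, Finset.smul_sum, Finset.sum_smul, mul_smul]
    exact Finset.sum_comm
  refine ⟨?_, fun x => (hv x).trans ⟨trans v w B hB hvw x, trans w v A hA hw x⟩⟩
  -- The span of w contains that of v, so its dimension is at least 4.
  rw [linearIndependent_iff_card_le_finrank_span]
  have h1 : Submodule.span ℚ (Set.range v) ≤ Submodule.span ℚ (Set.range w) := by
    rw [Submodule.span_le]
    rintro _ ⟨i, rfl⟩
    rw [hvw i]
    exact Submodule.sum_mem _ fun j _ =>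
      Submodule.smul_mem _ _ (Submodule.subset_span (Set.mem_range_self j))
  have h2 := Submodule.finrank_mono h1
  rwa [finrank_span_eq_card hli] at h2

/-- A `p`-integral unipotent triangular change of basis. -/
theorem IsPIntegralBasis.of_unipotent [NumberField K] {p : ℕ} (hp : p.Prime)
    {v₁ v₂ v₃ w₁ w₂ w₃ : K} (hv : IsPIntegralBasis p ![1, v₁, v₂, v₃]) (q₁₀ q₂₀ q₂₁ q₃₀ q₃₁ q₃₂ : ℚ)
    (h₁₀ : ¬ p ∣ q₁₀.den) (h₂₀ : ¬ p ∣ q₂₀.den) (h₂₁ : ¬ p ∣ q₂₁.den)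
    (h₃₀ : ¬ p ∣ q₃₀.den) (h₃₁ : ¬ p ∣ q₃₁.den) (h₃₂ : ¬ p ∣ q₃₂.den)
    (hw₁ : w₁ = v₁ + q₁₀) (hw₂ : w₂ = v₂ + q₂₁ * v₁ + q₂₀)
    (hw₃ : w₃ = v₃ + q₃₂ * v₂ + q₃₁ * v₁ + q₃₀) : IsPIntegralBasis p ![1, w₁, w₂, w₃] := by
  have h0 : ¬ p ∣ (0 : ℚ).den := by simpa using hp.ne_one
  have h1 : ¬ p ∣ (1 : ℚ).den := by simpa using hp.ne_one
  have hneg : ∀ x : ℚ, ¬ p ∣ x.den → ¬ p ∣ (-x).den := fun x hx => by simpa using hx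
  have hadd : ∀ x y : ℚ, ¬ p ∣ x.den → ¬ p ∣ y.den → ¬ p ∣ (x + y).den :=
    fun x y => not_dvd_den_add hp
  have hmul : ∀ x y : ℚ, ¬ p ∣ x.den → ¬ p ∣ y.den → ¬ p ∣ (x * y).den :=
    fun x y => not_dvd_den_mul hp
  refine hv.of_change hp ![![1, 0, 0, 0], ![q₁₀, 1, 0, 0], ![q₂₀, q₂₁, 1, 0], ![q₃₀, q₃₁, q₃₂, 1]]
    ![![1, 0, 0, 0], ![-q₁₀, 1, 0, 0], ![-q₂₀ + q₂₁ * q₁₀, -q₂₁, 1, 0],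
      ![-q₃₀ + q₃₁ * q₁₀ + -(q₃₂ * (-q₂₀ + q₂₁ * q₁₀)), -q₃₁ + q₃₂ * q₂₁, -q₃₂, 1]] ?_ ?_ ?_ ?_
  · intro i j
    fin_cases i <;> fin_cases j
    exacts [h1, h0, h0, h0, h₁₀, h1, h0, h0, h₂₀, h₂₁, h1, h0, h₃₀, h₃₁, h₃₂, h1]
  · have e₂₀ := hadd _ _ (hneg _ h₂₀) (hmul _ _ h₂₁ h₁₀)
    intro i j
    fin_cases i <;> fin_cases j
    exacts [h1, h0, h0, h0, hneg _ h₁₀, h1, h0, h0, e₂₀, hneg _ h₂₁, h1, h0,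
      hadd _ _ (hadd _ _ (hneg _ h₃₀) (hmul _ _ h₃₁ h₁₀)) (hneg _ (hmul _ _ h₃₂ e₂₀)),
      hadd _ _ (hneg _ h₃₁) (hmul _ _ h₃₂ h₂₁), hneg _ h₃₂, h1]
  · intro i
    fin_cases i <;> simp [Fin.sum_univ_four, Algebra.smul_def, hw₁, hw₂, hw₃] <;> ring
  · intro i
    fin_cases i <;> simp [Fin.sum_univ_four, Algebra.smul_def, hw₁, hw₂, hw₃] <;> ring

/-- An integral unipotent triangular change of basis. -/
theorem IsPIntegralBasis.of_unipotent_int [NumberField K] {p : ℕ} (hp : p.Prime)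
    {v₁ v₂ v₃ w₁ w₂ w₃ : K} (hv : IsPIntegralBasis p ![1, v₁, v₂, v₃]) (q₁₀ q₂₀ q₂₁ q₃₀ q₃₁ q₃₂ : ℤ)
    (hw₁ : w₁ = v₁ + q₁₀) (hw₂ : w₂ = v₂ + q₂₁ * v₁ + q₂₀)
    (hw₃ : w₃ = v₃ + q₃₂ * v₂ + q₃₁ * v₁ + q₃₀) : IsPIntegralBasis p ![1, w₁, w₂, w₃] := by
  have h := not_dvd_den_intCast hp
  exact hv.of_unipotent hp _ _ _ _ _ _ (h q₁₀) (h q₂₀) (h q₂₁) (h q₃₀) (h q₃₁) (h q₃₂)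
    (by simpa using hw₁) (by simpa using hw₂) (by simpa using hw₃)

end Criterion

/-! ### Towers 1, θ, ψ, θψ of two quadratic steps -/

section Tower

variable {K : Type*} [Field K]

lemma forall_fin_four {P : Fin 4 → Prop} : (∀ i, P i) ↔ P 0 ∧ P 1 ∧ P 2 ∧ P 3 := by
  simp [Fin.forall_fin_succ]

lemma ZMod.eq_zero_of_mul_eq {p : ℕ} (hp : p.Prime) {x y : ℤ} (h : (p : ℤ) * x = p * y)
    (hy : (y : ZMod p) = 0) : (x : ZMod p) = 0 := by
  rw [mul_left_cancel₀ (by exact_mod_cast hp.ne_zero) h, hy]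

/-- The multiplication table of `1, θ, ψ, θψ` where `θ² = Pψ - βθ - γ` and
`ψ² = Aψ + Eθψ + Bθ + C`. -/
def towerTable (β γ P A B C E : ℤ) : MulTable where
  t11 := ![-γ, -β, P, 0]
  t12 := ![0, 0, 0, 1]
  t13 := ![P * C, P * B, P * A - γ, P * E - β]
  t22 := ![C, B, A, E]
  t23 := ![-B * γ + E * P * C, C - B * β + E * P * B, B * P + E * (P * A - γ), A + E * (P * E - β)]
  t33 := ![P * (A * C + E * (-B * γ + E * P * C)) - β * (-B * γ + E * P * C) - γ * C,
    P * (A * B + E * (C - B * β + E * P * B)) - β * (C - B * β + E * P * B) - γ * B,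
    P * (C + A * A + E * (B * P + E * (P * A - γ))) - β * (B * P + E * (P * A - γ)) - γ * A,
    P * (B + A * E + E * (A + E * (P * E - β))) - β * (A + E * (P * E - β)) - γ * E]

/-- All products reduce by the two quadratic relations; the last row of the table is (Pψ − βθ − γ)ψ²
reduced with the rows for ψ² and ψ·θψ. -/
lemma towerTable_holds {θ ψ : K} {β γ P A B C E : ℤ} (hθ : θ ^ 2 = P * ψ - β * θ - γ)
    (hψ : ψ ^ 2 = A * ψ + E * (θ * ψ) + B * θ + C) :
    (towerTable β γ P A B C E).Holds θ ψ (θ * ψ) := by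
  constructor <;> simp only [evalCoord, towerTable, Matrix.cons_val] <;> push_cast
  · linear_combination hθ
  · ring
  · linear_combination ψ * hθ + P * hψ
  · linear_combination hψ
  · linear_combination (θ + P * E) * hψ + (B + E * ψ) * hθ
  · linear_combination ψ ^ 2 * hθ + (P * ψ - β * θ - γ + P * A + E * P * (θ + P * E)
      - β * P * E) * hψ + (E * P - β) * (B + E * ψ) * hθ

/-- The case of a ramified `θ` and a `ψ` that generates a separable residue algebra. -/
theorem isPIntegralBasis_tower_of_ramified_separable [NumberField K] {p : ℕ} (hp : p.Prime)
    (hfr : Module.finrank ℚ K = 4) {θ ψ : K} (hli : LinearIndependent ℚ ![1, θ, ψ, θ * ψ])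
    {β γ P A B C E : ℤ} (hθ : θ ^ 2 = (p * P : ℤ) * ψ - (p * β : ℤ) * θ - (p * γ : ℤ))
    (hψ : ψ ^ 2 = A * ψ + E * (θ * ψ) + B * θ + C)
    (hsep : ((A ^ 2 + 4 * C : ℤ) : ZMod p) ≠ 0)
    (hram : ((γ ^ 2 - P * γ * A - P ^ 2 * C : ℤ) : ZMod p) ≠ 0) :
    IsPIntegralBasis p ![1, θ, ψ, θ * ψ] := by
  have := Fact.mk hp
  push_cast at hsep hram
  refine isPIntegralBasis_of_mulTable hp hli hfr (towerTable_holds hθ hψ) {0, 2} [![0, 1, 0, 0]]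
    ?_ ?_ ?_ ?_ ?_
  · intro x y hy i hi
    simp only [Finset.mem_insert, Finset.mem_singleton, forall_eq_or_imp, forall_eq] at hy hi
    obtain ⟨h0, h2⟩ := hy
    rcases hi with rfl | rfl <;> simp [MulTable.mul, towerTable, h0, h2]
  · intro x hx i hi
    simp [MulTable.mul, towerTable] at hx
    obtain ⟨h0, h2⟩ := hx
    -- Modulo I the square is taken in F_p[ψ]/(ψ² − Aψ − C), which is reduced because its
    -- discriminant A² + 4C is a unit.
    have e2 : (x 2 : ZMod p) = 0 := by
      have : (x 2 : ZMod p) ^ 3 * (A ^ 2 + 4 * C) = 0 := by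
        linear_combination 4 * (x 2 : ZMod p) * h0 + (A * x 2 - 2 * x 0) * h2
      simpa [hsep] using this
    have e0 : (x 0 : ZMod p) = 0 := by simpa [e2] using h0
    simp at hi
    rcases hi with rfl | rfl <;> assumption
  · simp
  · simp [MulTable.mul, towerTable, forall_fin_four]
  · intro l hl he
    simp only [Finset.mem_insert, Finset.mem_singleton, forall_eq_or_imp, forall_eq] at hl
    obtain ⟨⟨l0, h0⟩, l2, h2⟩ := hl
    simp [MulTable.mul, towerTable, forall_fin_four] at he
    obtain ⟨k, ⟨hk0, -, hk2, -⟩, k0, k2⟩ := he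
    -- Since θl/p ∈ I, the pair (l₁, l₃) solves a linear system whose determinant γ² − PγA − P²C is
    -- the norm of θ²/p ≡ Pψ − γ from that algebra.
    have e0 : ((-γ * l 1 + P * C * l 3 : ℤ) : ZMod p) = 0 :=
      ZMod.eq_zero_of_mul_eq hp (by linear_combination hk0) k0
    have e2 : ((P * l 1 + (P * A - γ) * l 3 : ℤ) : ZMod p) = 0 :=
      ZMod.eq_zero_of_mul_eq hp (by linear_combination hk2) k2
    push_cast at e0 e2
    have f1 : (l 1 : ZMod p) = 0 :=
      (mul_eq_zero.1 (show (l 1 : ZMod p) * _ = 0 by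
        linear_combination (P * A - γ : ZMod p) * e0 - (P * C : ZMod p) * e2)).resolve_right hram
    have f3 : (l 3 : ZMod p) = 0 :=
      (mul_eq_zero.1 (show (l 3 : ZMod p) * _ = 0 by
        linear_combination (-P : ZMod p) * e0 - (γ : ZMod p) * e2)).resolve_right hram
    simp [forall_fin_four, h0, h2, f1, f3]

/-- The totally ramified case with `v(θ) = 1/2` and `v(ψ) = 1/4`. -/
theorem isPIntegralBasis_tower_of_totally_ramified [NumberField K] {p : ℕ} (hp : p.Prime)
    (hfr : Module.finrank ℚ K = 4) {θ ψ : K} (hli : LinearIndependent ℚ ![1, θ, ψ, θ * ψ])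
    {β γ P A B C E : ℤ} (hθ : θ ^ 2 = (p * P : ℤ) * ψ - (p * β : ℤ) * θ - (p * γ : ℤ))
    (hψ : ψ ^ 2 = (p * A : ℤ) * ψ + E * (θ * ψ) + B * θ + (p * C : ℤ))
    (hγ : (γ : ZMod p) ≠ 0) (hB : (B : ZMod p) ≠ 0) :
    IsPIntegralBasis p ![1, θ, ψ, θ * ψ] := by
  have := Fact.mk hp
  refine isPIntegralBasis_of_mulTable hp hli hfr (towerTable_holds hθ hψ) {0} [![0, 0, 1, 0]]
    ?_ ?_ ?_ ?_ ?_
  · intro x y hy i hi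
    simp only [Finset.mem_singleton, forall_eq] at hy hi
    subst hi
    simp [MulTable.mul, towerTable, hy]
  · intro x hx i hi
    simp [MulTable.mul, towerTable] at hx hi
    subst hi
    exact hx
  · simp
  · simp [MulTable.mul, towerTable, forall_fin_four]
  · intro l hl he
    simp only [Finset.mem_singleton, forall_eq] at hl
    obtain ⟨l0, h0⟩ := hl
    simp [MulTable.mul, towerTable, forall_fin_four] at he
    obtain ⟨k, ⟨hk0, hk1, -, hk3⟩, k0⟩ := he
    -- Here ψ is a uniformizer. Coordinates 1 and 3 of ψl modulo p give l₂ and then l₁; coordinate 0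
    -- divided by p gives l₃, with unit coefficient −Bγ.
    have e1 := congrArg (Int.cast : ℤ → ZMod p) hk1
    have e3 := congrArg (Int.cast : ℤ → ZMod p) hk3
    simp at e1 e3
    have f2 : (l 2 : ZMod p) = 0 := e1.resolve_right hB
    have f1 : (l 1 : ZMod p) = 0 := by simpa [f2] using e3
    have e0 : ((C * l 2 + l 3 * (-B * γ + E * P * p * C) : ℤ) : ZMod p) = 0 :=
      ZMod.eq_zero_of_mul_eq hp (by linear_combination hk0) k0
    simp [f2, hB, hγ] at e0
    simp [forall_fin_four, h0, f1, f2, e0]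

/-- The case where `θ` generates a quadratic residue field and `ψ` is ramified. -/
theorem isPIntegralBasis_tower_of_inert_ramified [NumberField K] {p : ℕ} (hp : p.Prime)
    (hfr : Module.finrank ℚ K = 4) {θ ψ : K} (hli : LinearIndependent ℚ ![1, θ, ψ, θ * ψ])
    {β γ P A B C E : ℤ} (hθ : θ ^ 2 = P * ψ - β * θ - γ)
    (hψ : ψ ^ 2 = (p * A : ℤ) * ψ + (p * E : ℤ) * (θ * ψ) + (p * B : ℤ) * θ + (p * C : ℤ))
    (hirr : ∀ x y : ZMod p, x ^ 2 - β * x * y + γ * y ^ 2 = 0 → x = 0 ∧ y = 0)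
    (hBC : (C : ZMod p) ≠ 0 ∨ (B : ZMod p) ≠ 0) :
    IsPIntegralBasis p ![1, θ, ψ, θ * ψ] := by
  have := Fact.mk hp
  refine isPIntegralBasis_of_mulTable hp hli hfr (towerTable_holds hθ hψ) {0, 1} [![0, 0, 1, 0]]
    ?_ ?_ ?_ ?_ ?_
  · intro x y hy i hi
    simp only [Finset.mem_insert, Finset.mem_singleton, forall_eq_or_imp, forall_eq] at hy hi
    obtain ⟨h0, h1⟩ := hy
    rcases hi with rfl | rfl <;> simp [MulTable.mul, towerTable, h0, h1]
  · intro x hx i hi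
    simp [MulTable.mul, towerTable] at hx hi
    obtain ⟨h0, h1⟩ := hx
    -- The norm of (x₀ + x₁θ)² is the square of the norm form, which is anisotropic because θ
    -- generates a field modulo p.
    have hN : ((x 0 : ZMod p) ^ 2 - β * x 0 * x 1 + γ * x 1 ^ 2) ^ 2 = 0 := by
      linear_combination (((x 0 : ZMod p) ^ 2 - γ * x 1 ^ 2) - β * (2 * x 0 * x 1 - β * x 1 ^ 2))
        * h0 + γ * (2 * x 0 * x 1 - β * x 1 ^ 2) * h1
    have := hirr _ _ (pow_eq_zero_iff two_ne_zero |>.1 hN)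
    rcases hi with rfl | rfl
    exacts [this.1, this.2]
  · simp
  · simp [MulTable.mul, towerTable, forall_fin_four]
  · intro l hl he
    simp only [Finset.mem_insert, Finset.mem_singleton, forall_eq_or_imp, forall_eq] at hl
    obtain ⟨⟨l0, h0⟩, l1, h1⟩ := hl
    simp [MulTable.mul, towerTable, forall_fin_four] at he
    obtain ⟨k, ⟨hk0, hk1, -, -⟩, k0, k1⟩ := he
    have e0 : ((C * l 2 + l 3 * (-B * γ + E * P * p * C) : ℤ) : ZMod p) = 0 :=
      ZMod.eq_zero_of_mul_eq hp (by linear_combination hk0) k0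
    have e1 : ((B * l 2 + l 3 * (C - B * β + E * P * p * B) : ℤ) : ZMod p) = 0 :=
      ZMod.eq_zero_of_mul_eq hp (by linear_combination hk1) k1
    simp at e0 e1
    -- The norm of the residue C + Bθ of ψ²/p is the determinant of the system for l₂ and l₃.
    have hN : (C : ZMod p) ^ 2 - β * C * B + γ * B ^ 2 ≠ 0 := by
      intro h
      have := hirr _ _ h
      rcases hBC with h' | h'
      exacts [h' this.1, h' this.2]
    have f2 : (l 2 : ZMod p) = 0 :=
      (mul_eq_zero.1 (show (l 2 : ZMod p) * _ = 0 by
        linear_combination (C - B * β : ZMod p) * e0 + (B * γ : ZMod p) * e1)).resolve_right hN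
    have f3 : (l 3 : ZMod p) = 0 :=
      (mul_eq_zero.1 (show (l 3 : ZMod p) * _ = 0 by
        linear_combination -(B : ZMod p) * e0 + (C : ZMod p) * e1)).resolve_right hN
    simp [forall_fin_four, h0, h1, f2, f3]

/-- The unramified case, `p` odd. -/
theorem isPIntegralBasis_tower_of_unramified_odd [NumberField K] {p : ℕ} (hp : p.Prime)
    (hp2 : 2 < p) (hfr : Module.finrank ℚ K = 4) {θ ψ : K}
    (hli : LinearIndependent ℚ ![1, θ, ψ, θ * ψ])
    {β γ P A B C E : ℤ} (hθ : θ ^ 2 = (p * P : ℤ) * ψ - β * θ - γ)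
    (hψ : ψ ^ 2 = (p * A : ℤ) * ψ + (p * E : ℤ) * (θ * ψ) + B * θ + C)
    (hirr : ∀ x y : ZMod p, x ^ 2 - β * x * y + γ * y ^ 2 = 0 → x = 0 ∧ y = 0)
    (hBC : (C : ZMod p) ≠ 0 ∨ (B : ZMod p) ≠ 0) :
    IsPIntegralBasis p ![1, θ, ψ, θ * ψ] := by
  have := Fact.mk hp
  have h2 : (2 : ZMod p) ≠ 0 := by
    have h : ((2 : ℕ) : ZMod p) ≠ 0 := by
      rw [Ne, ZMod.natCast_eq_zero_iff]
      exact fun h => absurd (Nat.le_of_dvd two_pos h) (by omega)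
    exact_mod_cast h
  refine isPIntegralBasis_of_mulTable hp hli hfr (towerTable_holds hθ hψ) Finset.univ []
    ?_ ?_ ?_ ?_ ?_
  · intro x y hy i _
    simp only [Finset.mem_univ, forall_const, forall_fin_four] at hy
    obtain ⟨h0, h1, h2, h3⟩ := hy
    revert i
    simp [MulTable.mul, towerTable, forall_fin_four, h0, h1, h2, h3]
  · intro x hx
    simp [MulTable.mul, towerTable, forall_fin_four] at hx
    simp only [Finset.mem_univ, forall_const]
    obtain ⟨h0, h1, e2, e3⟩ := hx
    have h2 : (x 0 : ZMod p) * x 2 - γ * (x 1 * x 3) = 0 :=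
      (mul_eq_zero.1 (show (2 : ZMod p) * _ = 0 by linear_combination e2)).resolve_left h2
    have h3 : (x 0 : ZMod p) * x 3 + x 1 * x 2 - β * (x 1 * x 3) = 0 :=
      (mul_eq_zero.1 (show (2 : ZMod p) * _ = 0 by linear_combination e3)).resolve_left ‹_›
    -- Write x = u + wψ with u, w in the field F_p[θ]. Then x² = u² + (C + Bθ)w² + 2uwψ. As p is
    -- odd, x² = 0 gives uw = 0, hence one of u, w vanishes, and the constant part kills the other.
    have hN : ((x 0 : ZMod p) ^ 2 - β * x 0 * x 1 + γ * x 1 ^ 2) *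
        ((x 2 : ZMod p) ^ 2 - β * x 2 * x 3 + γ * x 3 ^ 2) = 0 := by
      linear_combination (((x 0 : ZMod p) * x 2 - γ * (x 1 * x 3))
        - β * (x 0 * x 3 + x 1 * x 2 - β * (x 1 * x 3))) * h2
        + γ * (x 0 * x 3 + x 1 * x 2 - β * (x 1 * x 3)) * h3
    have hNC : (C : ZMod p) ^ 2 - β * C * B + γ * B ^ 2 ≠ 0 := by
      intro h
      have := hirr _ _ h
      rcases hBC with h' | h'
      exacts [h' this.1, h' this.2]
    rcases mul_eq_zero.1 hN with h | h
    · obtain ⟨f0, f1⟩ := hirr _ _ h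
      simp only [f0, f1] at h0 h1
      have hN : ((x 2 : ZMod p) ^ 2 - β * x 2 * x 3 + γ * x 3 ^ 2) ^ 2 *
          ((C : ZMod p) ^ 2 - β * C * B + γ * B ^ 2) = 0 := by
        linear_combination ((x 2 ^ 2 * C + 2 * x 2 * x 3 * (-(B * γ)) + x 3 ^ 2 *
          (β * B * γ - γ * C) : ZMod p) - β * (x 2 ^ 2 * B + 2 * x 2 * x 3 * (C - B * β) + x 3 ^ 2 *
          (-β * (C - B * β) - γ * B))) * h0 +
          γ * (x 2 ^ 2 * B + 2 * x 2 * x 3 * (C - B * β) + x 3 ^ 2 *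
          (-β * (C - B * β) - γ * B)) * h1
      obtain ⟨f2, f3⟩ := hirr _ _
        (pow_eq_zero_iff two_ne_zero |>.1 ((mul_eq_zero.1 hN).resolve_right hNC))
      simp [forall_fin_four, f0, f1, f2, f3]
    · obtain ⟨f2, f3⟩ := hirr _ _ h
      simp only [f2, f3] at h0 h1
      have hN : ((x 0 : ZMod p) ^ 2 - β * x 0 * x 1 + γ * x 1 ^ 2) ^ 2 = 0 := by
        linear_combination (((x 0 : ZMod p) ^ 2 - γ * x 1 ^ 2) - β * (2 * x 0 * x 1 - β * x 1 ^ 2))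
          * h0 + γ * (2 * x 0 * x 1 - β * x 1 ^ 2) * h1
      obtain ⟨f0, f1⟩ := hirr _ _ (pow_eq_zero_iff two_ne_zero |>.1 hN)
      simp [forall_fin_four, f0, f1, f2, f3]
  · simp
  · simp
  · intro l hl _ i
    exact (ZMod.intCast_zmod_eq_zero_iff_dvd _ _).2 (hl i (Finset.mem_univ i))

/-- The unramified case, `p = 2`. -/
theorem isPIntegralBasis_tower_of_unramified_two [NumberField K]
    (hfr : Module.finrank ℚ K = 4) {θ ψ : K}
    (hli : LinearIndependent ℚ ![1, θ, ψ, θ * ψ])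
    {β γ P A B C E : ℤ} (hθ : θ ^ 2 = (2 * P : ℤ) * ψ - β * θ - γ)
    (hψ : ψ ^ 2 = A * ψ + E * (θ * ψ) + B * θ + C)
    (hirr : ∀ x y : ZMod 2, x ^ 2 - β * x * y + γ * y ^ 2 = 0 → x = 0 ∧ y = 0)
    (hAE : (A : ZMod 2) ≠ 0 ∨ (E : ZMod 2) ≠ 0) :
    IsPIntegralBasis 2 ![1, θ, ψ, θ * ψ] := by
  have := Fact.mk Nat.prime_two
  have two : (2 : ZMod 2) = 0 := rfl
  refine isPIntegralBasis_of_mulTable Nat.prime_two hli hfr (towerTable_holds hθ hψ) Finset.univ []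
    ?_ ?_ ?_ ?_ ?_
  · intro x y hy i _
    simp only [Finset.mem_univ, forall_const, forall_fin_four] at hy
    obtain ⟨h0, h1, h2, h3⟩ := hy
    revert i
    simp [MulTable.mul, towerTable, forall_fin_four, h0, h1, h2, h3]
  · intro x hx
    simp [MulTable.mul, towerTable, forall_fin_four, two] at hx
    simp only [Finset.mem_univ, forall_const]
    obtain ⟨h0, h1, h2, h3⟩ := hx
    -- For p = 2 the square of u + wψ is u² + (C + Bθ)w² + (A + Eθ)w²ψ, and A + Eθ is a nonzero
    -- element of the field F₂[θ].
    have hNA : (A : ZMod 2) ^ 2 - β * A * E + γ * E ^ 2 ≠ 0 := by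
      intro h
      have := hirr _ _ h
      rcases hAE with h' | h'
      exacts [h' this.1, h' this.2]
    have hN : ((x 2 : ZMod 2) ^ 2 - β * x 2 * x 3 + γ * x 3 ^ 2) ^ 2 *
        ((A : ZMod 2) ^ 2 - β * A * E + γ * E ^ 2) = 0 := by
      have w0 : (A : ZMod 2) * (x 2 ^ 2 - γ * x 3 ^ 2) - γ * E * (2 * x 2 * x 3 - β * x 3 ^ 2) = 0 := by
        linear_combination h2 - (x 0 * x 2 + γ * x 1 * x 3 + 2 * γ * E * x 2 * x 3 : ZMod 2) * two
      have w1 : (E : ZMod 2) * (x 2 ^ 2 - γ * x 3 ^ 2) + (A - β * E) * (2 * x 2 * x 3 - β * x 3 ^ 2)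
          = 0 := by
        linear_combination h3 - (x 0 * x 3 + x 1 * x 2 + β * x 1 * x 3 + β * A * x 3 ^ 2
          + 2 * β * E * x 2 * x 3 : ZMod 2) * two
      linear_combination ((A : ZMod 2) * (x 2 ^ 2 - γ * x 3 ^ 2)
        - γ * E * (2 * x 2 * x 3 - β * x 3 ^ 2) - β * ((E : ZMod 2) * (x 2 ^ 2 - γ * x 3 ^ 2)
        + (A - β * E) * (2 * x 2 * x 3 - β * x 3 ^ 2))) * w0 + γ * ((E : ZMod 2) *
        (x 2 ^ 2 - γ * x 3 ^ 2) + (A - β * E) * (2 * x 2 * x 3 - β * x 3 ^ 2)) * w1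
    obtain ⟨f2, f3⟩ := hirr _ _
      (pow_eq_zero_iff two_ne_zero |>.1 ((mul_eq_zero.1 hN).resolve_right hNA))
    simp only [f2, f3] at h0 h1
    have hN : ((x 0 : ZMod 2) ^ 2 - β * x 0 * x 1 + γ * x 1 ^ 2) ^ 2 = 0 := by
      linear_combination (((x 0 : ZMod 2) ^ 2 - γ * x 1 ^ 2) - β * (2 * x 0 * x 1 - β * x 1 ^ 2))
        * (h0 - γ * x 1 ^ 2 * two) + γ * (2 * x 0 * x 1 - β * x 1 ^ 2) * (h1 - β * x 1 ^ 2 * two)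
    obtain ⟨f0, f1⟩ := hirr _ _ (pow_eq_zero_iff two_ne_zero |>.1 hN)
    simp [forall_fin_four, f0, f1, f2, f3]
  · simp
  · simp
  · intro l hl _ i
    exact (ZMod.intCast_zmod_eq_zero_iff_dvd _ _).2 (hl i (Finset.mem_univ i))

end Tower

/-! ### Towers in which θψ is divisible by p -/

section TowerDiv

variable {K : Type*} [Field K]

/-- The multiplication table of `1, θ, ψ, θψ/p` where `θ² = p(Pψ - βθ - γ)` and
`ψ² = p(Aψ + Bθ + C) + Eθψ`. -/
def towerDivTable (p β γ P A B C E : ℤ) : MulTable :=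
  let t11 := ![-p * γ, -p * β, p * P, 0]
  let t13 := ![P * p * C, P * p * B, P * p * A - γ, P * p * E - β * p]
  let t22 := ![p * C, p * B, p * A, p * E]
  let t23 := A • ![0, 0, 0, p] + E • t13 + B • t11 + C • ![0, 1, 0, 0]
  { t11 := t11
    t12 := ![0, 0, 0, p]
    t13 := t13
    t22 := t22
    t23 := t23
    t33 := P • (C • ![0, 0, 1, 0] + B • ![0, 0, 0, p] + A • t22 + E • t23) - β • t23
      - γ • ![C, B, A, E] }

/-- The products with τ are integral since both θ²/p and ψ²/p = Aψ + Eτ + Bθ + C are: θτ = (θ²/p)ψ,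
ψτ = θ(ψ²/p) and τ² = (θ²/p)(ψ²/p). They are verified after multiplication by p. -/
lemma towerDivTable_holds {θ ψ τ : K} {p β γ P A B C E : ℤ} (hp : (p : K) ≠ 0)
    (hθ : θ ^ 2 = (p * P : ℤ) * ψ - (p * β : ℤ) * θ - (p * γ : ℤ))
    (hψ : ψ ^ 2 = (p * A : ℤ) * ψ + E * (θ * ψ) + (p * B : ℤ) * θ + (p * C : ℤ))
    (hτ : p * τ = θ * ψ) : (towerDivTable p β γ P A B C E).Holds θ ψ τ := by
  push_cast at hθ hψ
  have h13 : θ * τ = (P * p * C : K) + P * p * B * θ + (P * p * A - γ) * ψ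
      + (P * p * E - β * p) * τ := by
    refine mul_left_cancel₀ hp ?_
    linear_combination θ * hτ + ψ * hθ + p * P * hψ - (p * P * E - p * β) * hτ
  have h23 : ψ * τ = (A * p : K) * τ + E * (θ * τ) + B * (θ * θ) + C * θ := by
    refine mul_left_cancel₀ hp ?_
    linear_combination ψ * hτ + θ * hψ - (A * p + E * θ) * hτ
  have h33 : τ * τ = (P * (C * ψ + B * (θ * ψ) + A * (ψ * ψ) + E * (ψ * τ)) - β * (ψ * τ)
      - γ * (C + B * θ + A * ψ + E * τ) : K) := by
    have h1 : (p : K) * (p * (τ * τ)) = p * ((P * ψ - β * θ - γ) * ψ ^ 2) := by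
      linear_combination (p * τ + θ * ψ) * hτ + ψ ^ 2 * hθ
    have h2 := mul_left_cancel₀ hp h1
    refine mul_left_cancel₀ hp ?_
    linear_combination h2 + (P * ψ - γ) * hψ + (β * ψ - P * E * ψ + γ * E) * hτ
  constructor <;> simp only [evalCoord, towerDivTable, Matrix.cons_val, Pi.add_apply,
    Pi.smul_apply, Pi.sub_apply, smul_eq_mul] <;> push_cast
  · linear_combination hθ
  · linear_combination -hτ
  · linear_combination h13
  · linear_combination hψ - E * hτ
  · linear_combination h23 + E * h13 + B * hθ
  · linear_combination h33 + P * (B * (-hτ) + A * (hψ - E * hτ)) + (P * E - β) * (h23 + E * h13 + B * hθ)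

/-- The case of a ramified `θ` such that `θψ/p` generates a separable residue algebra. -/
theorem isPIntegralBasis_towerDiv_of_ramified_separable [NumberField K] {p : ℕ} (hp : p.Prime)
    (hfr : Module.finrank ℚ K = 4) {θ ψ τ : K} (hli : LinearIndependent ℚ ![1, θ, ψ, τ])
    {β γ P A B C E : ℤ} (hθ : θ ^ 2 = (p * P : ℤ) * ψ - (p * β : ℤ) * θ - (p * γ : ℤ))
    (hψ : ψ ^ 2 = (p * A : ℤ) * ψ + E * (θ * ψ) + (p * B : ℤ) * θ + (p * C : ℤ))
    (hτ : p * τ = θ * ψ) (hγ : (γ : ZMod p) ≠ 0)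
    (hsep : ((γ * E ^ 2 - 4 * C : ℤ) : ZMod p) ≠ 0) :
    IsPIntegralBasis p ![1, θ, ψ, τ] := by
  have := Fact.mk hp
  have hp0 : (p : K) ≠ 0 := by exact_mod_cast hp.ne_zero
  push_cast at hsep
  refine isPIntegralBasis_of_mulTable hp hli hfr (towerDivTable_holds (p := p) (by simpa using hp0)
    hθ hψ (by simpa using hτ)) {0, 3} [![0, 1, 0, 0]] ?_ ?_ ?_ ?_ ?_
  · intro x y hy i hi
    simp only [Finset.mem_insert, Finset.mem_singleton, forall_eq_or_imp, forall_eq] at hy hi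
    obtain ⟨h0, h3⟩ := hy
    rcases hi with rfl | rfl <;> simp [MulTable.mul, towerDivTable, h0, h3]
  · intro x hx i hi
    simp [MulTable.mul, towerDivTable] at hx hi
    obtain ⟨h0, h3⟩ := hx
    -- Modulo I the element τ satisfies τ² = −γEτ − γC, a quadratic algebra of discriminant γ(γE² −
    -- 4C).
    have e3 : (x 3 : ZMod p) = 0 := by
      have : (x 3 : ZMod p) ^ 3 * (γ * (γ * E ^ 2 - 4 * C)) = 0 := by
        linear_combination 4 * (x 3 : ZMod p) * h0 - (γ * E * x 3 + 2 * x 0) * h3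
      simpa [hsep, hγ] using this
    have e0 : (x 0 : ZMod p) = 0 := by simpa [e3] using h0
    rcases hi with rfl | rfl <;> assumption
  · simp
  · simp [MulTable.mul, towerDivTable, forall_fin_four]
  · intro l hl he
    simp only [Finset.mem_insert, Finset.mem_singleton, forall_eq_or_imp, forall_eq] at hl
    obtain ⟨⟨l0, h0⟩, l3, h3⟩ := hl
    simp [MulTable.mul, towerDivTable, forall_fin_four] at he
    obtain ⟨k, ⟨hk0, -, -, hk3⟩, k0, k3⟩ := he
    have e0 : ((-γ * l 1 + P * C * l 3 : ℤ) : ZMod p) = 0 :=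
      ZMod.eq_zero_of_mul_eq hp (by linear_combination hk0) k0
    have e3 : ((l 2 + (P * E - β) * l 3 : ℤ) : ZMod p) = 0 :=
      ZMod.eq_zero_of_mul_eq hp (by linear_combination hk3) k3
    simp [h3, hγ] at e0 e3
    simp [forall_fin_four, h0, h3, e0, e3]

/-- The totally ramified case with `v(θ) = 1/2` and `v(ψ) = 3/4`. -/
theorem isPIntegralBasis_towerDiv_of_totally_ramified [NumberField K] {p : ℕ} (hp : p.Prime)
    (hfr : Module.finrank ℚ K = 4) {θ ψ τ : K} (hli : LinearIndependent ℚ ![1, θ, ψ, τ])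
    {β γ P A B C E : ℤ} (hθ : θ ^ 2 = (p * P : ℤ) * ψ - (p * β : ℤ) * θ - (p * γ : ℤ))
    (hψ : ψ ^ 2 = (p * A : ℤ) * ψ + E * (θ * ψ) + (p * B : ℤ) * θ + (p * C : ℤ))
    (hτ : p * τ = θ * ψ) (hγ : (γ : ZMod p) ≠ 0) (hB : (B : ZMod p) ≠ 0)
    (hE : (E : ZMod p) = 0) (hC : (C : ZMod p) = 0) :
    IsPIntegralBasis p ![1, θ, ψ, τ] := by
  have := Fact.mk hp
  have hp0 : (p : K) ≠ 0 := by exact_mod_cast hp.ne_zero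
  refine isPIntegralBasis_of_mulTable hp hli hfr (towerDivTable_holds (p := p) (by simpa using hp0)
    hθ hψ (by simpa using hτ)) {0} [![0, 0, 0, 1]] ?_ ?_ ?_ ?_ ?_
  · intro x y hy i hi
    simp only [Finset.mem_singleton, forall_eq] at hy hi
    subst hi
    simp [MulTable.mul, towerDivTable, hy, hC]
  · intro x hx i hi
    simp [MulTable.mul, towerDivTable, hC] at hx hi
    subst hi
    exact hx
  · simp
  · simp [MulTable.mul, towerDivTable, forall_fin_four, hC, hE]
  · intro l hl he
    simp only [Finset.mem_singleton, forall_eq] at hl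
    obtain ⟨l0, h0⟩ := hl
    simp [MulTable.mul, towerDivTable, forall_fin_four] at he
    obtain ⟨k, ⟨hk0, hk1, hk2, -⟩, k0⟩ := he
    -- The uniformizer is τ, of valuation 1/2 + 3/4 − 1 = 1/4. Coordinates 1 and 2 of τl modulo p
    -- give l₃ and then l₁; coordinate 0 divided by p gives l₂.
    have e1 := congrArg (Int.cast : ℤ → ZMod p) hk1
    have e2 := congrArg (Int.cast : ℤ → ZMod p) hk2
    simp [hE, hC, hB, hγ] at e1 e2
    have f3 : (l 3 : ZMod p) = 0 := by simpa [hB, hγ] using e1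
    have f1 : (l 1 : ZMod p) = 0 := by simpa [f3, hγ] using e2
    obtain ⟨C', rfl⟩ := (ZMod.intCast_zmod_eq_zero_iff_dvd _ _).1 hC
    have e0 : ((l 1 * (P * (p * C')) + l 2 * (E * (P * (p * C')) - B * γ)
        + l 3 * (P * (A * (p * C') + E * (E * (P * (p * C')) - B * γ))
          - β * (E * (P * (p * C')) - B * γ) - γ * C') : ℤ) : ZMod p) = 0 :=
      ZMod.eq_zero_of_mul_eq hp (by linear_combination hk0) k0
    simp [f3, f1, hB, hγ] at e0
    simp [forall_fin_four, h0, f1, e0, f3]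

end TowerDiv

/-! ### From the φ-adic development of the quartic to tower bases -/

section Root

variable {K : Type*} [Field K] [NumberField K]

/-- `θ` generates the quartic field `K` and is a root of `x⁴ + a x² + b x + c`. -/
structure IsQuarticRoot (a b c : ℤ) (θ : K) : Prop where
  finrank_eq : Module.finrank ℚ K = 4
  eq_zero : θ ^ 4 + a * θ ^ 2 + b * θ + c = 0
  linearIndependent : ∀ r₀ r₁ r₂ r₃ : ℚ, (r₀ + r₁ * θ + r₂ * θ ^ 2 + r₃ * θ ^ 3 : K) = 0 →
    r₀ = 0 ∧ r₁ = 0 ∧ r₂ = 0 ∧ r₃ = 0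

lemma quartic_natDegree (a b c : ℤ) : (quartic a b c).natDegree = 4 := by
  unfold quartic; compute_degree!

lemma quartic_monic (a b c : ℤ) : (quartic a b c).Monic := by
  unfold quartic; monicity!

/-- By Gauss's lemma the monic f remains irreducible over ℚ, so it is the minimal polynomial of θ.
-/
lemma isQuarticRoot {a b c : ℤ} (hf : Irreducible (quartic a b c)) {θ : K}
    (hθ : aeval θ (quartic a b c) = 0) (hK : IntermediateField.adjoin ℚ {θ} = ⊤) :
    IsQuarticRoot a b c θ := by
  have hmon := quartic_monic a b c
  have hint : IsIntegral ℚ θ := Algebra.IsIntegral.isIntegral θ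
  have hmin : minpoly ℚ θ = (quartic a b c).map (algebraMap ℤ ℚ) := by
    refine (minpoly.eq_of_irreducible_of_monic ?_ ?_ (hmon.map _)).symm
    · exact (hmon.irreducible_iff_irreducible_map_fraction_map (K := ℚ)).1 hf
    · rw [aeval_map_algebraMap]; exact hθ
  have hdeg : (minpoly ℚ θ).natDegree = 4 := by
    rw [hmin, hmon.natDegree_map, quartic_natDegree]
  refine ⟨?_, ?_, ?_⟩
  · rw [← hdeg, ← IntermediateField.adjoin.finrank hint, hK, IntermediateField.finrank_top']
  · simpa [quartic] using hθ
  · intro r₀ r₁ r₂ r₃ h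
    have hli := linearIndependent_pow (K := ℚ) θ
    rw [Fintype.linearIndependent_iff] at hli
    have hd : ∀ k : Fin 4, (k : ℕ) < (minpoly ℚ θ).natDegree := fun k => by rw [hdeg]; exact k.2
    have h' := hli (fun i => (![r₀, r₁, r₂, r₃] : Fin 4 → ℚ) (Fin.cast hdeg i)) (by
      rw [← (finCongr hdeg.symm).sum_comp]
      simp only [finCongr_apply, Fin.sum_univ_four, Algebra.smul_def]
      simpa using h)
    refine ⟨h' ⟨0, hd 0⟩, h' ⟨1, hd 1⟩, h' ⟨2, hd 2⟩, h' ⟨3, hd 3⟩⟩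

lemma IsQuarticRoot.linearIndependent_of_triangular {a b c : ℤ} {θ : K} (h : IsQuarticRoot a b c θ)
    {w₁ w₂ w₃ : K} {d₂ d₃ : ℤ} (hd₂ : d₂ ≠ 0) (hd₃ : d₃ ≠ 0) (q₁₀ q₂₀ q₂₁ q₃₀ q₃₁ q₃₂ : ℤ)
    (h₁ : w₁ = θ + q₁₀) (h₂ : d₂ * w₂ = θ ^ 2 + q₂₁ * θ + q₂₀)
    (h₃ : d₃ * w₃ = θ ^ 3 + q₃₂ * θ ^ 2 + q₃₁ * θ + q₃₀) :
    LinearIndependent ℚ ![1, w₁, w₂, w₃] := by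
  rw [Fintype.linearIndependent_iff]
  intro g hg
  have hd₂' : (d₂ : K) ≠ 0 := by exact_mod_cast hd₂
  have hd₃' : (d₃ : K) ≠ 0 := by exact_mod_cast hd₃
  have hd₂'' : (d₂ : ℚ) ≠ 0 := by exact_mod_cast hd₂
  have hd₃'' : (d₃ : ℚ) ≠ 0 := by exact_mod_cast hd₃
  have hg' : (g 0 + g 1 * w₁ + g 2 * w₂ + g 3 * w₃ : K) = 0 := by
    simpa [Fin.sum_univ_four, Algebra.smul_def] using hg
  have hw₂ : w₂ = (θ ^ 2 + q₂₁ * θ + q₂₀) / d₂ := by rw [eq_div_iff hd₂', mul_comm]; exact h₂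
  have hw₃ : w₃ = (θ ^ 3 + q₃₂ * θ ^ 2 + q₃₁ * θ + q₃₀) / d₃ := by
    rw [eq_div_iff hd₃', mul_comm]; exact h₃
  obtain ⟨e0, e1, e2, e3⟩ := h.linearIndependent
    (g 0 + g 1 * q₁₀ + g 2 / d₂ * q₂₀ + g 3 / d₃ * q₃₀) (g 1 + g 2 / d₂ * q₂₁ + g 3 / d₃ * q₃₁)
    (g 2 / d₂ + g 3 / d₃ * q₃₂) (g 3 / d₃) (by
      rw [← hg', h₁, hw₂, hw₃]
      push_cast
      ring)
  have f3 : g 3 = 0 := by simpa [hd₃''] using e3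
  have f2 : g 2 = 0 := by simpa [f3, hd₂''] using e2
  have f1 : g 1 = 0 := by simpa [f3, f2] using e1
  have f0 : g 0 = 0 := by simpa [f3, f2, f1] using e0
  exact forall_fin_four.2 ⟨f0, f1, f2, f3⟩

/-- The relation for ψ² is f(θ) = 0 written in the φ-adic development f = φ² + (A₀ − 2βx)φ + B₁x +
B₀ and divided by P². -/
lemma IsQuarticRoot.tower_sq {a b c : ℤ} {θ : K} (h : IsQuarticRoot a b c θ)
    {β γ P A B C E : ℤ} (hP : P ≠ 0) (hA : a - 2 * γ + β ^ 2 = -P * A) (hE : 2 * β = P * E)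
    (hB : b - (a - 2 * γ + β ^ 2) * β = -P ^ 2 * B)
    (hC : c - γ ^ 2 - (a - 2 * γ + β ^ 2) * γ = -P ^ 2 * C) {ψ : K}
    (hψ : ψ = (θ ^ 2 + β * θ + γ) / P) :
    θ ^ 2 = P * ψ - β * θ - γ ∧ ψ ^ 2 = A * ψ + E * (θ * ψ) + B * θ + C := by
  have hP' : (P : K) ≠ 0 := by exact_mod_cast hP
  have h1 : P * ψ = θ ^ 2 + β * θ + γ := by rw [hψ]; field_simp
  have hA' : (a - 2 * γ + β ^ 2 : K) = -P * A := by exact_mod_cast congrArg (Int.cast : ℤ → K) hA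
  have hE' : (2 * β : K) = P * E := by exact_mod_cast congrArg (Int.cast : ℤ → K) hE
  have hB' : (b - (a - 2 * γ + β ^ 2) * β : K) = -P ^ 2 * B := by
    exact_mod_cast congrArg (Int.cast : ℤ → K) hB
  have hC' : (c - γ ^ 2 - (a - 2 * γ + β ^ 2) * γ : K) = -P ^ 2 * C := by
    exact_mod_cast congrArg (Int.cast : ℤ → K) hC
  refine ⟨by linear_combination -h1, ?_⟩
  refine mul_left_cancel₀ (pow_ne_zero 2 hP') ?_
  linear_combination (P * ψ + θ ^ 2 + β * θ + γ) * h1 + h.eq_zero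
    - (P * ψ) * hA' + θ * P * ψ * hE' + (a - 2 * γ + β ^ 2 - 2 * β * θ) * h1
    - θ * hB' - hC'

lemma intCast_ne_zero_of_not_dvd {p : ℕ} {x : ℤ} (h : ¬ (p : ℤ) ∣ x) : (x : ZMod p) ≠ 0 :=
  fun h' => h ((ZMod.intCast_zmod_eq_zero_iff_dvd _ _).1 h')

/-- The family `1, θ, φ(θ)/pᵐ, θφ(θ)/pⁿ` where `φ = x² + βx + γ`. -/
def towerBasis (p : ℕ) (θ : K) (β γ : ℤ) (m n : ℕ) : Fin 4 → K :=
  ![1, θ, (θ ^ 2 + β * θ + γ) / (p : K) ^ m, θ * (θ ^ 2 + β * θ + γ) / (p : K) ^ n]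

lemma IsQuarticRoot.towerBasis_linearIndependent {a b c : ℤ} {θ : K} (h : IsQuarticRoot a b c θ)
    {p : ℕ} (hp : p.Prime) (β γ : ℤ) (m n : ℕ) :
    LinearIndependent ℚ (towerBasis p θ β γ m n) := by
  have hpm : ∀ k : ℕ, ((p : ℤ) ^ k) ≠ 0 := fun k => pow_ne_zero k (by exact_mod_cast hp.ne_zero)
  have hpK : ∀ k : ℕ, ((p : K) ^ k) ≠ 0 := fun k => pow_ne_zero k (by exact_mod_cast hp.ne_zero)
  refine h.linearIndependent_of_triangular (hpm m) (hpm n) 0 γ β 0 γ β (by simp) ?_ ?_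
  · have := hpK m
    push_cast
    field_simp
  · have := hpK n
    push_cast
    field_simp
    ring

/-- The hypotheses on `φ = x² + βx + γ` in terms of the `φ`-adic development of the quartic:
`f = φ² + (A₀ - 2βx)φ + B₁x + B₀` with `A₀ = -pᵐA`, `2β = pᵐE`, `B₁ = -p²ᵐB`, `B₀ = -p²ᵐC`. -/
structure Development (a b c : ℤ) (p m : ℕ) (β γ A B C E : ℤ) : Prop where
  hA : a - 2 * γ + β ^ 2 = -p ^ m * A
  hE : 2 * β = p ^ m * E
  hB : b - (a - 2 * γ + β ^ 2) * β = -(p ^ m) ^ 2 * B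
  hC : c - γ ^ 2 - (a - 2 * γ + β ^ 2) * γ = -(p ^ m) ^ 2 * C

theorem IsQuarticRoot.basis_of_ramified_separable {a b c : ℤ} {θ : K} (h : IsQuarticRoot a b c θ)
    {p : ℕ} (hp : p.Prime) {m : ℕ} {β γ A B C E : ℤ}
    (hd : Development a b c p (m + 1) (p * β) (p * γ) A B C E)
    (hsep : ¬ (p : ℤ) ∣ A ^ 2 + 4 * C)
    (hram : ¬ (p : ℤ) ∣ γ ^ 2 - p ^ m * γ * A - (p ^ m) ^ 2 * C) :
    IsPIntegralBasis p (towerBasis p θ (p * β) (p * γ) (m + 1) (m + 1)) := by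
  have hpm : ((p : ℤ) ^ (m + 1)) ≠ 0 := pow_ne_zero _ (by exact_mod_cast hp.ne_zero)
  obtain ⟨hθ, hψ⟩ := h.tower_sq hpm hd.hA hd.hE hd.hB hd.hC rfl
  have hli := h.towerBasis_linearIndependent hp (p * β) (p * γ) (m + 1) (m + 1)
  have e : (((p : ℤ) ^ (m + 1) : ℤ) : K) = (p : K) ^ (m + 1) := by push_cast; rfl
  rw [e] at hθ hψ
  unfold towerBasis at hli ⊢
  rw [mul_div_assoc] at hli ⊢
  -- One factor p of the denominator p^(m+1) is split off: in the relation for θ² it is the p that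
  -- makes θ ramified.
  refine isPIntegralBasis_tower_of_ramified_separable hp h.finrank_eq hli
    (β := β) (γ := γ) (P := p ^ m) (by push_cast; rw [← pow_succ']; push_cast at hθ; exact hθ) hψ
    (intCast_ne_zero_of_not_dvd hsep) (intCast_ne_zero_of_not_dvd hram)

theorem IsQuarticRoot.basis_of_totally_ramified {a b c : ℤ} {θ : K} (h : IsQuarticRoot a b c θ)
    {p : ℕ} (hp : p.Prime) {m : ℕ} {β γ A B C E : ℤ}
    (hd : Development a b c p (m + 1) (p * β) (p * γ) (p * A) B (p * C) E)
    (hγ : ¬ (p : ℤ) ∣ γ) (hB : ¬ (p : ℤ) ∣ B) :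
    IsPIntegralBasis p (towerBasis p θ (p * β) (p * γ) (m + 1) (m + 1)) := by
  have hpm : ((p : ℤ) ^ (m + 1)) ≠ 0 := pow_ne_zero _ (by exact_mod_cast hp.ne_zero)
  obtain ⟨hθ, hψ⟩ := h.tower_sq hpm hd.hA hd.hE hd.hB hd.hC rfl
  have hli := h.towerBasis_linearIndependent hp (p * β) (p * γ) (m + 1) (m + 1)
  have e : (((p : ℤ) ^ (m + 1) : ℤ) : K) = (p : K) ^ (m + 1) := by push_cast; rfl
  rw [e] at hθ hψ
  unfold towerBasis at hli ⊢
  rw [mul_div_assoc] at hli ⊢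
  exact isPIntegralBasis_tower_of_totally_ramified hp h.finrank_eq hli
    (β := β) (γ := γ) (P := p ^ m) (A := A) (C := C)
    (by push_cast; rw [← pow_succ']; push_cast at hθ; exact hθ)
    hψ (intCast_ne_zero_of_not_dvd hγ) (intCast_ne_zero_of_not_dvd hB)

theorem IsQuarticRoot.basis_of_inert_ramified {a b c : ℤ} {θ : K} (h : IsQuarticRoot a b c θ)
    {p : ℕ} (hp : p.Prime) {m : ℕ} {β γ A B C E : ℤ}
    (hd : Development a b c p m β γ (p * A) (p * B) (p * C) (p * E))
    (hirr : ∀ x y : ZMod p, x ^ 2 - β * x * y + γ * y ^ 2 = 0 → x = 0 ∧ y = 0)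
    (hBC : ¬ (p : ℤ) ∣ C ∨ ¬ (p : ℤ) ∣ B) :
    IsPIntegralBasis p (towerBasis p θ β γ m m) := by
  have hpm : ((p : ℤ) ^ m) ≠ 0 := pow_ne_zero _ (by exact_mod_cast hp.ne_zero)
  obtain ⟨hθ, hψ⟩ := h.tower_sq hpm hd.hA hd.hE hd.hB hd.hC rfl
  have hli := h.towerBasis_linearIndependent hp β γ m m
  have e : (((p : ℤ) ^ m : ℤ) : K) = (p : K) ^ m := by push_cast; rfl
  rw [e] at hθ hψ
  unfold towerBasis at hli ⊢
  rw [mul_div_assoc] at hli ⊢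
  exact isPIntegralBasis_tower_of_inert_ramified hp h.finrank_eq hli
    (β := β) (γ := γ) (P := p ^ m) (A := A) (B := B) (C := C) (E := E) (by push_cast; exact hθ)
    hψ hirr
    (hBC.imp intCast_ne_zero_of_not_dvd intCast_ne_zero_of_not_dvd)

theorem IsQuarticRoot.basis_of_unramified_odd {a b c : ℤ} {θ : K} (h : IsQuarticRoot a b c θ)
    {p : ℕ} (hp : p.Prime) (hp2 : 2 < p) {m : ℕ} {β γ A B C E : ℤ}
    (hd : Development a b c p (m + 1) β γ (p * A) B C (p * E))
    (hirr : ∀ x y : ZMod p, x ^ 2 - β * x * y + γ * y ^ 2 = 0 → x = 0 ∧ y = 0)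
    (hBC : ¬ (p : ℤ) ∣ C ∨ ¬ (p : ℤ) ∣ B) :
    IsPIntegralBasis p (towerBasis p θ β γ (m + 1) (m + 1)) := by
  have hpm : ((p : ℤ) ^ (m + 1)) ≠ 0 := pow_ne_zero _ (by exact_mod_cast hp.ne_zero)
  obtain ⟨hθ, hψ⟩ := h.tower_sq hpm hd.hA hd.hE hd.hB hd.hC rfl
  have hli := h.towerBasis_linearIndependent hp β γ (m + 1) (m + 1)
  have e : (((p : ℤ) ^ (m + 1) : ℤ) : K) = (p : K) ^ (m + 1) := by push_cast; rfl
  rw [e] at hθ hψ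
  unfold towerBasis at hli ⊢
  rw [mul_div_assoc] at hli ⊢
  exact isPIntegralBasis_tower_of_unramified_odd hp hp2 h.finrank_eq hli
    (β := β) (γ := γ) (P := p ^ m) (A := A) (E := E) (by push_cast; rw [← pow_succ']; exact hθ)
    hψ hirr
    (hBC.imp intCast_ne_zero_of_not_dvd intCast_ne_zero_of_not_dvd)

theorem IsQuarticRoot.basis_of_unramified_two {a b c : ℤ} {θ : K} (h : IsQuarticRoot a b c θ)
    {m : ℕ} {β γ A B C E : ℤ}
    (hd : Development a b c 2 (m + 1) β γ A B C E)
    (hirr : ∀ x y : ZMod 2, x ^ 2 - β * x * y + γ * y ^ 2 = 0 → x = 0 ∧ y = 0)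
    (hAE : ¬ (2 : ℤ) ∣ A ∨ ¬ (2 : ℤ) ∣ E) :
    IsPIntegralBasis 2 (towerBasis 2 θ β γ (m + 1) (m + 1)) := by
  have hp := Nat.prime_two
  have hpm : (((2 : ℕ) : ℤ) ^ (m + 1)) ≠ 0 := pow_ne_zero _ (by exact_mod_cast hp.ne_zero)
  obtain ⟨hθ, hψ⟩ := h.tower_sq hpm hd.hA hd.hE hd.hB hd.hC rfl
  have hli := h.towerBasis_linearIndependent hp β γ (m + 1) (m + 1)
  have e : ((((2 : ℕ) : ℤ) ^ (m + 1) : ℤ) : K) = ((2 : ℕ) : K) ^ (m + 1) := by push_cast; rfl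
  rw [e] at hθ hψ
  unfold towerBasis at hli ⊢
  rw [mul_div_assoc] at hli ⊢
  exact isPIntegralBasis_tower_of_unramified_two h.finrank_eq hli
    (β := β) (γ := γ) (P := 2 ^ m) (A := A) (B := B) (C := C) (E := E)
    (by push_cast; rw [← pow_succ']; push_cast at hθ; exact hθ)
    hψ hirr (hAE.imp intCast_ne_zero_of_not_dvd intCast_ne_zero_of_not_dvd)

lemma mul_towerBasis_three {p : ℕ} (hp : p.Prime) (θ : K) (φ : K) (m : ℕ) :
    (p : K) * (θ * φ / (p : K) ^ (m + 1)) = θ * (φ / (p : K) ^ m) := by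
  have : (p : K) ≠ 0 := by exact_mod_cast hp.ne_zero
  rw [pow_succ']
  field_simp

theorem IsQuarticRoot.basis_succ_of_ramified_separable {a b c : ℤ} {θ : K}
    (h : IsQuarticRoot a b c θ)
    {p : ℕ} (hp : p.Prime) {m : ℕ} {β γ A B C E : ℤ}
    (hd : Development a b c p (m + 1) (p * β) (p * γ) (p * A) (p * B) (p * C) E)
    (hγ : ¬ (p : ℤ) ∣ γ) (hsep : ¬ (p : ℤ) ∣ γ * E ^ 2 - 4 * C) :
    IsPIntegralBasis p (towerBasis p θ (p * β) (p * γ) (m + 1) (m + 2)) := by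
  have hpm : ((p : ℤ) ^ (m + 1)) ≠ 0 := pow_ne_zero _ (by exact_mod_cast hp.ne_zero)
  obtain ⟨hθ, hψ⟩ := h.tower_sq hpm hd.hA hd.hE hd.hB hd.hC rfl
  have hli := h.towerBasis_linearIndependent hp (p * β) (p * γ) (m + 1) (m + 2)
  have hτ := mul_towerBasis_three hp θ (θ ^ 2 + ((p * β : ℤ) : K) * θ + ((p * γ : ℤ) : K)) (m + 1)
  have e : (((p : ℤ) ^ (m + 1) : ℤ) : K) = (p : K) ^ (m + 1) := by push_cast; rfl
  rw [e] at hθ hψ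
  exact isPIntegralBasis_towerDiv_of_ramified_separable hp h.finrank_eq hli
    (β := β) (γ := γ) (P := p ^ m) (A := A) (B := B) (C := C) (E := E)
    (by push_cast; rw [← pow_succ']; push_cast at hθ; exact hθ) hψ hτ
    (intCast_ne_zero_of_not_dvd hγ) (intCast_ne_zero_of_not_dvd hsep)

theorem IsQuarticRoot.basis_succ_of_totally_ramified {a b c : ℤ} {θ : K}
    (h : IsQuarticRoot a b c θ)
    {p : ℕ} (hp : p.Prime) {m : ℕ} {β γ A B C E : ℤ}
    (hd : Development a b c p (m + 1) (p * β) (p * γ) (p * A) (p * B) (p * C) E)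
    (hγ : ¬ (p : ℤ) ∣ γ) (hB : ¬ (p : ℤ) ∣ B) (hE : (p : ℤ) ∣ E) (hC : (p : ℤ) ∣ C) :
    IsPIntegralBasis p (towerBasis p θ (p * β) (p * γ) (m + 1) (m + 2)) := by
  have hpm : ((p : ℤ) ^ (m + 1)) ≠ 0 := pow_ne_zero _ (by exact_mod_cast hp.ne_zero)
  obtain ⟨hθ, hψ⟩ := h.tower_sq hpm hd.hA hd.hE hd.hB hd.hC rfl
  have hli := h.towerBasis_linearIndependent hp (p * β) (p * γ) (m + 1) (m + 2)
  have hτ := mul_towerBasis_three hp θ (θ ^ 2 + ((p * β : ℤ) : K) * θ + ((p * γ : ℤ) : K)) (m + 1)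
  have e : (((p : ℤ) ^ (m + 1) : ℤ) : K) = (p : K) ^ (m + 1) := by push_cast; rfl
  rw [e] at hθ hψ
  exact isPIntegralBasis_towerDiv_of_totally_ramified hp h.finrank_eq hli
    (β := β) (γ := γ) (P := p ^ m) (A := A) (B := B) (C := C) (E := E)
    (by push_cast; rw [← pow_succ']; push_cast at hθ; exact hθ) hψ hτ
    (intCast_ne_zero_of_not_dvd hγ) (intCast_ne_zero_of_not_dvd hB)
    ((ZMod.intCast_zmod_eq_zero_iff_dvd _ _).2 hE) ((ZMod.intCast_zmod_eq_zero_iff_dvd _ _).2 hC)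

end Root

/-! ### Valuations as divisibilities -/

section Valuation

lemma le_vp_iff {p : ℕ} {n : ℕ} {x : ℤ} : (n : ℕ∞) ≤ vp p x ↔ (p : ℤ) ^ n ∣ x :=
  pow_dvd_iff_le_emultiplicity.symm

lemma lt_vp_iff {p : ℕ} {n : ℕ} {x : ℤ} : (n : ℕ∞) < vp p x ↔ (p : ℤ) ^ (n + 1) ∣ x := by
  rw [← le_vp_iff, Nat.cast_add, Nat.cast_one, ENat.add_one_le_iff (ENat.natCast_ne_top n)]

lemma vp_eq_iff {p : ℕ} (hp : p.Prime) {n : ℕ} {x : ℤ} :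
    vp p x = n ↔ ∃ k, x = (p : ℤ) ^ n * k ∧ ¬ (p : ℤ) ∣ k := by
  have hp0 : (p : ℤ) ^ n ≠ 0 := pow_ne_zero _ (by exact_mod_cast hp.ne_zero)
  unfold vp
  rw [emultiplicity_eq_coe]
  constructor
  · rintro ⟨⟨k, rfl⟩, h⟩
    refine ⟨k, rfl, fun ⟨l, hl⟩ => h ⟨l, ?_⟩⟩
    rw [hl, pow_succ, mul_assoc]
  · rintro ⟨k, rfl, h⟩
    refine ⟨Dvd.intro _ rfl, ?_⟩
    rw [pow_succ, mul_dvd_mul_iff_left hp0]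
    exact h

lemma vp_two_eq_iff {n : ℕ} {x : ℤ} : vp 2 x = n ↔ ∃ k, x = 2 ^ n * (2 * k + 1) := by
  rw [vp_eq_iff Nat.prime_two]
  constructor
  · rintro ⟨k, rfl, h⟩
    push_cast at h
    exact ⟨k / 2, by push_cast; congr 1; omega⟩
  · rintro ⟨k, rfl⟩
    exact ⟨_, rfl, by push_cast; omega⟩

lemma vp_eq_top_iff {p : ℕ} (hp : p.Prime) {x : ℤ} : vp p x = ⊤ ↔ x = 0 := by
  unfold vp
  constructor
  · intro h
    by_contra hx
    exact (finiteMultiplicity_iff_emultiplicity_ne_top.1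
      (Int.finiteMultiplicity_iff.2 ⟨by simpa using hp.ne_one, hx⟩)) h
  · rintro rfl
    exact emultiplicity_zero _

end Valuation

/-! ### Replacing φ by a congruent polynomial -/

section BaseChange

variable {K : Type*} [Field K] [NumberField K]

/-- `1, θ, ψ, θψ` may be changed by integral multiples of `1, θ` in `ψ`. -/
lemma isPIntegralBasis_towerBasis_of_add {p : ℕ} (hp : p.Prime) {θ : K} {β γ k₁ k₀ : ℤ} {m : ℕ}
    (h : IsPIntegralBasis p (towerBasis p θ (β + p ^ m * k₁) (γ + p ^ m * k₀) m m)) :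
    IsPIntegralBasis p (towerBasis p θ β γ m m) := by
  have hp0 : (p : K) ≠ 0 := by exact_mod_cast hp.ne_zero
  refine h.of_unipotent_int hp 0 (-k₀) (-k₁) (k₁ * (γ + p ^ m * k₀))
    (-k₀ + k₁ * (β + p ^ m * k₁)) (-k₁ * p ^ m) (by simp) ?_ ?_
  · push_cast
    field_simp
    ring
  · push_cast
    field_simp
    ring

/-- The denominator of the last element is p^(m+2), so the constant term may only move by p^(m+2)k₀.
The linear term may move by p^(m+1)k₁, because the resulting k₁θ²/p is a combination of 1, θ, ψ: p
divides the lower coefficients of φ. -/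
lemma isPIntegralBasis_towerBasis_succ_of_add {p : ℕ} (hp : p.Prime) {θ : K} {β γ k₁ k₀ : ℤ}
    {m : ℕ} (h : IsPIntegralBasis p (towerBasis p θ (p * β + p ^ (m + 1) * k₁)
      (p * γ + p ^ (m + 2) * k₀) (m + 1) (m + 2))) :
    IsPIntegralBasis p (towerBasis p θ (p * β) (p * γ) (m + 1) (m + 2)) := by
  have hp0 : (p : K) ≠ 0 := by exact_mod_cast hp.ne_zero
  refine h.of_unipotent_int hp 0 (-p * k₀) (-k₁) (k₁ * (γ + p ^ (m + 1) * k₀))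
    (-k₀ + k₁ * (β + p ^ m * k₁)) (-k₁ * p ^ m) (by simp) ?_ ?_
  · push_cast
    field_simp
    ring
  · push_cast
    field_simp
    ring

end BaseChange

/-! ### The four types of irregular bases at 2, by the fractional part of ν -/

section Irregular

variable {K : Type*} [Field K] [NumberField K]

/-- The conclusion for a row `Q, ν` of the irregular tables. -/
def IsIrregularBasis (θ : K) (Q : ℤ[X]) (ν : ℚ) : Prop :=
  IsPIntegralBasis 2 ![1, θ, aeval θ Q / 2 ^ ⌊ν⌋₊, θ * aeval θ Q / 2 ^ ⌊ν + 1 / 2⌋₊]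

lemma isIrregularBasis_of_towerBasis {θ : K} {Q : ℤ[X]} {ν : ℚ} {β γ : ℤ} {m n : ℕ}
    (h : IsPIntegralBasis 2 (towerBasis 2 θ β γ m n)) (hQ : aeval θ Q = θ ^ 2 + β * θ + γ)
    (hm : (m : ℚ) ≤ ν ∧ ν < m + 1) (hn : (n : ℚ) ≤ ν + 1 / 2 ∧ ν + 1 / 2 < n + 1) :
    IsIrregularBasis θ Q ν := by
  have hν : 0 ≤ ν := m.cast_nonneg.trans hm.1
  unfold IsIrregularBasis
  rw [(Nat.floor_eq_iff hν).2 hm, (Nat.floor_eq_iff (by positivity)).2 hn, hQ]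
  exact h

/-- Type ν = m + 2. With an odd coefficient of ψ, the equation of ψ is separable modulo 2, and the
norm of θ²/2 is odd. -/
lemma IsQuarticRoot.irregular_int {a b c : ℤ} {θ : K} (h : IsQuarticRoot a b c θ)
    {m : ℕ} {β γ A B C E : ℤ}
    (hd : Development a b c 2 (m + 2) (2 * β) (2 * (2 * γ + 1)) (2 * A + 1) B C E) :
    IsPIntegralBasis 2 (towerBasis 2 θ (2 * β) (2 * (2 * γ + 1)) (m + 2) (m + 2)) := by
  refine h.basis_of_ramified_separable Nat.prime_two (m := m + 1) hd ?_ ?_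
  · intro ⟨k, hk⟩
    have : 2 * (2 * A ^ 2 + 2 * A + 2 * C - k) = -1 := by push_cast at hk; linear_combination hk
    omega
  · intro ⟨k, hk⟩
    have : 2 * (2 * γ ^ 2 + 2 * γ - 2 ^ m * (2 * γ + 1) * (2 * A + 1) - 2 * (2 ^ m) ^ 2 * C - k)
        = -1 := by
      push_cast at hk
      linear_combination hk
    omega

/-- Type ν = m + 1 + 1/4: here ψ² ≡ θ up to terms of higher valuation, so ψ is a uniformizer. -/
lemma IsQuarticRoot.irregular_quarter {a b c : ℤ} {θ : K} (h : IsQuarticRoot a b c θ)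
    {m : ℕ} {β γ A B C E : ℤ}
    (hd : Development a b c 2 (m + 1) (2 * β) (2 * (2 * γ + 1)) (2 * A) (2 * B + 1) (2 * C) E) :
    IsPIntegralBasis 2 (towerBasis 2 θ (2 * β) (2 * (2 * γ + 1)) (m + 1) (m + 1)) :=
  h.basis_of_totally_ramified Nat.prime_two hd (by push_cast; omega) (by push_cast; omega)

/-- Type ν = m + 1 + 1/2: here τ = θψ/2 satisfies a separable equation modulo 2 because the
coefficient of θψ in ψ² is odd. -/
lemma IsQuarticRoot.irregular_half {a b c : ℤ} {θ : K} (h : IsQuarticRoot a b c θ)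
    {m : ℕ} {β γ A B C E : ℤ}
    (hd : Development a b c 2 (m + 1) (2 * β) (2 * (2 * γ + 1)) (2 * A) (2 * B) (2 * C)
      (2 * E + 1)) :
    IsPIntegralBasis 2 (towerBasis 2 θ (2 * β) (2 * (2 * γ + 1)) (m + 1) (m + 2)) := by
  refine h.basis_succ_of_ramified_separable Nat.prime_two hd (by push_cast; omega) ?_
  intro ⟨k, hk⟩
  have : 2 * (γ * (2 * E + 1) ^ 2 + 2 * E ^ 2 + 2 * E - 2 * C - k) = -1 := by
    push_cast at hk
    linear_combination hk
  omega

/-- Type ν = m + 1 + 3/4: the dominant term of ψ² is 2θ up to a unit, so ψ has valuation 3/4 and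
θψ/2 is a uniformizer. -/
lemma IsQuarticRoot.irregular_three_quarters {a b c : ℤ} {θ : K} (h : IsQuarticRoot a b c θ)
    {m : ℕ} {β γ A B C E : ℤ}
    (hd : Development a b c 2 (m + 1) (2 * β) (2 * (2 * γ + 1)) (2 * A) (2 * (2 * B + 1))
      (2 * (2 * C)) (2 * E)) :
    IsPIntegralBasis 2 (towerBasis 2 θ (2 * β) (2 * (2 * γ + 1)) (m + 1) (m + 2)) :=
  h.basis_succ_of_totally_ramified Nat.prime_two hd (by push_cast; omega) (by push_cast; omega)
    (by push_cast; exact Dvd.intro _ rfl) (by push_cast; exact Dvd.intro _ rfl)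

end Irregular

/-! ### The rows of the irregular tables, each by an explicit development -/

section IrregularRows

set_option linter.unusedSimpArgs false
set_option linter.unusedSectionVars false

variable {K : Type*} [Field K] [NumberField K]

lemma aeval_int_two (θ : K) : aeval θ (2 : ℤ[X]) = 2 := map_ofNat _ 2

lemma aeval_int_four (θ : K) : aeval θ (4 : ℤ[X]) = 4 := map_ofNat _ 4

/-- The optimal φ of a row need not be its Q. When the fractional part of ν is below 1/2, both
exponents are m, and Q may differ from φ by any multiple of 2ᵐ of degree at most 1. -/
lemma isIrregularBasis_of_add {θ : K} {Q : ℤ[X]} {ν : ℚ} {β γ : ℤ} {m : ℕ} (k₁ k₀ β' γ' : ℤ)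
    (h : IsPIntegralBasis 2 (towerBasis 2 θ β' γ' m m)) (hβ : β' = β + 2 ^ m * k₁)
    (hγ : γ' = γ + 2 ^ m * k₀) (hQ : aeval θ Q = θ ^ 2 + β * θ + γ)
    (hm : (m : ℚ) ≤ ν ∧ ν + 1 / 2 < m + 1) : IsIrregularBasis θ Q ν := by
  subst hβ hγ
  exact isIrregularBasis_of_towerBasis (isPIntegralBasis_towerBasis_of_add Nat.prime_two h) hQ
    ⟨hm.1, by linarith [hm.2]⟩ ⟨by linarith [hm.1], hm.2⟩

/-- The same correction when the fractional part of ν is at least 1/2, so that the two exponents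
differ by one. -/
lemma isIrregularBasis_of_add_succ {θ : K} {Q : ℤ[X]} {ν : ℚ} {β γ : ℤ} {m : ℕ} (k₁ k₀ β' γ' : ℤ)
    (h : IsPIntegralBasis 2 (towerBasis 2 θ β' γ' (m + 1) (m + 2)))
    (hβ : β' = 2 * β + 2 ^ (m + 1) * k₁)
    (hγ : γ' = 2 * γ + 2 ^ (m + 2) * k₀)
    (hQ : aeval θ Q = θ ^ 2 + ((2 * β : ℤ) : K) * θ + ((2 * γ : ℤ) : K))
    (hm : (m + 3 / 2 : ℚ) ≤ ν ∧ ν < m + 2) : IsIrregularBasis θ Q ν := by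
  subst hβ hγ
  refine isIrregularBasis_of_towerBasis
    (isPIntegralBasis_towerBasis_succ_of_add Nat.prime_two h) hQ ⟨?_, ?_⟩ ⟨?_, ?_⟩ <;> push_cast <;>
    linarith [hm.1, hm.2]

lemma IsQuarticRoot.irregular_b_two {θ : K} {a' b' c' : ℤ}
    (hθ : IsQuarticRoot (4 * a') (4 * (2 * b' + 1))
      (4 * (2 * c' + 1)) θ) :
    IsIrregularBasis θ (X ^ 2) (5 / 4) := by
  -- The development that fits is that of φ = x² + 2, which differs from Q = x² by 2.
  have key := hθ.irregular_quarter (m := 0) (β := 0) (γ := 0)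
    (A := 1 - a') (B := -b' - 1) (C := a' - c' - 1) (E := 0)
    (by constructor <;> push_cast <;> ring)
  refine isIrregularBasis_of_add (β := 2 * (0) - 2 ^ (0 + 1) * 0)
    (γ := 2 * (2 * (0) + 1) - 2 ^ (0 + 1) * 1) 0 1 _ _ key (by ring) (by ring)
    (by simp only [map_add, map_sub, map_mul, map_pow, aeval_X, aeval_C, aeval_int_two, aeval_int_four,
      algebraMap_int_eq, eq_intCast, map_intCast, map_one]; push_cast; ring) ?_
  constructor <;> push_cast <;> linarith

lemma IsQuarticRoot.irregular_b_three_1 {θ : K} {a' b' h : ℤ}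
    (hθ : IsQuarticRoot (4 * a') (8 * (2 * b' + 1))
      (8 * (2 * h + 1) + 4 - 8 * a') θ) :
    IsIrregularBasis θ (X ^ 2 + 2) (7 / 4) := by
  have key := hθ.irregular_three_quarters (m := 0) (β := 0) (γ := 0)
    (A := 1 - a') (B := -b' - 1) (C := a' - h - 1) (E := 0)
    (by constructor <;> push_cast <;> ring)
  refine isIrregularBasis_of_towerBasis key
    (by simp only [map_add, map_sub, map_mul, map_pow, aeval_X, aeval_C, aeval_int_two, aeval_int_four,
      algebraMap_int_eq, eq_intCast, map_intCast, map_one]; push_cast; ring) ?_ ?_ <;> constructor <;> push_cast <;>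
    linarith

lemma IsQuarticRoot.irregular_b_three_2 {θ : K} {a' b' h : ℤ}
    (hθ : IsQuarticRoot (4 * (2 * a' + 1)) (8 * (2 * b' + 1))
      (16 * h + 4 - 8 * (2 * a' + 1)) θ) :
    IsIrregularBasis θ (X ^ 2 + 2 * X + 2) (2) := by
  have key := hθ.irregular_int (m := 0) (β := 1) (γ := 0)
    (A := -a' - 1) (B := a' - b') (C := 2 * a' + 1 - h) (E := 1)
    (by constructor <;> push_cast <;> ring)
  refine isIrregularBasis_of_towerBasis key
    (by simp only [map_add, map_sub, map_mul, map_pow, aeval_X, aeval_C, aeval_int_two, aeval_int_four,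
      algebraMap_int_eq, eq_intCast, map_intCast, map_one]; push_cast; ring) ?_ ?_ <;> constructor <;> push_cast <;>
    linarith

lemma IsQuarticRoot.irregular_b_three_3 {θ : K} {a' b' h : ℤ}
    (hθ : IsQuarticRoot (8 * a') (8 * (2 * b' + 1))
      (16 * h + 4 - 16 * a') θ) :
    IsIrregularBasis θ (X ^ 2 + 2) (7 / 4) := by
  -- The development that fits is that of x² + 2x + 2; the term 2x is removed afterwards.
  have key := hθ.irregular_three_quarters (m := 0) (β := 1) (γ := 0)
    (A := -2 * a') (B := a' - b' - 1) (C := 2 * a' - h) (E := 1)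
    (by constructor <;> push_cast <;> ring)
  refine isIrregularBasis_of_add_succ (β := 1 - 2 ^ (0) * 1)
    (γ := 2 * (0) + 1 - 2 ^ (0 + 1) * 0) 1 0 _ _ key (by ring) (by ring)
    (by simp only [map_add, map_sub, map_mul, map_pow, aeval_X, aeval_C, aeval_int_two, aeval_int_four,
      algebraMap_int_eq, eq_intCast, map_intCast, map_one]; push_cast; ring) ?_
  constructor <;> push_cast <;> linarith

lemma IsQuarticRoot.irregular_b_four_1 {θ : K} {a' b' h : ℤ}
    (hθ : IsQuarticRoot (4 * (2 * a' + 1)) (16 * b')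
      (16 * h + 4 - 8 * (2 * a' + 1)) θ) :
    IsIrregularBasis θ (X ^ 2 + 2) (7 / 4) := by
  have key := hθ.irregular_three_quarters (m := 0) (β := 1) (γ := 0)
    (A := -(2 * a' + 1)) (B := a' - b') (C := 2 * a' + 1 - h) (E := 1)
    (by constructor <;> push_cast <;> ring)
  refine isIrregularBasis_of_add_succ (β := 1 - 2 ^ (0) * 1)
    (γ := 2 * (0) + 1 - 2 ^ (0 + 1) * 0) 1 0 _ _ key (by ring) (by ring)
    (by simp only [map_add, map_sub, map_mul, map_pow, aeval_X, aeval_C, aeval_int_two, aeval_int_four,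
      algebraMap_int_eq, eq_intCast, map_intCast, map_one]; push_cast; ring) ?_
  constructor <;> push_cast <;> linarith

lemma IsQuarticRoot.irregular_b_four_2 {θ : K} {a' b' h : ℤ}
    (hθ : IsQuarticRoot (8 * a') (16 * b')
      (8 * (2 * h + 1) + 4 - 16 * a') θ) :
    IsIrregularBasis θ (X ^ 2 + 2) (2) := by
  have key := hθ.irregular_int (m := 0) (β := 0) (γ := 0)
    (A := -a') (B := -b') (C := 2 * a' - h - 1) (E := 0)
    (by constructor <;> push_cast <;> ring)
  refine isIrregularBasis_of_towerBasis key
    (by simp only [map_add, map_sub, map_mul, map_pow, aeval_X, aeval_C, aeval_int_two, aeval_int_four,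
      algebraMap_int_eq, eq_intCast, map_intCast, map_one]; push_cast; ring) ?_ ?_ <;> constructor <;> push_cast <;>
    linarith

lemma IsQuarticRoot.irregular_b_four_3 {θ : K} {a' k h : ℤ}
    (hθ : IsQuarticRoot (8 * a') (32 * k - 16 * a')
      (16 * (2 * h + 1) + 4 - 16 * a') θ) :
    IsIrregularBasis θ (X ^ 2 + 2 * X + 2) (9 / 4) := by
  -- The development is that of x² + 2x + 6, and 6 ≡ 2 modulo the denominator 4.
  have key := hθ.irregular_quarter (m := 1) (β := 1) (γ := 1)
    (A := 1 - a') (B := a' - k - 1) (C := 2 * a' - h - 1) (E := 1)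
    (by constructor <;> push_cast <;> ring)
  refine isIrregularBasis_of_add (β := 2 * (1) - 2 ^ (1 + 1) * 0)
    (γ := 2 * (2 * (1) + 1) - 2 ^ (1 + 1) * 1) 0 1 _ _ key (by ring) (by ring)
    (by simp only [map_add, map_sub, map_mul, map_pow, aeval_X, aeval_C, aeval_int_two, aeval_int_four,
      algebraMap_int_eq, eq_intCast, map_intCast, map_one]; push_cast; ring) ?_
  constructor <;> push_cast <;> linarith

lemma IsQuarticRoot.irregular_b_four_4 {θ : K} {a' k h : ℤ}
    (hθ : IsQuarticRoot (8 * a') (16 * (2 * k + 1) - 16 * a')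
      (16 * (2 * h + 1) + 4 - 16 * a') θ) :
    IsIrregularBasis θ (X ^ 2 + 2 * X - 2) (5 / 2) := by
  have key := hθ.irregular_half (m := 1) (β := 1) (γ := -1)
    (A := -a' - 1) (B := a' - k) (C := -h - 1) (E := 0)
    (by constructor <;> push_cast <;> ring)
  refine isIrregularBasis_of_towerBasis key
    (by simp only [map_add, map_sub, map_mul, map_pow, aeval_X, aeval_C, aeval_int_two, aeval_int_four,
      algebraMap_int_eq, eq_intCast, map_intCast, map_one]; push_cast; ring) ?_ ?_ <;> constructor <;> push_cast <;>
    linarith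

lemma IsQuarticRoot.irregular_b_four_5 {θ : K} {a' k h : ℤ}
    (hθ : IsQuarticRoot (8 * a') (16 * (2 * k + 1) - 16 * a')
      (32 * h + 4 - 16 * a') θ) :
    IsIrregularBasis θ (X ^ 2 + 2 * X + 2) (9 / 4) := by
  have key := hθ.irregular_quarter (m := 1) (β := 1) (γ := 0)
    (A := -a') (B := a' - k - 1) (C := a' - h) (E := 1)
    (by constructor <;> push_cast <;> ring)
  refine isIrregularBasis_of_towerBasis key
    (by simp only [map_add, map_sub, map_mul, map_pow, aeval_X, aeval_C, aeval_int_two, aeval_int_four,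
      algebraMap_int_eq, eq_intCast, map_intCast, map_one]; push_cast; ring) ?_ ?_ <;> constructor <;> push_cast <;>
    linarith

lemma IsQuarticRoot.irregular_b_four_6 {θ : K} {a' k h : ℤ}
    (hθ : IsQuarticRoot (8 * a') (32 * k - 16 * a')
      (32 * h + 4 - 16 * a') θ) :
    IsIrregularBasis θ (X ^ 2 + 2 * X + 2) (5 / 2) := by
  have key := hθ.irregular_half (m := 1) (β := 1) (γ := 0)
    (A := -a') (B := a' - k) (C := a' - h) (E := 0)
    (by constructor <;> push_cast <;> ring)
  refine isIrregularBasis_of_towerBasis key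
    (by simp only [map_add, map_sub, map_mul, map_pow, aeval_X, aeval_C, aeval_int_two, aeval_int_four,
      algebraMap_int_eq, eq_intCast, map_intCast, map_one]; push_cast; ring) ?_ ?_ <;> constructor <;> push_cast <;>
    linarith

lemma IsQuarticRoot.irregular_sub_one_even_1 {θ : K} {a' b' e : ℤ} {t : ℕ}
    (hθ : IsQuarticRoot (4 * (2 * a' + 1)) (2 ^ (2 * (t + 2)) * (2 * b' + 1))
      ((2 * (2 * a' + 1)) ^ 2 + 2 ^ (2 * (t + 2)) * (2 * e)) θ) :
    IsIrregularBasis θ (X ^ 2 + C (2 * (2 * a' + 1))) ((2 * (2 * (t + 2) : ℕ) + 1) / 4) := by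
  have key := hθ.irregular_quarter (m := t + 1) (β := 0) (γ := a')
    (A := 0) (B := -b' - 1) (C := -e) (E := 0)
    (by constructor <;> push_cast <;> ring)
  refine isIrregularBasis_of_towerBasis key
    (by simp only [map_add, map_sub, map_mul, map_pow, aeval_X, aeval_C, aeval_int_two, aeval_int_four,
      algebraMap_int_eq, eq_intCast, map_intCast, map_one]; push_cast; ring) ?_ ?_ <;> constructor <;> push_cast <;>
    linarith

/-- For φ = x² + γ₀ the constant of the development is D + (γ₀ − a/2)² with D = c − a²/4. If D =
2^(2w)·odd, the choice γ₀ = a/2 + 2^w gains a factor 2. For odd u the same is achieved by a linear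
term. -/
lemma IsQuarticRoot.irregular_sub_one_even_2 {θ : K} {a' b' e : ℤ} {t : ℕ}
    (hθ : IsQuarticRoot (4 * (2 * a' + 1)) (2 ^ (2 * (t + 2)) * (2 * b' + 1))
      ((2 * (2 * a' + 1)) ^ 2 + 2 ^ (2 * (t + 2)) * (2 * e + 1)) θ) :
    IsIrregularBasis θ (X ^ 2 + C (2 * (2 * a' + 1))) ((2 * (2 * (t + 2) : ℕ) + 1) / 4) := by
  have key := hθ.irregular_quarter (m := t + 1) (β := 0) (γ := a' + 2 ^ t)
    (A := 1) (B := -b' - 1) (C := -e - 1) (E := 0)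
    (by constructor <;> push_cast <;> ring)
  refine isIrregularBasis_of_add (β := 2 * (0) - 2 ^ (t + 1 + 1) * 0)
    (γ := 2 * (2 * (a' + 2 ^ t) + 1) - 2 ^ (t + 1 + 1) * 1) 0 1 _ _ key (by ring) (by ring)
    (by simp only [map_add, map_sub, map_mul, map_pow, aeval_X, aeval_C, aeval_int_two, aeval_int_four,
      algebraMap_int_eq, eq_intCast, map_intCast, map_one]; push_cast; ring) ?_
  constructor <;> push_cast <;> linarith

lemma IsQuarticRoot.irregular_sub_one_odd_1 {θ : K} {a' b' e : ℤ} {t : ℕ}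
    (hθ : IsQuarticRoot (4 * (2 * a' + 1)) (2 ^ (2 * (t + 2) + 1) * (2 * b' + 1))
      ((2 * (2 * a' + 1)) ^ 2 + 2 ^ (2 * (t + 2) + 1) * (2 * e)) θ) :
    IsIrregularBasis θ (X ^ 2 + C (2 * (2 * a' + 1))) ((2 * (2 * (t + 2) + 1 : ℕ) + 1) / 4) := by
  have key := hθ.irregular_three_quarters (m := t + 1) (β := 0) (γ := a')
    (A := 0) (B := -b' - 1) (C := -e) (E := 0)
    (by constructor <;> push_cast <;> ring)
  refine isIrregularBasis_of_towerBasis key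
    (by simp only [map_add, map_sub, map_mul, map_pow, aeval_X, aeval_C, aeval_int_two, aeval_int_four,
      algebraMap_int_eq, eq_intCast, map_intCast, map_one]; push_cast; ring) ?_ ?_ <;> constructor <;> push_cast <;>
    linarith

lemma IsQuarticRoot.irregular_sub_one_odd_2 {θ : K} {a' b' e : ℤ} {t : ℕ}
    (hθ : IsQuarticRoot (4 * (2 * a' + 1)) (2 ^ (2 * (t + 2) + 1) * (2 * b' + 1))
      ((2 * (2 * a' + 1)) ^ 2 + 2 ^ (2 * (t + 2) + 1) * (2 * e + 1)) θ) :
    IsIrregularBasis θ (X ^ 2 + C (2 * (2 * a' + 1))) ((2 * (2 * (t + 2) + 1 : ℕ) + 1) / 4) := by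
  have key := hθ.irregular_three_quarters (m := t + 1) (β := 2 * 2 ^ t) (γ := a')
    (A := -2 * 2 ^ t) (B := 2 ^ t - b' - 1) (C := a' - e) (E := 1)
    (by constructor <;> push_cast <;> ring)
  refine isIrregularBasis_of_add_succ (β := 2 * 2 ^ t - 2 ^ (t + 1) * 1)
    (γ := 2 * (a') + 1 - 2 ^ (t + 1 + 1) * 0) 1 0 _ _ key (by ring) (by ring)
    (by simp only [map_add, map_sub, map_mul, map_pow, aeval_X, aeval_C, aeval_int_two, aeval_int_four,
      algebraMap_int_eq, eq_intCast, map_intCast, map_one]; push_cast; ring) ?_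
  constructor <;> push_cast <;> linarith

/-- With D = 2^(2w)(4d − 1) and γ₀ = a/2 + 2^w, where w = t + 2, the constant D + (γ₀ − a/2)² =
2^(2w)·4d gains two factors 2. -/
lemma IsQuarticRoot.irregular_sub_two {θ : K} {a' b' d : ℤ} {t : ℕ}
    (hθ : IsQuarticRoot (4 * (2 * a' + 1)) (2 ^ (2 * (t + 2) + 1) * (2 * b' + 1))
      ((2 * (2 * a' + 1)) ^ 2 + 2 ^ (2 * (t + 2)) * (4 * d + -1)) θ) :
    IsIrregularBasis θ (X ^ 2 + C (2 * (2 * a' + 1) + 2 ^ (t + 2))) ((t + 2 : ℕ) + 3 / 4) := by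
  have key := hθ.irregular_three_quarters (m := t + 1) (β := 0) (γ := a' + 2 ^ t)
    (A := 1) (B := -b' - 1) (C := -d) (E := 0)
    (by constructor <;> push_cast <;> ring)
  refine isIrregularBasis_of_towerBasis key
    (by simp only [map_add, map_sub, map_mul, map_pow, aeval_X, aeval_C, aeval_int_two, aeval_int_four,
      algebraMap_int_eq, eq_intCast, map_intCast, map_one]; push_cast; ring) ?_ ?_ <;> constructor <;> push_cast <;>
    linarith

lemma IsQuarticRoot.irregular_sub_three {θ : K} {a' b' d : ℤ} {t : ℕ}
    (hθ : IsQuarticRoot (4 * (2 * a' + 1)) (2 ^ (2 * (t + 2) + 1 + 1) * b')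
      ((2 * (2 * a' + 1)) ^ 2 + 2 ^ (2 * (t + 2)) * (4 * d + -1)) θ) :
    IsIrregularBasis θ (X ^ 2 + C (2 * (2 * a' + 1) + 2 ^ (t + 2))) ((t + 2 : ℕ) + 1) := by
  have key := hθ.irregular_int (m := t + 1) (β := 0) (γ := a' + 2 ^ t)
    (A := 0) (B := -b') (C := -d) (E := 0)
    (by constructor <;> push_cast <;> ring)
  refine isIrregularBasis_of_towerBasis key
    (by simp only [map_add, map_sub, map_mul, map_pow, aeval_X, aeval_C, aeval_int_two, aeval_int_four,
      algebraMap_int_eq, eq_intCast, map_intCast, map_one]; push_cast; ring) ?_ ?_ <;> constructor <;> push_cast <;>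
    linarith

/-- If d ≡ 1 modulo 4, adding 2^(2w) to D gives only 2^(2w)·2·odd. A linear term β₀x with β₀ = 2^w
contributes −β₀²γ₀ = −2^(2w)·2·odd to the constant, and the sum is divisible by 2^(2w+2). -/
lemma IsQuarticRoot.irregular_sub_four {θ : K} {a' b' d : ℤ} {t : ℕ}
    (hθ : IsQuarticRoot (4 * (2 * a' + 1)) (2 ^ (2 * (t + 2) + 1) * (2 * b' + 1))
      ((2 * (2 * a' + 1)) ^ 2 + 2 ^ (2 * (t + 2)) * (4 * d + 1)) θ) :
    IsIrregularBasis θ (X ^ 2 + C (2 ^ (t + 2)) * X + C (2 * (2 * a' + 1) + 2 ^ (t + 2))) ((t + 2 : ℕ) + 1) := by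
  have key := hθ.irregular_int (m := t + 1) (β := 2 * 2 ^ t) (γ := a' + 2 ^ t)
    (A := -2 ^ t) (B := 2 ^ t - b' - 1) (C := a' + 2 ^ t - d) (E := 1)
    (by constructor <;> push_cast <;> ring)
  refine isIrregularBasis_of_towerBasis key
    (by simp only [map_add, map_sub, map_mul, map_pow, aeval_X, aeval_C, aeval_int_two, aeval_int_four,
      algebraMap_int_eq, eq_intCast, map_intCast, map_one]; push_cast; ring) ?_ ?_ <;> constructor <;> push_cast <;>
    linarith

lemma IsQuarticRoot.irregular_sub_five {θ : K} {a' b' d : ℤ} {t : ℕ}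
    (hθ : IsQuarticRoot (4 * (2 * a' + 1)) (2 ^ (2 * (t + 2) + 1 + 1) * b')
      ((2 * (2 * a' + 1)) ^ 2 + 2 ^ (2 * (t + 2)) * (4 * d + 1)) θ) :
    IsIrregularBasis θ (X ^ 2 + C (2 * (2 * a' + 1) + 2 ^ (t + 2))) ((t + 2 : ℕ) + 3 / 4) := by
  have key := hθ.irregular_three_quarters (m := t + 1) (β := 2 * 2 ^ t) (γ := a' + 2 ^ t)
    (A := 1 - 2 * 2 ^ t) (B := 2 ^ t - b' - 1) (C := a' + 2 ^ t - d) (E := 1)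
    (by constructor <;> push_cast <;> ring)
  refine isIrregularBasis_of_add_succ (β := 2 * 2 ^ t - 2 ^ (t + 1) * 1)
    (γ := 2 * (a' + 2 ^ t) + 1 - 2 ^ (t + 1 + 1) * 0) 1 0 _ _ key (by ring) (by ring)
    (by simp only [map_add, map_sub, map_mul, map_pow, aeval_X, aeval_C, aeval_int_two, aeval_int_four,
      algebraMap_int_eq, eq_intCast, map_intCast, map_one]; push_cast; ring) ?_
  constructor <;> push_cast <;> linarith

/-- For D = 2^(2w+1)d the contribution −β₀²·a/2 = −2^(2w+1)·a/4 of the linear term 2^w x cancels D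
up to 2^(2w+3) when d ≡ a/4 modulo 4. -/
lemma IsQuarticRoot.irregular_sub_six {θ : K} {a' b' d : ℤ} {t : ℕ}
    (hθ : IsQuarticRoot (4 * (2 * a' + 1)) (2 ^ (2 * (t + 3) + 2) * (2 * b' + 1))
      ((2 * (2 * a' + 1)) ^ 2 + 2 ^ (2 * (t + 3) + 1) * (4 * d + (2 * a' + 1))) θ) :
    IsIrregularBasis θ (X ^ 2 + C (2 ^ (t + 3)) * X + C (2 * (2 * a' + 1))) ((t + 3 : ℕ) + 5 / 4) := by
  have key := hθ.irregular_quarter (m := t + 3) (β := 4 * 2 ^ t) (γ := a')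
    (A := -2 * 2 ^ t) (B := 2 ^ t - b' - 1) (C := -d) (E := 1)
    (by constructor <;> push_cast <;> ring)
  refine isIrregularBasis_of_towerBasis key
    (by simp only [map_add, map_sub, map_mul, map_pow, aeval_X, aeval_C, aeval_int_two, aeval_int_four,
      algebraMap_int_eq, eq_intCast, map_intCast, map_one]; push_cast; ring) ?_ ?_ <;> constructor <;> push_cast <;>
    linarith

lemma IsQuarticRoot.irregular_sub_seven {θ : K} {a' b' d : ℤ} {t : ℕ}
    (hθ : IsQuarticRoot (4 * (2 * a' + 1)) (2 ^ (2 * (t + 3) + 2 + 1) * b')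
      ((2 * (2 * a' + 1)) ^ 2 + 2 ^ (2 * (t + 3) + 1) * (4 * d + (2 * a' + 1))) θ) :
    IsIrregularBasis θ (X ^ 2 + C (2 ^ (t + 3)) * X + C (2 * (2 * a' + 1))) ((t + 3 : ℕ) + 3 / 2) := by
  have key := hθ.irregular_half (m := t + 3) (β := 4 * 2 ^ t) (γ := a')
    (A := -2 * 2 ^ t) (B := 2 ^ t - b') (C := -d) (E := 0)
    (by constructor <;> push_cast <;> ring)
  refine isIrregularBasis_of_towerBasis key
    (by simp only [map_add, map_sub, map_mul, map_pow, aeval_X, aeval_C, aeval_int_two, aeval_int_four,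
      algebraMap_int_eq, eq_intCast, map_intCast, map_one]; push_cast; ring) ?_ ?_ <;> constructor <;> push_cast <;>
    linarith

/-- When d ≡ −a/4 modulo 4 the linear term leaves 2^(2w+2)·odd, which the square of the additional
constant 2^(w+1) compensates. -/
lemma IsQuarticRoot.irregular_sub_eight {θ : K} {a' b' d : ℤ} {t : ℕ}
    (hθ : IsQuarticRoot (4 * (2 * a' + 1)) (2 ^ (2 * (t + 3) + 2) * (2 * b' + 1))
      ((2 * (2 * a' + 1)) ^ 2 + 2 ^ (2 * (t + 3) + 1) * (4 * d + -(2 * a' + 1))) θ) :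
    IsIrregularBasis θ (X ^ 2 + C (2 ^ (t + 3)) * X + C (2 * (2 * a' + 1) + 2 ^ (t + 3 + 1))) ((t + 3 : ℕ) + 3 / 2) := by
  have key := hθ.irregular_half (m := t + 3) (β := 4 * 2 ^ t) (γ := a' + 4 * 2 ^ t)
    (A := 1 - 2 * 2 ^ t) (B := 2 ^ t - b' - 1) (C := a' + 2 * 2 ^ t - d) (E := 0)
    (by constructor <;> push_cast <;> ring)
  refine isIrregularBasis_of_towerBasis key
    (by simp only [map_add, map_sub, map_mul, map_pow, aeval_X, aeval_C, aeval_int_two, aeval_int_four,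
      algebraMap_int_eq, eq_intCast, map_intCast, map_one]; push_cast; ring) ?_ ?_ <;> constructor <;> push_cast <;>
    linarith

lemma IsQuarticRoot.irregular_sub_nine {θ : K} {a' b' d : ℤ} {t : ℕ}
    (hθ : IsQuarticRoot (4 * (2 * a' + 1)) (2 ^ (2 * (t + 3) + 2 + 1) * b')
      ((2 * (2 * a' + 1)) ^ 2 + 2 ^ (2 * (t + 3) + 1) * (4 * d + -(2 * a' + 1))) θ) :
    IsIrregularBasis θ (X ^ 2 + C (2 ^ (t + 3)) * X + C (2 * (2 * a' + 1))) ((t + 3 : ℕ) + 5 / 4) := by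
  have key := hθ.irregular_quarter (m := t + 3) (β := 4 * 2 ^ t) (γ := a' + 4 * 2 ^ t)
    (A := 1 - 2 * 2 ^ t) (B := 2 ^ t - b' - 1) (C := a' + 2 * 2 ^ t - d) (E := 1)
    (by constructor <;> push_cast <;> ring)
  refine isIrregularBasis_of_add (β := 2 * (4 * 2 ^ t) - 2 ^ (t + 3 + 1) * 0)
    (γ := 2 * (2 * (a' + 4 * 2 ^ t) + 1) - 2 ^ (t + 3 + 1) * 1) 0 1 _ _ key (by ring) (by ring)
    (by simp only [map_add, map_sub, map_mul, map_pow, aeval_X, aeval_C, aeval_int_two, aeval_int_four,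
      algebraMap_int_eq, eq_intCast, map_intCast, map_one]; push_cast; ring) ?_
  constructor <;> push_cast <;> linarith

/-- The case w = 2 is special: with φ = x² + 4x + a/2 the linear coefficient of the development is b
− β₀³ = b − 2^(3w), and 3w = 2w + 2 = 6 is the critical valuation of b. Hence the roles of v₂(b) = 6
and v₂(b) > 6 are exchanged. For w ≥ 3 the term 2^(3w) is negligible. -/
lemma IsQuarticRoot.irregular_sub_six_five {θ : K} {a' b' d : ℤ}
    (hθ : IsQuarticRoot (4 * (2 * a' + 1)) (2 ^ 7 * b')
      ((2 * (2 * a' + 1)) ^ 2 + 2 ^ 5 * (4 * d + (2 * a' + 1))) θ) :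
    IsIrregularBasis θ (X ^ 2 + 4 * X + C (2 * (2 * a' + 1))) (2 + 5 / 4) := by
  have key := hθ.irregular_quarter (m := 2) (β := 2) (γ := a')
    (A := -1) (B := -b') (C := -d) (E := 1)
    (by constructor <;> push_cast <;> ring)
  refine isIrregularBasis_of_towerBasis key
    (by simp only [map_add, map_sub, map_mul, map_pow, aeval_X, aeval_C, aeval_int_two, aeval_int_four,
      algebraMap_int_eq, eq_intCast, map_intCast, map_one]; push_cast; ring) ?_ ?_ <;> constructor <;> push_cast <;>
    linarith

lemma IsQuarticRoot.irregular_sub_seven_five {θ : K} {a' b' d : ℤ}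
    (hθ : IsQuarticRoot (4 * (2 * a' + 1)) (2 ^ 6 * (2 * b' + 1))
      ((2 * (2 * a' + 1)) ^ 2 + 2 ^ 5 * (4 * d + (2 * a' + 1))) θ) :
    IsIrregularBasis θ (X ^ 2 + 4 * X + C (2 * (2 * a' + 1))) (2 + 3 / 2) := by
  have key := hθ.irregular_half (m := 2) (β := 2) (γ := a')
    (A := -1) (B := -b') (C := -d) (E := 0)
    (by constructor <;> push_cast <;> ring)
  refine isIrregularBasis_of_towerBasis key
    (by simp only [map_add, map_sub, map_mul, map_pow, aeval_X, aeval_C, aeval_int_two, aeval_int_four,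
      algebraMap_int_eq, eq_intCast, map_intCast, map_one]; push_cast; ring) ?_ ?_ <;> constructor <;> push_cast <;>
    linarith

lemma IsQuarticRoot.irregular_sub_eight_five {θ : K} {a' b' d : ℤ}
    (hθ : IsQuarticRoot (4 * (2 * a' + 1)) (2 ^ 7 * b')
      ((2 * (2 * a' + 1)) ^ 2 + 2 ^ 5 * (4 * d + -(2 * a' + 1))) θ) :
    IsIrregularBasis θ (X ^ 2 + 4 * X + C (2 * (2 * a' + 1) + 8)) (2 + 3 / 2) := by
  have key := hθ.irregular_half (m := 2) (β := 2) (γ := a' + 2)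
    (A := 0) (B := -b') (C := a' + 1 - d) (E := 0)
    (by constructor <;> push_cast <;> ring)
  refine isIrregularBasis_of_towerBasis key
    (by simp only [map_add, map_sub, map_mul, map_pow, aeval_X, aeval_C, aeval_int_two, aeval_int_four,
      algebraMap_int_eq, eq_intCast, map_intCast, map_one]; push_cast; ring) ?_ ?_ <;> constructor <;> push_cast <;>
    linarith

lemma IsQuarticRoot.irregular_sub_nine_five {θ : K} {a' b' d : ℤ}
    (hθ : IsQuarticRoot (4 * (2 * a' + 1)) (2 ^ 6 * (2 * b' + 1))
      ((2 * (2 * a' + 1)) ^ 2 + 2 ^ 5 * (4 * d + -(2 * a' + 1))) θ) :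
    IsIrregularBasis θ (X ^ 2 + 4 * X + C (2 * (2 * a' + 1))) (2 + 5 / 4) := by
  have key := hθ.irregular_quarter (m := 2) (β := 2) (γ := a' + 2)
    (A := 0) (B := -b' - 1) (C := a' + 1 - d) (E := 1)
    (by constructor <;> push_cast <;> ring)
  refine isIrregularBasis_of_add (β := 2 * (2) - 2 ^ (2 + 1) * 0)
    (γ := 2 * (2 * (a' + 2) + 1) - 2 ^ (2 + 1) * 1) 0 1 _ _ key (by ring) (by ring)
    (by simp only [map_add, map_sub, map_mul, map_pow, aeval_X, aeval_C, aeval_int_two, aeval_int_four,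
      algebraMap_int_eq, eq_intCast, map_intCast, map_one]; push_cast; ring) ?_
  constructor <;> push_cast <;> linarith

end IrregularRows

/-! ### Parametrising a, b, c in each irregular row -/

section IrregularDispatch

variable {K : Type*} [Field K] [NumberField K]

lemma exists_eq_of_vp_redConst {a c e : ℤ} {n : ℕ} (hv : vp 2 (redConst a c) = n)
    (hd : redConst a c / 2 ^ n ≡ e [ZMOD 4]) : ∃ d, c = (a / 2) ^ 2 + 2 ^ n * (4 * d + e) := by
  obtain ⟨k, hk⟩ := vp_two_eq_iff.1 hv
  rw [hk, Int.mul_ediv_cancel_left _ (by positivity)] at hd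
  obtain ⟨d, hd⟩ := hd.symm.dvd
  refine ⟨d, ?_⟩
  unfold redConst at hk
  rw [← hd]
  linear_combination hk

/-- Substituting a = 4(2a' + 1) and 2a + c − 4 = 8(2k + 1) gives D = 16(k − 2a' − a'²), hence v ≥ 4
and w ≥ 2. -/
lemma two_le_of_vp_redConst {a c : ℤ} (ha : vp 2 a = 2) (h : vp 2 (2 * a + c - 4) = 3) :
    (2 : ℤ) ^ 4 ∣ redConst a c := by
  obtain ⟨a', rfl⟩ := (vp_two_eq_iff (n := 2)).1 (by exact_mod_cast ha)
  obtain ⟨k, hk⟩ := (vp_two_eq_iff (n := 3)).1 (by exact_mod_cast h)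
  have h2 : (2 : ℤ) ^ 2 * (2 * a' + 1) / 2 = 2 * (2 * a' + 1) := by omega
  unfold redConst
  rw [h2]
  exact ⟨k - 2 * a' - a' ^ 2, by linear_combination hk⟩

lemma exists_eq_add_of_vp_redConst {a c : ℤ} (ha : vp 2 a = 2) (h : vp 2 (2 * a + c - 4) = 3)
    {v : ℕ} (hv : vp 2 (redConst a c) = v) : ∃ t, v = t + 4 := by
  have h4 : ((4 : ℕ) : ℕ∞) ≤ v := by
    rw [← hv]
    exact le_vp_iff.2 (by exact_mod_cast two_le_of_vp_redConst ha h)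
  exact ⟨v - 4, by have := Nat.cast_le.1 h4; omega⟩

theorem isIrregularBasis_of_row {a b c : ℤ} {θ : K} (hθ : IsQuarticRoot a b c θ)
    (hc : vp 2 c = 2) (ha : 1 < vp 2 a) {Q : ℤ[X]} {ν : ℚ}
    (hQ : IrregularRow a b c Q ν) : IsIrregularBasis θ Q ν := by
  have e2 : ∀ {x : ℤ}, vp 2 x = 2 → ∃ k, x = 4 * (2 * k + 1) := fun h => by
    obtain ⟨k, hk⟩ := (vp_two_eq_iff (n := 2)).1 (by exact_mod_cast h)
    exact ⟨k, by rw [hk]; ring⟩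
  have e3 : ∀ {x : ℤ}, vp 2 x = 3 → ∃ k, x = 8 * (2 * k + 1) := fun h => by
    obtain ⟨k, hk⟩ := (vp_two_eq_iff (n := 3)).1 (by exact_mod_cast h)
    exact ⟨k, by rw [hk]; ring⟩
  have e4 : ∀ {x : ℤ}, vp 2 x = 4 → ∃ k, x = 16 * (2 * k + 1) := fun h => by
    obtain ⟨k, hk⟩ := (vp_two_eq_iff (n := 4)).1 (by exact_mod_cast h)
    exact ⟨k, by rw [hk]; ring⟩
  have l3 : ∀ {x : ℤ}, 3 ≤ vp 2 x → ∃ k, x = 8 * k := fun h => by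
    obtain ⟨k, hk⟩ := (le_vp_iff (p := 2) (n := 3)).1 (by exact_mod_cast h)
    exact ⟨k, by rw [hk]; push_cast; ring⟩
  have l4 : ∀ {x : ℤ}, 4 ≤ vp 2 x → ∃ k, x = 16 * k := fun h => by
    obtain ⟨k, hk⟩ := (le_vp_iff (p := 2) (n := 4)).1 (by exact_mod_cast h)
    exact ⟨k, by rw [hk]; push_cast; ring⟩
  have l5 : ∀ {x : ℤ}, 5 ≤ vp 2 x → ∃ k, x = 32 * k := fun h => by
    obtain ⟨k, hk⟩ := (le_vp_iff (p := 2) (n := 5)).1 (by exact_mod_cast h)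
    exact ⟨k, by rw [hk]; push_cast; ring⟩
  have l5' : ∀ {x : ℤ}, 4 < vp 2 x → ∃ k, x = 32 * k := fun h => by
    obtain ⟨k, hk⟩ := (lt_vp_iff (p := 2) (n := 4)).1 (by exact_mod_cast h)
    exact ⟨k, by rw [hk]; push_cast; ring⟩
  have half : ∀ x : ℤ, 4 * (2 * x + 1) / 2 = 2 * (2 * x + 1) := fun x => by omega
  have quarter : ∀ x : ℤ, 4 * (2 * x + 1) / 4 = 2 * x + 1 := fun x => by omega
  have lt' : ∀ {x : ℤ} {n : ℕ}, (n : ℕ∞) < vp 2 x → ∃ k, x = 2 ^ (n + 1) * k := fun h => by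
    obtain ⟨k, hk⟩ := lt_vp_iff.1 h
    exact ⟨k, by rw [hk]; push_cast; ring⟩
  cases hQ with
  | row1 hb =>
    obtain ⟨a', rfl⟩ := (lt_vp_iff (p := 2) (n := 1)).1 (by exact_mod_cast ha)
    obtain ⟨b', rfl⟩ := e2 hb
    obtain ⟨c', rfl⟩ := e2 hc
    exact IsQuarticRoot.irregular_b_two (a' := a') (by convert hθ using 1; norm_num)
  | row2 hb h =>
    obtain ⟨a', rfl⟩ := (lt_vp_iff (p := 2) (n := 1)).1 (by exact_mod_cast ha)
    obtain ⟨b', rfl⟩ := e3 hb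
    obtain ⟨h', hh⟩ := e3 h
    norm_num at hh hθ
    obtain rfl : c = 8 * (2 * h' + 1) + 4 - 8 * a' := by linarith
    exact hθ.irregular_b_three_1
  | row3 ha hb h =>
    obtain ⟨a', rfl⟩ := e2 ha
    obtain ⟨b', rfl⟩ := e3 hb
    obtain ⟨h', hh⟩ := l4 h
    obtain rfl : c = 16 * h' + 4 - 8 * (2 * a' + 1) := by linarith
    exact hθ.irregular_b_three_2
  | row4 ha hb h =>
    obtain ⟨a', rfl⟩ := l3 ha
    obtain ⟨b', rfl⟩ := e3 hb
    obtain ⟨h', hh⟩ := l4 h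
    obtain rfl : c = 16 * h' + 4 - 16 * a' := by linarith
    exact hθ.irregular_b_three_3
  | row5 ha hb h =>
    obtain ⟨a', rfl⟩ := e2 ha
    obtain ⟨b', rfl⟩ := l4 hb
    obtain ⟨h', hh⟩ := l4 h
    obtain rfl : c = 16 * h' + 4 - 8 * (2 * a' + 1) := by linarith
    exact hθ.irregular_b_four_1
  | row7 ha hb h =>
    obtain ⟨a', rfl⟩ := l3 ha
    obtain ⟨b', rfl⟩ := l4 hb
    obtain ⟨h', hh⟩ := e3 h
    obtain rfl : c = 8 * (2 * h' + 1) + 4 - 16 * a' := by linarith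
    exact hθ.irregular_b_four_2
  | row8 ha hb h h' =>
    obtain ⟨a', rfl⟩ := l3 ha
    obtain ⟨k, hk⟩ := l5' h'
    obtain ⟨h', hh⟩ := e4 h
    obtain rfl : c = 16 * (2 * h' + 1) + 4 - 16 * a' := by linarith
    obtain rfl : b = 32 * k - 16 * a' := by linarith
    exact hθ.irregular_b_four_3
  | row9 ha hb h h' =>
    obtain ⟨a', rfl⟩ := l3 ha
    obtain ⟨k, hk⟩ := e4 h'
    obtain ⟨h', hh⟩ := e4 h
    obtain rfl : c = 16 * (2 * h' + 1) + 4 - 16 * a' := by linarith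
    obtain rfl : b = 16 * (2 * k + 1) - 16 * a' := by linarith
    exact hθ.irregular_b_four_4
  | row10 ha hb h h' =>
    obtain ⟨a', rfl⟩ := l3 ha
    obtain ⟨k, hk⟩ := e4 h'
    obtain ⟨h', hh⟩ := l5 h
    obtain rfl : c = 32 * h' + 4 - 16 * a' := by linarith
    obtain rfl : b = 16 * (2 * k + 1) - 16 * a' := by linarith
    exact hθ.irregular_b_four_5
  | row11 ha hb h h' =>
    obtain ⟨a', rfl⟩ := l3 ha
    obtain ⟨k, hk⟩ := l5' h'
    obtain ⟨h', hh⟩ := l5 h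
    obtain rfl : c = 32 * h' + 4 - 16 * a' := by linarith
    obtain rfl : b = 32 * k - 16 * a' := by linarith
    exact hθ.irregular_b_four_6
  | sub1 ha hb h u hu huv =>
    obtain ⟨a', rfl⟩ := e2 ha
    obtain ⟨b', rfl⟩ := vp_two_eq_iff.1 hu
    obtain ⟨e, he⟩ := le_vp_iff.1 huv
    have h4 : 4 ≤ u := by
      rw [hu] at hb
      exact_mod_cast hb
    unfold redConst at he
    rw [half] at he ⊢
    obtain rfl : c = (2 * (2 * a' + 1)) ^ 2 + 2 ^ u * e := by push_cast at he; linarith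
    obtain ⟨n, rfl | rfl⟩ := Nat.even_or_odd' u <;> obtain ⟨t, rfl⟩ : ∃ t, n = t + 2 :=
      ⟨n - 2, by omega⟩ <;> obtain ⟨e', rfl | rfl⟩ := Int.even_or_odd' e
    · exact hθ.irregular_sub_one_even_1
    · exact hθ.irregular_sub_one_even_2
    · exact hθ.irregular_sub_one_odd_1
    · exact hθ.irregular_sub_one_odd_2
  | sub2 ha hb h w hv hu hd =>
    obtain ⟨t, ht⟩ := exists_eq_add_of_vp_redConst ha h hv
    obtain ⟨t, rfl⟩ : ∃ t, w = t + 2 := ⟨w - 2, by omega⟩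
    obtain ⟨d, rfl⟩ := exists_eq_of_vp_redConst hv hd
    obtain ⟨a', rfl⟩ := e2 ha
    obtain ⟨b', rfl⟩ := vp_two_eq_iff.1 hu
    rw [half] at hθ ⊢
    exact hθ.irregular_sub_two
  | sub3 ha hb h w hv hu hd =>
    obtain ⟨t, ht⟩ := exists_eq_add_of_vp_redConst ha h hv
    obtain ⟨t, rfl⟩ : ∃ t, w = t + 2 := ⟨w - 2, by omega⟩
    obtain ⟨d, rfl⟩ := exists_eq_of_vp_redConst hv hd
    obtain ⟨a', rfl⟩ := e2 ha
    obtain ⟨b', rfl⟩ := lt' hu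
    rw [half] at hθ ⊢
    exact hθ.irregular_sub_three
  | sub4 ha hb h w hv hu hd =>
    obtain ⟨t, ht⟩ := exists_eq_add_of_vp_redConst ha h hv
    obtain ⟨t, rfl⟩ : ∃ t, w = t + 2 := ⟨w - 2, by omega⟩
    obtain ⟨d, rfl⟩ := exists_eq_of_vp_redConst hv hd
    obtain ⟨a', rfl⟩ := e2 ha
    obtain ⟨b', rfl⟩ := vp_two_eq_iff.1 hu
    rw [half] at hθ ⊢
    exact hθ.irregular_sub_four
  | sub5 ha hb h w hv hu hd =>
    obtain ⟨t, ht⟩ := exists_eq_add_of_vp_redConst ha h hv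
    obtain ⟨t, rfl⟩ : ∃ t, w = t + 2 := ⟨w - 2, by omega⟩
    obtain ⟨d, rfl⟩ := exists_eq_of_vp_redConst hv hd
    obtain ⟨a', rfl⟩ := e2 ha
    obtain ⟨b', rfl⟩ := lt' hu
    rw [half] at hθ ⊢
    exact hθ.irregular_sub_five
  | sub6 ha hb h w hw hv hu hd =>
    obtain ⟨t, rfl⟩ : ∃ t, w = t + 3 := ⟨w - 3, by omega⟩
    obtain ⟨d, rfl⟩ := exists_eq_of_vp_redConst hv hd
    obtain ⟨a', rfl⟩ := e2 ha
    obtain ⟨b', rfl⟩ := vp_two_eq_iff.1 hu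
    rw [half, quarter] at hθ
    rw [half]
    exact hθ.irregular_sub_six
  | sub7 ha hb h w hw hv hu hd =>
    obtain ⟨t, rfl⟩ : ∃ t, w = t + 3 := ⟨w - 3, by omega⟩
    obtain ⟨d, rfl⟩ := exists_eq_of_vp_redConst hv hd
    obtain ⟨a', rfl⟩ := e2 ha
    obtain ⟨b', rfl⟩ := lt' hu
    rw [half, quarter] at hθ
    rw [half]
    exact hθ.irregular_sub_seven
  | sub8 ha hb h w hw hv hu hd =>
    obtain ⟨t, rfl⟩ : ∃ t, w = t + 3 := ⟨w - 3, by omega⟩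
    obtain ⟨d, rfl⟩ := exists_eq_of_vp_redConst hv hd
    obtain ⟨a', rfl⟩ := e2 ha
    obtain ⟨b', rfl⟩ := vp_two_eq_iff.1 hu
    rw [half, quarter] at hθ
    rw [half]
    exact hθ.irregular_sub_eight
  | sub9 ha hb h w hw hv hu hd =>
    obtain ⟨t, rfl⟩ : ∃ t, w = t + 3 := ⟨w - 3, by omega⟩
    obtain ⟨d, rfl⟩ := exists_eq_of_vp_redConst hv hd
    obtain ⟨a', rfl⟩ := e2 ha
    obtain ⟨b', rfl⟩ := lt' hu
    rw [half, quarter] at hθ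
    rw [half]
    exact hθ.irregular_sub_nine
  | sub6_five ha hb h hv hd =>
    obtain ⟨d, rfl⟩ := exists_eq_of_vp_redConst (n := 5) (by exact_mod_cast hv) hd
    obtain ⟨a', rfl⟩ := e2 ha
    obtain ⟨b', rfl⟩ := lt' (n := 6) (by exact_mod_cast hb)
    rw [half, quarter] at hθ
    rw [half]
    exact hθ.irregular_sub_six_five
  | sub7_five ha hb h hv hd =>
    obtain ⟨d, rfl⟩ := exists_eq_of_vp_redConst (n := 5) (by exact_mod_cast hv) hd
    obtain ⟨a', rfl⟩ := e2 ha
    obtain ⟨b', rfl⟩ := (vp_two_eq_iff (n := 6)).1 (by exact_mod_cast hb)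
    rw [half, quarter] at hθ
    rw [half]
    exact hθ.irregular_sub_seven_five
  | sub8_five ha hb h hv hd =>
    obtain ⟨d, rfl⟩ := exists_eq_of_vp_redConst (n := 5) (by exact_mod_cast hv) hd
    obtain ⟨a', rfl⟩ := e2 ha
    obtain ⟨b', rfl⟩ := lt' (n := 6) (by exact_mod_cast hb)
    rw [half, quarter] at hθ
    rw [half]
    exact hθ.irregular_sub_eight_five
  | sub9_five ha hb h hv hd =>
    obtain ⟨d, rfl⟩ := exists_eq_of_vp_redConst (n := 5) (by exact_mod_cast hv) hd
    obtain ⟨a', rfl⟩ := e2 ha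
    obtain ⟨b', rfl⟩ := (vp_two_eq_iff (n := 6)).1 (by exact_mod_cast hb)
    rw [half, quarter] at hθ
    rw [half]
    exact hθ.irregular_sub_nine_five

end IrregularDispatch

/-! ### Completeness of the irregular tables -/

section IrregularExists

lemma ENat.eq_or_succ_le {n : ℕ} {x : ℕ∞} (h : (n : ℕ∞) ≤ x) :
    x = n ∨ ((n + 1 : ℕ) : ℕ∞) ≤ x := by
  rcases h.eq_or_lt with h | h
  · exact Or.inl h.symm
  · exact Or.inr (by
      rw [Nat.cast_add, Nat.cast_one]
      exact (ENat.add_one_le_iff (ENat.natCast_ne_top n)).2 h)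

lemma ENat.eq_or_lt_of_lt {n : ℕ} {x : ℕ∞} (h : (n : ℕ∞) < x) :
    x = (n + 1 : ℕ) ∨ ((n + 1 : ℕ) : ℕ∞) < x := by
  have : ((n + 1 : ℕ) : ℕ∞) ≤ x := by
    rw [Nat.cast_add, Nat.cast_one]
    exact (ENat.add_one_le_iff (ENat.natCast_ne_top n)).2 h
  exact this.eq_or_lt.imp_left Eq.symm

lemma Int.modEq_four_of_odd {x y : ℤ} (hx : x % 2 = 1) (hy : y % 2 = 1) :
    x ≡ y [ZMOD 4] ∨ x ≡ -y [ZMOD 4] := by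
  unfold Int.ModEq
  omega

lemma redConst_div_odd {a c : ℤ} {n : ℕ} (h : vp 2 (redConst a c) = n) :
    (redConst a c / 2 ^ n) % 2 = 1 := by
  obtain ⟨k, hk⟩ := vp_two_eq_iff.1 h
  rw [hk, Int.mul_ediv_cancel_left _ (by positivity)]
  omega

/-- The hypothesis that b and D are not both 0 makes u finite in the row u ≤ v; if u > v, then v is
finite and the residues of d modulo 4 exhaust the cases. -/
lemma exists_irregularRow_of_sub {a b c : ℤ} (ha : vp 2 a = 2) (hb : 4 ≤ vp 2 b)
    (h : vp 2 (2 * a + c - 4) = 3) (hnz : ¬ (b = 0 ∧ redConst a c = 0)) :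
    ∃ Q ν, IrregularRow a b c Q ν := by
  rcases le_or_gt (vp 2 b) (vp 2 (redConst a c)) with huv | huv
  · obtain ⟨u, hu⟩ := ENat.ne_top_iff_exists.1 (fun ht : vp 2 b = ⊤ => hnz
      ⟨(vp_eq_top_iff Nat.prime_two).1 ht,
        (vp_eq_top_iff Nat.prime_two).1 (top_le_iff.1 (ht ▸ huv))⟩)
    exact ⟨_, _, .sub1 ha hb h u hu.symm (hu ▸ huv)⟩
  · obtain ⟨v, hv⟩ := ENat.ne_top_iff_exists.1 huv.ne_top
    rw [← hv] at huv
    replace hv := hv.symm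
    obtain ⟨t, ht⟩ := exists_eq_add_of_vp_redConst ha h hv
    have hd := redConst_div_odd hv
    have ha4 : (a / 4) % 2 = 1 := by
      obtain ⟨k, hk⟩ := (vp_two_eq_iff (n := 2)).1 (by exact_mod_cast ha)
      norm_num at hk
      omega
    obtain ⟨w, rfl | rfl⟩ := Nat.even_or_odd' v
    · rcases Int.modEq_four_of_odd hd (y := 1) rfl with hd | hd <;>
        rcases ENat.eq_or_lt_of_lt huv with hu | hu
      · exact ⟨_, _, .sub4 ha hb h w hv hu hd⟩
      · exact ⟨_, _, .sub5 ha hb h w hv hu hd⟩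
      · exact ⟨_, _, .sub2 ha hb h w hv hu hd⟩
      · exact ⟨_, _, .sub3 ha hb h w hv hu hd⟩
    · obtain rfl | hw : w = 2 ∨ 3 ≤ w := by omega
      · rcases Int.modEq_four_of_odd hd ha4 with hd | hd <;>
          rcases ENat.eq_or_lt_of_lt huv with hu | hu
        · exact ⟨_, _, .sub7_five ha hu h hv hd⟩
        · exact ⟨_, _, .sub6_five ha hu h hv hd⟩
        · exact ⟨_, _, .sub9_five ha hu h hv hd⟩
        · exact ⟨_, _, .sub8_five ha hu h hv hd⟩
      · rcases Int.modEq_four_of_odd hd ha4 with hd | hd <;>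
          rcases ENat.eq_or_lt_of_lt huv with hu | hu
        · exact ⟨_, _, .sub6 ha hb h w hw hv hu hd⟩
        · exact ⟨_, _, .sub7 ha hb h w hw hv hu hd⟩
        · exact ⟨_, _, .sub8 ha hb h w hw hv hu hd⟩
        · exact ⟨_, _, .sub9 ha hb h w hw hv hu hd⟩

lemma exists_irregularRow {a b c : ℤ} (hc : vp 2 c = 2) (ha : 1 < vp 2 a) (hb : 1 < vp 2 b)
    (hnz : ¬ (b = 0 ∧ redConst a c = 0)) : ∃ Q ν, IrregularRow a b c Q ν := by
  -- As c ≡ 4 modulo 8 and 4 ∣ a, this valuation is at least 3, where the table starts.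
  have h3 : ((3 : ℕ) : ℕ∞) ≤ vp 2 (2 * a + c - 4) := by
    obtain ⟨k, hk⟩ := (vp_two_eq_iff (n := 2)).1 (by exact_mod_cast hc)
    obtain ⟨l, hl⟩ := (lt_vp_iff (n := 1)).1 (by exact_mod_cast ha)
    refine le_vp_iff.2 ⟨l + k, ?_⟩
    push_cast at hl ⊢
    linear_combination hk + 2 * hl
  rcases ENat.eq_or_lt_of_lt (n := 1) (by exact_mod_cast hb) with hb | hb
  · exact ⟨_, _, .row1 hb⟩
  rcases ENat.eq_or_lt_of_lt hb with hb | hb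
  · rcases ENat.eq_or_succ_le h3 with h | h
    · exact ⟨_, _, .row2 hb h⟩
    · rcases ENat.eq_or_lt_of_lt (n := 1) (by exact_mod_cast ha) with ha | ha
      · exact ⟨_, _, .row3 ha hb h⟩
      · exact ⟨_, _, .row4 (Order.add_one_le_of_lt ha) hb h⟩
  replace hb : 4 ≤ vp 2 b := Order.add_one_le_of_lt hb
  rcases ENat.eq_or_lt_of_lt (n := 1) (by exact_mod_cast ha) with ha | ha
  · rcases ENat.eq_or_succ_le h3 with h | h
    · exact exists_irregularRow_of_sub ha hb h hnz
    · exact ⟨_, _, .row5 ha hb h⟩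
  replace ha : 3 ≤ vp 2 a := Order.add_one_le_of_lt ha
  have h4 : ((4 : ℕ) : ℕ∞) ≤ vp 2 (2 * a + b) := by
    obtain ⟨k, hk⟩ := (le_vp_iff (n := 3)).1 (by exact_mod_cast ha)
    obtain ⟨l, hl⟩ := (le_vp_iff (n := 4)).1 (by exact_mod_cast hb)
    refine le_vp_iff.2 ⟨l + k, ?_⟩
    push_cast at hk hl ⊢
    linear_combination 2 * hk + hl
  rcases ENat.eq_or_succ_le h3 with h | h
  · exact ⟨_, _, .row7 ha hb h⟩
  rcases ENat.eq_or_succ_le h with h | h <;> rcases h4.eq_or_lt with h' | h'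
  · exact ⟨_, _, .row9 ha hb h h'.symm⟩
  · exact ⟨_, _, .row8 ha hb h h'⟩
  · exact ⟨_, _, .row10 ha hb h h'.symm⟩
  · exact ⟨_, _, .row11 ha hb h h'⟩

/-- Otherwise 4f = (2x² + a)², and θ would have degree at most 2. -/
lemma IsQuarticRoot.not_isSquare {K : Type*} [Field K] [NumberField K] {a b c : ℤ} {θ : K}
    (hθ : IsQuarticRoot a b c θ) (h : b = 0 ∧ 4 * c = a ^ 2) : False := by
  obtain ⟨rfl, hc⟩ := h
  have hc' : (4 * c : K) = a ^ 2 := by exact_mod_cast congrArg (Int.cast : ℤ → K) hc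
  have h0 := hθ.eq_zero
  have hsq : (2 * θ ^ 2 + a : K) ^ 2 = 0 := by
    push_cast at h0
    linear_combination 4 * h0 - hc'
  have h2 := hθ.linearIndependent a 0 2 0 (by
    push_cast
    linear_combination pow_eq_zero_iff two_ne_zero |>.1 hsq)
  norm_num at h2

lemma IsQuarticRoot.exists_irregularRow {K : Type*} [Field K] [NumberField K] {a b c : ℤ} {θ : K}
    (hθ : IsQuarticRoot a b c θ) (hc : vp 2 c = 2) (ha : 1 < vp 2 a) (hb : 1 < vp 2 b) :
    ∃ Q ν, IrregularRow a b c Q ν := by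
  refine _root_.exists_irregularRow hc ha hb fun ⟨h1, h2⟩ => hθ.not_isSquare ⟨h1, ?_⟩
  obtain ⟨k, rfl⟩ := (lt_vp_iff (p := 2) (n := 1)).1 (by exact_mod_cast ha)
  have : ((2 : ℕ) : ℤ) ^ (1 + 1) * k / 2 = 2 * k := by push_cast; omega
  unfold redConst at h2
  rw [this] at h2
  push_cast
  linear_combination 4 * h2

end IrregularExists

/-! ### Coefficients of a square of a quadratic modulo p -/

section SquareOfQuadratic

lemma eq_of_degree_four_eq {R : Type*} [CommRing R] {r₀ r₁ r₂ r₃ r₄ q₀ q₁ q₂ q₃ q₄ : R}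
    (h : C r₄ * X ^ 4 + C r₃ * X ^ 3 + C r₂ * X ^ 2 + C r₁ * X + C r₀ =
      C q₄ * X ^ 4 + C q₃ * X ^ 3 + C q₂ * X ^ 2 + C q₁ * X + C q₀) :
    r₄ = q₄ ∧ r₃ = q₃ ∧ r₂ = q₂ ∧ r₁ = q₁ ∧ r₀ = q₀ := by
  have hc : ∀ n, _ := fun n => congrArg (fun q => coeff q n) h
  refine ⟨?_, ?_, ?_, ?_, ?_⟩
  · simpa [coeff_X, coeff_C] using hc 4
  · simpa [coeff_X, coeff_C] using hc 3
  · simpa [coeff_X, coeff_C] using hc 2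
  · simpa [coeff_X, coeff_C] using hc 1
  · simpa [coeff_X, coeff_C] using hc 0

lemma quartic_map (R : Type*) [CommRing R] (a b c : ℤ) :
    (quartic a b c).map (Int.castRingHom R) =
      C 1 * X ^ 4 + C 0 * X ^ 3 + C (a : R) * X ^ 2 + C (b : R) * X + C (c : R) := by
  simp [quartic]

/-- The quadratic factor g need not be monic, so its leading coefficient u is only known to satisfy
u² = 1. -/
lemma exists_coeffs_of_isSquareOfIrredQuadMod {p : ℕ} [Fact p.Prime] {a b c : ℤ}
    (h : IsSquareOfIrredQuadMod p (quartic a b c)) :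
    ∃ u e d : ZMod p, u ^ 2 = 1 ∧ 2 * u * e = 0 ∧ 2 * u * d + e ^ 2 = a ∧ 2 * e * d = b ∧
      d ^ 2 = c ∧ ∀ x, u * x ^ 2 + e * x + d ≠ 0 := by
  obtain ⟨g, hirr, hdeg, hg⟩ := h
  rw [quartic_map] at hg
  obtain ⟨u, e, d, rfl⟩ : ∃ u e d : ZMod p, g = C u * X ^ 2 + C e * X + C d :=
    ⟨g.coeff 2, g.coeff 1, g.coeff 0, by
      conv_lhs => rw [g.as_sum_range_C_mul_X_pow, hdeg]
      simp [Finset.sum_range_succ]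
      ring⟩
  have e2 : (C u * X ^ 2 + C e * X + C d : (ZMod p)[X]) ^ 2 =
      C (u ^ 2) * X ^ 4 + C (2 * u * e) * X ^ 3 + C (2 * u * d + e ^ 2) * X ^ 2 +
        C (2 * e * d) * X + C (d ^ 2) := by
    simp only [map_add, map_mul, map_pow, map_ofNat]
    ring
  rw [e2] at hg
  obtain ⟨h4, h3, h2, h1, h0⟩ := eq_of_degree_four_eq hg.symm
  refine ⟨u, e, d, h4, h3, h2, h1, h0, fun x hx => ?_⟩
  exact hirr.not_isRoot_of_natDegree_ne_one (by omega) (x := x) (by simpa [IsRoot] using hx)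

end SquareOfQuadratic

/-! ### Floors of half-integers, and division by 4 modulo powers of an odd prime -/

section HalfMin

lemma exists_halfMin_eq {p : ℕ} (hp : p.Prime) {x y : ℤ} (h : x ≠ 0 ∨ y ≠ 0) :
    ∃ n : ℕ, halfMin (vp p x) (vp p y) = n / 2 ∧ (p : ℤ) ^ n ∣ x ∧ (p : ℤ) ^ n ∣ y ∧
      (¬ (p : ℤ) ^ (n + 1) ∣ x ∨ ¬ (p : ℤ) ^ (n + 1) ∣ y) := by
  have hne : min (vp p x) (vp p y) ≠ ⊤ := by
    rw [Ne, min_eq_top, vp_eq_top_iff hp, vp_eq_top_iff hp]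
    tauto
  obtain ⟨n, hn⟩ := ENat.ne_top_iff_exists.1 hne
  refine ⟨n, by rw [halfMin, ← hn]; simp, le_vp_iff.1 ?_, le_vp_iff.1 ?_, ?_⟩
  · rw [hn]; exact min_le_left _ _
  · rw [hn]; exact min_le_right _ _
  · rw [← lt_vp_iff, ← lt_vp_iff, not_lt, not_lt, hn]
    exact min_choice (vp p x) (vp p y) |>.imp (fun h => h.ge) (fun h => h.ge)

lemma floor_half_even (m : ℕ) : ⌊((2 * m : ℕ) : ℚ) / 2⌋₊ = m := by
  rw [Nat.floor_eq_iff (by positivity)]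
  constructor <;> push_cast <;> linarith

lemma floor_half_odd (m : ℕ) : ⌊((2 * m + 1 : ℕ) : ℚ) / 2⌋₊ = m := by
  rw [Nat.floor_eq_iff (by positivity)]
  constructor <;> push_cast <;> linarith

lemma floor_half_even_add (m : ℕ) : ⌊((2 * m : ℕ) : ℚ) / 2 + 1 / 2⌋₊ = m := by
  rw [Nat.floor_eq_iff (by positivity)]
  constructor <;> push_cast <;> linarith

lemma floor_half_odd_add (m : ℕ) : ⌊((2 * m + 1 : ℕ) : ℚ) / 2 + 1 / 2⌋₊ = m + 1 := by
  rw [Nat.floor_eq_iff (by positivity)]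
  constructor <;> push_cast <;> linarith

lemma exists_of_pow_dvd {p n : ℕ} {x : ℤ} (h : (p : ℤ) ^ n ∣ x) :
    ∃ k, x = p ^ n * k ∧ (¬ (p : ℤ) ^ (n + 1) ∣ x → ¬ (p : ℤ) ∣ k) := by
  obtain ⟨k, rfl⟩ := h
  refine ⟨k, rfl, fun h hk => h ?_⟩
  rw [pow_succ]
  exact mul_dvd_mul_left _ hk

lemma Nat.Prime.not_dvd_four {p : ℕ} (hp : p.Prime) (h2 : 2 < p) : ¬ (p : ℤ) ∣ 4 := by
  intro h
  have h' : p ∣ 2 ^ 2 := by exact_mod_cast h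
  exact absurd (Nat.le_of_dvd (by norm_num) (hp.dvd_of_dvd_pow h')) (by omega)

lemma exists_eq_of_four_mul_eq {p : ℕ} (hp : p.Prime) (h2 : 2 < p) {n : ℕ} {x y : ℤ}
    (h : 4 * x = p ^ n * y) : ∃ z, x = p ^ n * z ∧ 4 * z = y := by
  have hpn : (p : ℤ) ^ n ≠ 0 := pow_ne_zero _ (by exact_mod_cast hp.ne_zero)
  have hcop : IsCoprime ((p : ℤ) ^ n) 4 :=
    ((Nat.prime_iff_prime_int.1 hp).coprime_iff_not_dvd.2 (hp.not_dvd_four h2)).pow_left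
  obtain ⟨z, rfl⟩ := hcop.dvd_of_dvd_mul_left ⟨y, h⟩
  exact ⟨z, rfl, mul_left_cancel₀ hpn (by linear_combination h)⟩

end HalfMin

/-! ### The square of an irreducible quadratic modulo p -/

section SquareOfQuadraticBasis

variable {K : Type*} [Field K] [NumberField K]

lemma IsQuarticRoot.ne_zero_or {a b c : ℤ} {θ : K} (hθ : IsQuarticRoot a b c θ) :
    b ≠ 0 ∨ 4 * c - a ^ 2 ≠ 0 := by
  by_contra! h
  exact hθ.not_isSquare ⟨h.1, by linear_combination h.2⟩

/-- An integer approximation to a/2: if pⁿ = 2r + 1, then r + 1 is an inverse of 2 modulo pⁿ. -/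
lemma exists_shift_of_odd {p : ℕ} (hp : p.Prime) (h2 : 2 < p) (a : ℤ) (n : ℕ) :
    ∃ s k : ℤ, a - 2 * s = p ^ n * (a * k) := by
  have hodd : Odd ((p : ℤ) ^ n) := by
    have : Odd p := hp.odd_of_ne_two (by omega)
    exact_mod_cast this.pow
  obtain ⟨r, hr⟩ := hodd
  exact ⟨a * (r + 1), -1, by rw [hr]; ring⟩

/-- If 4c = a² the valuation on the left is infinite and s must be a/2 itself; a is then even
because a² is. -/
lemma exists_shift_square {p : ℕ} (hp : p.Prime) (h2 : 2 < p) (a c : ℤ) :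
    ∃ s : ℤ, vp p (4 * c - a ^ 2) < 2 * vp p (a - 2 * s) ∨ a = 2 * s := by
  by_cases h0 : 4 * c - a ^ 2 = 0
  · have : Even a := by
      have : Even (a ^ 2) := ⟨2 * c, by linear_combination -h0⟩
      rwa [Int.even_pow' two_ne_zero] at this
    obtain ⟨s, hs⟩ := this
    exact ⟨s, Or.inr (by omega)⟩
  · obtain ⟨n, hn⟩ := ENat.ne_top_iff_exists.1 (fun h => h0 ((vp_eq_top_iff hp).1 h))
    obtain ⟨s, k, hs⟩ := exists_shift_of_odd hp h2 a (n + 1)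
    refine ⟨s, Or.inl ?_⟩
    rw [← hn]
    have h1 : ((n + 1 : ℕ) : ℕ∞) ≤ vp p (a - 2 * s) := le_vp_iff.2 ⟨_, hs⟩
    calc (n : ℕ∞) < ((2 * (n + 1) : ℕ) : ℕ∞) := by exact_mod_cast (by omega : n < 2 * (n + 1))
      _ = 2 * ((n + 1 : ℕ) : ℕ∞) := by push_cast; rfl
      _ ≤ _ := by gcongr

lemma pow_dvd_of_lt_two_mul {p : ℕ} {x y : ℤ} {m : ℕ} (h : vp p x < 2 * vp p y ∨ y = 0)
    (hx : (p : ℤ) ^ (2 * m) ∣ x) : (p : ℤ) ^ (m + 1) ∣ y := by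
  rcases h with h | rfl
  · by_contra hy
    rw [← lt_vp_iff, not_lt] at hy
    rw [← le_vp_iff] at hx
    have : (2 * vp p y : ℕ∞) ≤ 2 * m := by gcongr
    push_cast at hx
    exact absurd (h.trans_le (this.trans hx)) (lt_irrefl _)
  · exact dvd_zero _

lemma towerBasis_zero (p : ℕ) (θ : K) (s : ℤ) (m n : ℕ) :
    towerBasis p θ 0 s m n =
      ![1, θ, (θ ^ 2 + s) / (p : K) ^ m, (θ ^ 3 + s * θ) / (p : K) ^ n] := by
  unfold towerBasis
  congr 4
  · push_cast; ring
  · push_cast; ring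

theorem IsQuarticRoot.basis_of_isSquareOfIrredQuadMod_odd {p : ℕ} (hp : p.Prime) (h2 : 2 < p)
    {a b c : ℤ} {θ : K} (hθ : IsQuarticRoot a b c θ)
    (h : IsSquareOfIrredQuadMod p (quartic a b c)) {s : ℤ}
    (hs : vp p (4 * c - a ^ 2) < 2 * vp p (a - 2 * s) ∨ a = 2 * s) :
    IsPIntegralBasis p ![1, θ,
      (θ ^ 2 + (s : K)) / (p : K) ^ ⌊halfMin (vp p b) (vp p (4 * c - a ^ 2))⌋₊,
      (θ ^ 3 + (s : K) * θ) / (p : K) ^ ⌊halfMin (vp p b) (vp p (4 * c - a ^ 2))⌋₊] := by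
  have := Fact.mk hp
  have hs' : vp p (4 * c - a ^ 2) < 2 * vp p (a - 2 * s) ∨ a - 2 * s = 0 :=
    hs.imp_right fun h => by omega
  obtain ⟨u, e, d, hu, hue, ha, hb, hc, hroot⟩ := exists_coeffs_of_isSquareOfIrredQuadMod h
  have h2' : (2 : ZMod p) ≠ 0 := by
    have := intCast_ne_zero_of_not_dvd (hp.not_dvd_four h2)
    intro h
    apply this
    push_cast
    linear_combination 2 * h
  have hu0 : u ≠ 0 := by rintro rfl; simp at hu
  obtain rfl : e = 0 := by simpa [h2', hu0] using hue
  have hpb : (p : ℤ) ∣ b := (ZMod.intCast_zmod_eq_zero_iff_dvd _ _).1 (by rw [← hb]; ring)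
  have hpD : (p : ℤ) ∣ 4 * c - a ^ 2 := (ZMod.intCast_zmod_eq_zero_iff_dvd _ _).1 (by
    push_cast
    rw [← ha, ← hc]
    linear_combination (-4 * d ^ 2) * hu)
  obtain ⟨n, hn, hnb, hnD, hne⟩ := exists_halfMin_eq hp hθ.ne_zero_or
  -- Since f is a square modulo p, p divides both b and 4c − a².
  have hn1 : n ≠ 0 := by
    rintro rfl
    simp only [zero_add, pow_one] at hne
    tauto
  rw [hn]
  have hsmod : (2 * s : ZMod p) = a := by
    obtain ⟨k, hk⟩ := pow_dvd_of_lt_two_mul (m := 0) hs' (by simp)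
    have := congrArg (Int.cast : ℤ → ZMod p) hk
    push_cast at this
    rw [CharP.cast_eq_zero] at this
    linear_combination -this
  have hirr : ∀ x y : ZMod p, x ^ 2 - ((0 : ℤ) : ZMod p) * x * y + s * y ^ 2 = 0 →
      x = 0 ∧ y = 0 := by
    intro x y hxy
    push_cast at hxy
    have hsd : (s : ZMod p) = u * d := by
      refine mul_left_cancel₀ h2' ?_
      rw [hsmod, ← ha]
      ring
    by_cases hy : y = 0
    · refine ⟨?_, hy⟩
      subst hy
      simpa using hxy
    · refine absurd ?_ (hroot (x / y))
      field_simp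
      rw [hsd] at hxy
      linear_combination u * hxy - d * y ^ 2 * hu
  obtain ⟨b', rfl, hb'⟩ := exists_of_pow_dvd hnb
  obtain ⟨D', hD', hD''⟩ := exists_of_pow_dvd hnD
  have hne' := hne.imp hb' hD''
  -- The identity 4(c − s² − (a − 2s)s) = (4c − a²) + (a − 2s)² has a negligible last square, so n
  -- is the valuation of the linear remainder of the development by x² + s. For even n, ψ² reduces
  -- to a nonzero element of the residue field F_p[θ]; for odd n, ψ²/p does.
  obtain ⟨m, rfl | rfl⟩ := Nat.even_or_odd' n
  · obtain ⟨m, rfl⟩ : ∃ k, m = k + 1 := ⟨m - 1, by omega⟩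
    rw [floor_half_even]
    obtain ⟨k, hk⟩ := pow_dvd_of_lt_two_mul hs' hnD
    obtain ⟨z, hz, hz'⟩ := exists_eq_of_four_mul_eq hp h2 (n := 2 * (m + 1))
      (x := c - s ^ 2 - (a - 2 * s) * s) (y := D' + p ^ 2 * k ^ 2) (by
      linear_combination hD' + (a - 2 * s + p ^ (m + 1 + 1) * k) * hk)
    have key := hθ.basis_of_unramified_odd hp h2 (m := m) (β := 0) (γ := s) (A := -k)
      (B := -b') (C := -z) (E := 0) ⟨by linear_combination hk, by ring,
        by ring, by linear_combination hz⟩ hirr ?_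
    · rwa [towerBasis_zero] at key
    · rw [dvd_neg, dvd_neg]
      refine hne'.symm.imp (fun h h' => h ?_) id
      have : D' = 4 * z - p * (p * k ^ 2) := by rw [hz']; ring
      rw [this]
      exact dvd_sub (h'.mul_left _) (Dvd.intro _ rfl)
  · rw [floor_half_odd]
    obtain ⟨k, hk⟩ := pow_dvd_of_lt_two_mul (m := m) hs' (dvd_trans (pow_dvd_pow _ (by omega)) hnD)
    obtain ⟨z, hz, hz'⟩ := exists_eq_of_four_mul_eq hp h2 (n := 2 * m + 1)
      (x := c - s ^ 2 - (a - 2 * s) * s) (y := D' + p * k ^ 2) (by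
      linear_combination hD' + (a - 2 * s + p ^ (m + 1) * k) * hk)
    have key := hθ.basis_of_inert_ramified hp (m := m) (β := 0) (γ := s) (A := -k)
      (B := -b') (C := -z) (E := 0) ⟨by linear_combination hk, by ring,
        by ring, by linear_combination hz⟩ hirr ?_
    · rwa [towerBasis_zero] at key
    · rw [dvd_neg, dvd_neg]
      refine hne'.symm.imp (fun h h' => h ?_) id
      have : D' = 4 * z - p * (k ^ 2) := by rw [hz']; ring
      rw [this]
      exact dvd_sub (h'.mul_left _) (Dvd.intro _ rfl)

/-- The only irreducible quadratic over F₂ is x² + x + 1, whose square is x⁴ + x² + 1. -/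
lemma mod_two_of_isSquareOfIrredQuadMod {a b c : ℤ}
    (h : IsSquareOfIrredQuadMod 2 (quartic a b c)) : Odd a ∧ Even b ∧ Odd c := by
  have key : ∀ u e d : ZMod 2, u ^ 2 = 1 → (∀ x, u * x ^ 2 + e * x + d ≠ 0) →
      2 * u * d + e ^ 2 = 1 ∧ 2 * e * d = 0 ∧ d ^ 2 = 1 := by decide
  have := Fact.mk Nat.prime_two
  obtain ⟨u, e, d, hu, -, ha, hb, hc, hroot⟩ := exists_coeffs_of_isSquareOfIrredQuadMod h
  obtain ⟨h1, h2, h3⟩ := key u e d hu hroot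
  rw [ha] at h1
  rw [hb] at h2
  rw [hc] at h3
  exact ⟨ZMod.intCast_eq_one_iff_odd.1 h1, ZMod.intCast_eq_zero_iff_even.1 h2,
    ZMod.intCast_eq_one_iff_odd.1 h3⟩

lemma norm_form_two (x y : ZMod 2) :
    x ^ 2 - ((1 : ℤ) : ZMod 2) * x * y + ((1 : ℤ) : ZMod 2) * y ^ 2 = 0 → x = 0 ∧ y = 0 := by
  revert x y
  decide

/-- For φ = x² + x + 1 one has f = φ² + (a − 1 − 2x)φ + (b + 1 − a)x + (c − a), which explains μ. If
μ = 1, φ(θ)²/2 is a unit modulo (2, φ(θ)). If μ > 1, ψ = φ(θ)/2 satisfies a separable equation over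
F₄: its linear coefficient (1 − a)/2 + θ is nonzero there. -/
theorem IsQuarticRoot.basis_of_isSquareOfIrredQuadMod_two {a b c : ℤ} {θ : K}
    (hθ : IsQuarticRoot a b c θ) (h : IsSquareOfIrredQuadMod 2 (quartic a b c)) :
    (min (vp 2 (b + 1 - a)) (vp 2 (c - a)) = 1 → IsPIntegralBasis 2 ![1, θ, θ ^ 2, θ ^ 3]) ∧
      (min (vp 2 (b + 1 - a)) (vp 2 (c - a)) ≠ 1 →
        1 < min (vp 2 (b + 1 - a)) (vp 2 (c - a)) ∧
        IsPIntegralBasis 2 ![1, θ, (θ ^ 2 + θ + 1) / 2, (θ ^ 3 + θ ^ 2 + θ) / 2]) := by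
  obtain ⟨⟨a, rfl⟩, ⟨b, rfl⟩, ⟨c, rfl⟩⟩ := mod_two_of_isSquareOfIrredQuadMod h
  have e1 : b + b + 1 - (2 * a + 1) = 2 * (b - a) := by ring
  have e2 : 2 * c + 1 - (2 * a + 1) = 2 * (c - a) := by ring
  rw [e1, e2]
  have le : 1 ≤ min (vp 2 (2 * (b - a))) (vp 2 (2 * (c - a))) :=
    le_min (le_vp_iff (n := 1).2 ⟨b - a, by ring⟩) (le_vp_iff (n := 1).2 ⟨c - a, by ring⟩)
  constructor
  · intro hμ
    have hne : ¬ (2 : ℤ) ∣ a - c ∨ ¬ (2 : ℤ) ∣ a - b := by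
      by_contra! hcon
      obtain ⟨⟨k, hk⟩, ⟨l, hl⟩⟩ := hcon
      have : ((2 : ℕ) : ℕ∞) ≤ min (vp 2 (2 * (b - a))) (vp 2 (2 * (c - a))) :=
        le_min (le_vp_iff.2 ⟨-l, by push_cast; linear_combination -2 * hl⟩)
          (le_vp_iff.2 ⟨-k, by push_cast; linear_combination -2 * hk⟩)
      rw [hμ] at this
      exact absurd (Nat.cast_le.1 (this : ((2 : ℕ) : ℕ∞) ≤ (1 : ℕ))) (by norm_num)
    have key := hθ.basis_of_inert_ramified Nat.prime_two (m := 0) (β := 1) (γ := 1) (A := -a)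
      (B := a - b) (C := a - c) (E := 1)
      ⟨by push_cast; ring, by simp, by push_cast; ring, by push_cast; ring⟩
      norm_form_two hne
    exact key.of_unipotent_int Nat.prime_two 0 (-1) (-1) 1 0 (-1) (by simp)
      (by push_cast; ring) (by push_cast; ring)
  · intro hμ
    have hlt := lt_of_le_of_ne le (Ne.symm hμ)
    refine ⟨hlt, ?_⟩
    obtain ⟨k, hk⟩ := lt_vp_iff (n := 1).1 (hlt.trans_le (min_le_left _ _))
    obtain ⟨l, hl⟩ := lt_vp_iff (n := 1).1 (hlt.trans_le (min_le_right _ _))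
    push_cast at hk hl
    have key := hθ.basis_of_unramified_two (m := 0) (β := 1) (γ := 1) (A := -a)
      (B := -k) (C := -l) (E := 1)
      ⟨by push_cast; ring, by simp, by push_cast; linear_combination hk,
        by push_cast; linear_combination hl⟩
      norm_form_two (Or.inr (by norm_num))
    convert key using 1
    unfold towerBasis
    congr 4
    · simp
    · push_cast; ring_nf
    · push_cast; ring

end SquareOfQuadraticBasis

/-! ### Quadruple root modulo p: rows 3, 4 and 5 -/

section QuadrupleRootTower

variable {K : Type*} [Field K] [NumberField K]

lemma not_dvd_den_div_two {p : ℕ} (h2 : 2 < p) (n : ℤ) :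
    ¬ p ∣ ((n : ℚ) / 2).den := by
  intro h
  have h' : ((n : ℚ) / 2).den ∣ 2 := by
    have := Rat.den_dvd n 2
    rw [Rat.divInt_eq_div] at this
    exact_mod_cast this
  exact absurd (Nat.le_of_dvd two_pos (h.trans h')) (by omega)

/-- For odd p, a/2 lies in ℤ_(p), and an integer γ congruent to it modulo p^(m+j) gives the same
span. -/
lemma IsPIntegralBasis.of_towerBasis_half {p : ℕ} (hp : p.Prime) (h2 : 2 < p) {θ : K} {a γ k : ℤ}
    {m j : ℕ} (h : IsPIntegralBasis p (towerBasis p θ 0 γ m (m + j)))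
    (hk : a - 2 * γ = p ^ (m + j) * k) :
    IsPIntegralBasis p ![1, θ, (θ ^ 2 + (a : K) / 2) / (p : K) ^ m,
      (θ ^ 3 + (a : K) / 2 * θ) / (p : K) ^ (m + j)] := by
  have hp0 : (p : K) ≠ 0 := by exact_mod_cast hp.ne_zero
  rw [towerBasis_zero] at h
  have hk' : (a - 2 * γ : K) = p ^ (m + j) * k := by exact_mod_cast congrArg (Int.cast : ℤ → K) hk
  have ha : (a : K) = 2 * γ + p ^ (m + j) * k := by linear_combination hk'
  have h0 : ¬ p ∣ (0 : ℚ).den := by simpa using hp.ne_one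
  refine h.of_unipotent hp 0 (((p ^ j * k : ℤ) : ℚ) / 2) 0 0 ((k : ℚ) / 2) 0 h0
    (not_dvd_den_div_two h2 _) h0 h0 (not_dvd_den_div_two h2 _) h0 (by simp) ?_ ?_
  · rw [ha]
    push_cast
    rw [pow_add]
    field_simp
    ring
  · rw [ha]
    push_cast
    field_simp
    ring

/-- Up to negligible terms, (θ² + a/2)² = (a² − 4c)/4 − bθ. With n the smaller of the valuations of
b and a² − 4c, the parity of n and the term that attains it decide whether ψ or θψ/p is a separable
generator, or whether the extension is totally ramified. -/
theorem IsQuarticRoot.basis_half {p : ℕ} (hp : p.Prime) (h2 : 2 < p)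
    {a b c : ℤ} {θ : K} (hθ : IsQuarticRoot a b c θ) (ha : vp p a = 1) (hb : 1 < vp p b)
    (hc : vp p c = 2) :
    IsPIntegralBasis p ![1, θ,
      (θ ^ 2 + (a : K) / 2) / (p : K) ^ ⌊halfMin (vp p b) (vp p (a ^ 2 - 4 * c))⌋₊,
      (θ ^ 3 + (a : K) / 2 * θ) /
        (p : K) ^ ⌊halfMin (vp p b) (vp p (a ^ 2 - 4 * c)) + 1 / 2⌋₊] := by
  have hpZ := Nat.prime_iff_prime_int.1 hp
  have hp0 : (p : ℤ) ≠ 0 := hpZ.ne_zero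
  obtain ⟨n, hn, hnb, hnD, hne⟩ := exists_halfMin_eq hp
    (x := b) (y := a ^ 2 - 4 * c) (hθ.ne_zero_or.imp_right fun h h' => h (by linarith))
  obtain ⟨a', rfl, ha'⟩ := (vp_eq_iff hp (n := 1)).1 (by exact_mod_cast ha)
  obtain ⟨c', rfl, hc'⟩ := (vp_eq_iff hp (n := 2)).1 (by exact_mod_cast hc)
  have hn2 : 2 ≤ n := by
    by_contra! hlt
    rcases hne with h | h
    · exact h ((pow_dvd_pow _ (by omega)).trans (lt_vp_iff (n := 1).1 (by exact_mod_cast hb)))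
    · exact h ((pow_dvd_pow _ (show n + 1 ≤ 2 by omega)).trans
        ⟨a' ^ 2 - 4 * c', by ring⟩)
  have h4 := hp.not_dvd_four h2
  have h2' : ¬ (p : ℤ) ∣ 2 := fun h => h4 (h.trans ⟨2, by norm_num⟩)
  rw [hn]
  obtain ⟨b', rfl, hb'⟩ := exists_of_pow_dvd hnb
  obtain ⟨D', hD', hD''⟩ := exists_of_pow_dvd hnD
  have hne' := hne.imp hb' hD''
  clear hne hb' hD'' ha hb hc hnb hnD hn
  obtain ⟨m, rfl | rfl⟩ := Nat.even_or_odd' n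
  all_goals obtain ⟨m, rfl⟩ : ∃ k, m = k + 1 := ⟨m - 1, by omega⟩
  all_goals
    -- The integer pg approximates a/2 so closely that (a − 2pg)² does not influence the development
    -- at level n.
    obtain ⟨g, q, hg⟩ := exists_shift_of_odd hp h2 a' (m + 2)
    have hγ : ¬ (p : ℤ) ∣ g := fun ⟨l, hl⟩ => ha' ⟨2 * l + p ^ (m + 1) * (a' * q), by
      rw [hl] at hg
      linear_combination hg⟩
  · rw [floor_half_even, floor_half_even_add]
    refine IsPIntegralBasis.of_towerBasis_half (j := 0) (γ := p * g) (k := p ^ 2 * (a' * q)) hp h2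
      ?_ (by linear_combination p * hg)
    obtain ⟨z, hz, hz'⟩ := exists_eq_of_four_mul_eq hp h2 (n := 2 * (m + 1))
      (x := p ^ 2 * c' - (p * g) ^ 2 - (p ^ 1 * a' - 2 * (p * g)) * (p * g))
      (y := p * (p ^ 3 * (a' * q) ^ 2) - D') (by
        linear_combination - hD' + p ^ 2 * (a' - 2 * g + p ^ (m + 2) * (a' * q)) * hg)
    by_cases hD : (p : ℤ) ∣ D'
    · have hB : ¬ (p : ℤ) ∣ b' := hne'.resolve_right (fun h => h hD)
      obtain ⟨D', rfl⟩ := hD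
      obtain ⟨w, rfl, hw⟩ := exists_eq_of_four_mul_eq hp h2 (n := 1) (x := z)
        (y := p ^ 3 * (a' * q) ^ 2 - D') (by linear_combination hz')
      simpa using hθ.basis_of_totally_ramified hp (m := m) (β := 0) (γ := g)
        (A := -(p * (a' * q))) (B := -b') (C := -w) (E := 0)
        ⟨by linear_combination p * hg, by ring, by ring, by linear_combination hz⟩ hγ
        (by rwa [dvd_neg])
    · have hA : ¬ (p : ℤ) ∣ z := fun h => hD (by
        have : D' = p * (p ^ 3 * (a' * q) ^ 2) - 4 * z := by linear_combination hz'
        rw [this]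
        exact dvd_sub (Dvd.intro _ rfl) (h.mul_left 4))
      have hsep : ¬ (p : ℤ) ∣ (-(p * (p * (a' * q)))) ^ 2 + 4 * -z := by
        intro h
        have h' := dvd_sub (Dvd.intro (p ^ 3 * (a' * q) ^ 2) rfl) h
        refine (hpZ.dvd_or_dvd (b := z) (a := 4) ?_).elim h4 hA
        convert h' using 1
        ring
      -- This norm is exactly c/p², a unit.
      have hram : ¬ (p : ℤ) ∣ g ^ 2 - p ^ m * g * -(p * (p * (a' * q))) - (p ^ m) ^ 2 * -z := by
        have : g ^ 2 - p ^ m * g * -(p * (p * (a' * q))) - (p ^ m) ^ 2 * -z = c' := by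
          refine mul_left_cancel₀ (pow_ne_zero 2 hp0) ?_
          linear_combination -hz - p ^ 2 * g * hg
        rwa [this]
      simpa using hθ.basis_of_ramified_separable hp (m := m) (β := 0) (γ := g)
        (A := -(p * (p * (a' * q)))) (B := -b') (C := -z) (E := 0)
        ⟨by linear_combination p * hg, by ring, by ring, by linear_combination hz⟩ hsep hram
  · rw [floor_half_odd, floor_half_odd_add]
    refine IsPIntegralBasis.of_towerBasis_half (j := 1) (γ := p * g) (k := p * (a' * q)) hp h2
      ?_ (by linear_combination p * hg)
    obtain ⟨z, hz, hz'⟩ := exists_eq_of_four_mul_eq hp h2 (n := 2 * (m + 1) + 1)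
      (x := p ^ 2 * c' - (p * g) ^ 2 - (p ^ 1 * a' - 2 * (p * g)) * (p * g))
      (y := p * (p ^ 2 * (a' * q) ^ 2) - D') (by
        linear_combination - hD' + p ^ 2 * (a' - 2 * g + p ^ (m + 2) * (a' * q)) * hg)
    by_cases hD : (p : ℤ) ∣ D'
    · have hB : ¬ (p : ℤ) ∣ b' := hne'.resolve_right (fun h => h hD)
      have hz4 : (p : ℤ) ∣ z := by
        refine (hpZ.dvd_or_dvd (a := 4) ?_).resolve_left h4
        rw [hz']
        exact dvd_sub (Dvd.intro _ rfl) hD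
      simpa using hθ.basis_succ_of_totally_ramified hp (m := m) (β := 0) (γ := g)
        (A := -(p * (a' * q))) (B := -b') (C := -z) (E := 0)
        ⟨by linear_combination p * hg, by ring, by ring, by linear_combination hz⟩ hγ
        (by rwa [dvd_neg]) (dvd_zero _) (by rwa [dvd_neg])
    · have hA : ¬ (p : ℤ) ∣ z := fun h => hD (by
        have : D' = p * (p ^ 2 * (a' * q) ^ 2) - 4 * z := by linear_combination hz'
        rw [this]
        exact dvd_sub (Dvd.intro _ rfl) (h.mul_left 4))
      have hsep : ¬ (p : ℤ) ∣ g * 0 ^ 2 - 4 * -z := by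
        intro h
        rw [show g * 0 ^ 2 - 4 * -z = 4 * z by ring] at h
        exact (hpZ.dvd_or_dvd h).elim h4 hA
      simpa using hθ.basis_succ_of_ramified_separable hp (m := m) (β := 0) (γ := g)
        (A := -(p * (a' * q))) (B := -b') (C := -z) (E := 0)
        ⟨by linear_combination p * hg, by ring, by ring, by linear_combination hz⟩ hγ hsep

/-- The element ψ = θ²/p is a root modulo (p, θ) of y² + (a/p)y + c/p². Its discriminant is a unit:
for p = 2 because a/2 is odd, for p > 2 because p ∣ a/p and c/p² is a unit. -/
lemma IsQuarticRoot.basis_of_vp_eq_two {p : ℕ} (hp : p.Prime)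
    {a b c : ℤ} {θ : K} (hθ : IsQuarticRoot a b c θ) (hb : 1 < vp p b) (hc : vp p c = 2)
    (h : p = 2 ∧ vp p a = 1 ∨ 2 < p ∧ 1 < vp p a) :
    IsPIntegralBasis p ![1, θ, θ ^ 2 / (p : K), θ ^ 3 / (p : K)] := by
  have hpZ := Nat.prime_iff_prime_int.1 hp
  obtain ⟨b', rfl⟩ := (lt_vp_iff (n := 1)).1 (by exact_mod_cast hb)
  obtain ⟨c', rfl, hc'⟩ := (vp_eq_iff hp (n := 2)).1 (by exact_mod_cast hc)
  obtain ⟨a', rfl, ha'⟩ : ∃ a', a = p * a' ∧ ¬ (p : ℤ) ∣ a' ^ 2 - 4 * c' := by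
    rcases h with ⟨rfl, ha⟩ | ⟨h2, ha⟩
    · obtain ⟨k, rfl, hk⟩ := (vp_eq_iff hp (n := 1)).1 (by exact_mod_cast ha)
      refine ⟨k, by ring, fun h => hk (hpZ.dvd_of_dvd_pow (n := 2) ?_)⟩
      have := dvd_add h (Dvd.intro (2 * c') rfl)
      convert this using 1
      push_cast
      ring
    · obtain ⟨k, rfl⟩ := (lt_vp_iff (n := 1)).1 (by exact_mod_cast ha)
      refine ⟨p * k, by ring, fun h => ?_⟩
      refine (hpZ.dvd_or_dvd (a := 4) (b := c') ?_).elim (hp.not_dvd_four h2) hc'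
      have := dvd_sub (Dvd.intro (p * k ^ 2) rfl) h
      convert this using 1
      ring
  have key := hθ.basis_of_ramified_separable hp (m := 0) (β := 0) (γ := 0)
    (A := -a') (B := -b') (C := -c') (E := 0) ⟨by ring, by ring, by ring, by ring⟩
    (by convert ha' using 2; ring) (by convert hc' using 2; ring)
  simpa [towerBasis_zero] using key

end QuadrupleRootTower

/-! ### Quadruple root modulo p: bases made of powers of θ (rows 1, 2, 9, 10) -/

section QuadrupleRootDirect

variable {K : Type*} [Field K] [NumberField K]

/-- Here f is an Eisenstein polynomial: θ is a uniformizer, and multiplication by it detects l₁, l₂,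
l₃. -/
lemma IsQuarticRoot.basis_powers {p : ℕ} (hp : p.Prime) {a b c : ℤ} {θ : K}
    (hθ : IsQuarticRoot (p * a) (p * b) (p * c) θ) (hc : ¬ (p : ℤ) ∣ c) :
    IsPIntegralBasis p ![1, θ, θ ^ 2, θ ^ 3] := by
  have := Fact.mk hp
  have hc' := intCast_ne_zero_of_not_dvd hc
  have h4 := hθ.eq_zero
  push_cast at h4
  refine isPIntegralBasis_of_mulTable hp
    (hθ.linearIndependent_of_triangular one_ne_zero one_ne_zero 0 0 0 0 0 0
      (by simp) (by simp) (by simp)) hθ.finrank_eq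
    (t := { t11 := ![0, 0, 1, 0]
            t12 := ![0, 0, 0, 1]
            t13 := ![-p * c, -p * b, -p * a, 0]
            t22 := ![-p * c, -p * b, -p * a, 0]
            t23 := ![0, -p * c, -p * b, -p * a]
            t33 := ![p ^ 2 * a * c, p ^ 2 * a * b, p ^ 2 * a ^ 2 - p * c, -p * b] })
    ?_ {0} [![0, 1, 0, 0]] ?_ ?_ ?_ ?_ ?_
  · constructor <;> simp [evalCoord]
    · ring
    · ring
    · linear_combination h4
    · linear_combination h4
    · linear_combination θ * h4
    · linear_combination (θ ^ 2 - p * a) * h4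
  · intro x y hy
    simp [MulTable.mul] at hy ⊢
    simp [hy]
  · intro x hx
    simpa [MulTable.mul] using hx
  · simp
  · simp [MulTable.mul, forall_fin_four]
  · intro l hl he
    simp [MulTable.mul, forall_fin_four] at hl he ⊢
    obtain ⟨k, ⟨hk0, hk1, hk2, hk3⟩, k0⟩ := he
    have l0 := (ZMod.intCast_zmod_eq_zero_iff_dvd _ _).2 hl
    have c1 := congrArg (Int.cast : ℤ → ZMod p) hk2
    have c2 := congrArg (Int.cast : ℤ → ZMod p) hk3
    push_cast at c1 c2
    rw [CharP.cast_eq_zero] at c1 c2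
    have c3 := ZMod.eq_zero_of_mul_eq hp (x := -(c * l 3)) (y := k 0) (by linear_combination hk0) k0
    push_cast at c3
    have l3 : (l 3 : ZMod p) = 0 := by simpa [hc'] using c3
    refine ⟨l0, ?_, ?_, l3⟩
    · linear_combination c1
    · linear_combination c2

/-- The Newton polygon has the single slope −3/4, so θ³/p² has valuation 9/4 − 2 = 1/4 and is a
uniformizer. -/
lemma IsQuarticRoot.basis_powers_of_vp_eq_three {p : ℕ} (hp : p.Prime) {a b c : ℤ} {θ : K}
    (hθ : IsQuarticRoot (p ^ 2 * a) (p ^ 3 * b) (p ^ 3 * c) θ) (hc : ¬ (p : ℤ) ∣ c) :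
    IsPIntegralBasis p ![1, θ, θ ^ 2 / (p : K), θ ^ 3 / (p : K) ^ 2] := by
  have := Fact.mk hp
  have hc' := intCast_ne_zero_of_not_dvd hc
  have hp0 : (p : K) ≠ 0 := by exact_mod_cast hp.ne_zero
  have hp0' : (p : ℤ) ≠ 0 := by exact_mod_cast hp.ne_zero
  have h4 := hθ.eq_zero
  push_cast at h4
  refine isPIntegralBasis_of_mulTable hp
    (hθ.linearIndependent_of_triangular hp0' (pow_ne_zero 2 hp0') 0 0 0 0 0 0
      (by simp) (by push_cast; field_simp; ring) (by push_cast; field_simp; ring)) hθ.finrank_eq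
    (t := { t11 := ![0, 0, p, 0]
            t12 := ![0, 0, 0, p]
            t13 := ![-p * c, -p * b, -p * a, 0]
            t22 := ![-p * c, -p * b, -p * a, 0]
            t23 := ![0, -c, -p * b, -p * a]
            t33 := ![p * a * c, p * a * b, p * a ^ 2 - c, -p * b] })
    ?_ {0} [![0, 0, 0, 1]] ?_ ?_ ?_ ?_ ?_
  · constructor <;> simp [evalCoord] <;> field_simp
    · linear_combination h4
    · linear_combination h4
    · linear_combination θ * h4
    · linear_combination (θ ^ 2 - p ^ 2 * a) * h4
  · intro x y hy
    simp [MulTable.mul] at hy ⊢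
    simp [hy]
  · intro x hx
    simpa [MulTable.mul] using hx
  · simp
  · simp [MulTable.mul, forall_fin_four]
  · intro l hl he
    simp [MulTable.mul, forall_fin_four] at hl he ⊢
    obtain ⟨k, ⟨hk0, hk1, hk2, hk3⟩, k0⟩ := he
    have l0 := (ZMod.intCast_zmod_eq_zero_iff_dvd _ _).2 hl
    have c1 := congrArg (Int.cast : ℤ → ZMod p) hk1
    have c2 := congrArg (Int.cast : ℤ → ZMod p) hk2
    push_cast at c1 c2
    rw [CharP.cast_eq_zero] at c1 c2
    have l2 : (l 2 : ZMod p) = 0 := by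
      have : (c : ZMod p) * l 2 = 0 := by linear_combination -c1
      simpa [hc'] using this
    have l3 : (l 3 : ZMod p) = 0 := by
      have : (c : ZMod p) * l 3 = 0 := by linear_combination -c2
      simpa [hc'] using this
    have c3 := ZMod.eq_zero_of_mul_eq hp (x := -(c * l 1) + a * c * l 3) (y := k 0)
      (by linear_combination hk0) k0
    push_cast at c3
    have l1 : (l 1 : ZMod p) = 0 := by
      have : (c : ZMod p) * l 1 = 0 := by linear_combination -c3 + a * c * l3
      simpa [hc'] using this
    exact ⟨l0, l1, l2, l3⟩

/-- The polygon has a side of slope −1/3 and a steeper side of length 1. On the first factor θ³/p is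
a unit: modulo the radical it satisfies y² = −by for the reduced coefficient b, so the residue ring
is F_p × F_p. -/
lemma IsQuarticRoot.basis_powers_of_vp_eq_one {p : ℕ} (hp : p.Prime) {a b c : ℤ} {θ : K}
    (hθ : IsQuarticRoot (p * a) (p * b) (p ^ 2 * c) θ) (hb : ¬ (p : ℤ) ∣ b) :
    IsPIntegralBasis p ![1, θ, θ ^ 2, θ ^ 3 / (p : K)] := by
  have := Fact.mk hp
  have hb' := intCast_ne_zero_of_not_dvd hb
  have hp0 : (p : K) ≠ 0 := by exact_mod_cast hp.ne_zero
  have hp0' : (p : ℤ) ≠ 0 := by exact_mod_cast hp.ne_zero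
  have h4 := hθ.eq_zero
  push_cast at h4
  refine isPIntegralBasis_of_mulTable hp
    (hθ.linearIndependent_of_triangular one_ne_zero hp0' 0 0 0 0 0 0
      (by simp) (by simp) (by push_cast; field_simp; ring)) hθ.finrank_eq
    (t := { t11 := ![0, 0, 1, 0]
            t12 := ![0, 0, 0, p]
            t13 := ![-p * c, -b, -a, 0]
            t22 := ![-p ^ 2 * c, -p * b, -p * a, 0]
            t23 := ![0, -p * c, -b, -p * a]
            t33 := ![p * a * c, a * b, a ^ 2 - c, -b] })
    ?_ {0, 3} [![0, 1, 0, 0]] ?_ ?_ ?_ ?_ ?_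
  · constructor <;> simp [evalCoord] <;> field_simp
    · linear_combination h4
    · linear_combination h4
    · linear_combination θ * h4
    · linear_combination (θ ^ 2 - p * a) * h4
  · intro x y hy
    simp [MulTable.mul] at hy ⊢
    simp [hy]
  · intro x hx
    simp [MulTable.mul] at hx ⊢
    obtain ⟨h0, h3⟩ := hx
    refine ⟨h0, ?_⟩
    simpa [h0, hb'] using h3
  · simp
  · simp [MulTable.mul, forall_fin_four]
  · intro l hl he
    simp [MulTable.mul, forall_fin_four] at hl he ⊢
    obtain ⟨k, ⟨hk0, hk1, hk2, hk3⟩, k0, k3⟩ := he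
    have l0 := (ZMod.intCast_zmod_eq_zero_iff_dvd _ _).2 hl.1
    have l3 := (ZMod.intCast_zmod_eq_zero_iff_dvd _ _).2 hl.2
    have c2 := congrArg (Int.cast : ℤ → ZMod p) hk2
    push_cast at c2
    rw [CharP.cast_eq_zero] at c2
    have l2 := ZMod.eq_zero_of_mul_eq hp (x := l 2) (y := k 3) (by linear_combination hk3) k3
    refine ⟨l0, ?_, l2, l3⟩
    linear_combination c2 + a * l3

/-- As for slope −1/3, now with slope −2/3: θ³/p² generates the residue ring F_p × F_p, and θ²/p has
valuation 1/3 on the ramified factor. -/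
lemma IsQuarticRoot.basis_powers_of_vp_eq_two {p : ℕ} (hp : p.Prime) {a b c : ℤ} {θ : K}
    (hθ : IsQuarticRoot (p ^ 2 * a) (p ^ 2 * b) (p ^ 3 * c) θ) (hb : ¬ (p : ℤ) ∣ b) :
    IsPIntegralBasis p ![1, θ, θ ^ 2 / (p : K), θ ^ 3 / (p : K) ^ 2] := by
  have := Fact.mk hp
  have hb' := intCast_ne_zero_of_not_dvd hb
  have hp0 : (p : K) ≠ 0 := by exact_mod_cast hp.ne_zero
  have hp0' : (p : ℤ) ≠ 0 := by exact_mod_cast hp.ne_zero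
  have h4 := hθ.eq_zero
  push_cast at h4
  refine isPIntegralBasis_of_mulTable hp
    (hθ.linearIndependent_of_triangular hp0' (pow_ne_zero 2 hp0') 0 0 0 0 0 0
      (by simp) (by push_cast; field_simp; ring) (by push_cast; field_simp; ring)) hθ.finrank_eq
    (t := { t11 := ![0, 0, p, 0]
            t12 := ![0, 0, 0, p]
            t13 := ![-p * c, -b, -p * a, 0]
            t22 := ![-p * c, -b, -p * a, 0]
            t23 := ![0, -c, -b, -p * a]
            t33 := ![p * a * c, a * b, p * a ^ 2 - c, -b] })
    ?_ {0, 3} [![0, 0, 1, 0]] ?_ ?_ ?_ ?_ ?_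
  · constructor <;> simp [evalCoord] <;> field_simp
    · linear_combination h4
    · linear_combination h4
    · linear_combination θ * h4
    · linear_combination (θ ^ 2 - p ^ 2 * a) * h4
  · intro x y hy
    simp [MulTable.mul] at hy ⊢
    simp [hy]
  · intro x hx
    simp [MulTable.mul] at hx ⊢
    obtain ⟨h0, h3⟩ := hx
    refine ⟨h0, ?_⟩
    simpa [h0, hb'] using h3
  · simp
  · simp [MulTable.mul, forall_fin_four]
  · intro l hl he
    simp [MulTable.mul, forall_fin_four] at hl he ⊢
    obtain ⟨k, ⟨hk0, hk1, hk2, hk3⟩, k0, k3⟩ := he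
    have l0 := (ZMod.intCast_zmod_eq_zero_iff_dvd _ _).2 hl.1
    have l3 := (ZMod.intCast_zmod_eq_zero_iff_dvd _ _).2 hl.2
    have c1 := congrArg (Int.cast : ℤ → ZMod p) hk1
    push_cast at c1
    rw [CharP.cast_eq_zero] at c1
    have l2 : (l 2 : ZMod p) = 0 := by
      have : (b : ZMod p) * l 2 = 0 := by linear_combination -c1 - c * l3
      simpa [hb'] using this
    have l1' := ZMod.eq_zero_of_mul_eq hp (x := l 1 - a * l 3) (y := k 3)
      (by linear_combination hk3) k3
    push_cast at l1'
    refine ⟨l0, ?_, l2, l3⟩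
    linear_combination l1' + a * l3

end QuadrupleRootDirect

/-! ### Taylor coefficients, residual coefficients and separability of quadratics -/

section Polygon

lemma taylor_quartic (a b c s : ℤ) : taylor s (quartic a b c) =
    C 1 * X ^ 4 + C (4 * s) * X ^ 3 + C (6 * s ^ 2 + a) * X ^ 2 + C (4 * s ^ 3 + 2 * a * s + b) * X +
      C (s ^ 4 + a * s ^ 2 + b * s + c) := by
  simp only [taylor_apply, quartic, mul_comp, pow_comp, X_comp, C_comp, map_add, map_mul,
    map_pow, map_ofNat, map_one]
  ring

lemma quartic_eval (a b c s : ℤ) : (quartic a b c).eval s = s ^ 4 + a * s ^ 2 + b * s + c := by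
  simp [quartic]

lemma quartic_derivative_eval (a b c s : ℤ) :
    (derivative (quartic a b c)).eval s = 4 * s ^ 3 + 2 * a * s + b := by
  simp [quartic]
  ring

lemma devCoeff_quartic_zero (a b c s : ℤ) :
    devCoeff (quartic a b c) s 0 = s ^ 4 + a * s ^ 2 + b * s + c := by
  rw [devCoeff, taylor_quartic]
  simp only [coeff_add, coeff_C_mul, coeff_X_pow, coeff_X, coeff_C]
  norm_num

lemma devCoeff_quartic_one (a b c s : ℤ) :
    devCoeff (quartic a b c) s 1 = 4 * s ^ 3 + 2 * a * s + b := by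
  rw [devCoeff, taylor_quartic]
  simp only [coeff_add, coeff_C_mul, coeff_X_pow, coeff_X, coeff_C]
  norm_num

lemma devCoeff_quartic_two (a b c s : ℤ) : devCoeff (quartic a b c) s 2 = 6 * s ^ 2 + a := by
  rw [devCoeff, taylor_quartic]
  simp only [coeff_add, coeff_C_mul, coeff_X_pow, coeff_X, coeff_C]
  norm_num

lemma devCoeff_quartic_three (a b c s : ℤ) : devCoeff (quartic a b c) s 3 = 4 * s := by
  rw [devCoeff, taylor_quartic]
  simp only [coeff_add, coeff_C_mul, coeff_X_pow, coeff_X, coeff_C]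
  norm_num

lemma devCoeff_quartic_four (a b c s : ℤ) : devCoeff (quartic a b c) s 4 = 1 := by
  rw [devCoeff, taylor_quartic]
  simp only [coeff_add, coeff_C_mul, coeff_X_pow, coeff_X, coeff_C]
  norm_num

/-- If pᵐ is the power prescribed by the line at abscissa k, the point lies above the line exactly
when p ∣ H; in both cases H modulo p is the residual coefficient. -/
lemma residualCoeff_eq {p : ℕ} (hp : p.Prime) {f : ℤ[X]} {s : ℤ} {i h e k m : ℕ} {H : ℤ}
    (he : 0 < e) (hk : devCoeff f s k = (p : ℤ) ^ m * H)
    (hL : ((e * m + h * k : ℕ) : ℕ∞) = e * devVal p f s i + (h * i : ℕ)) :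
    residualCoeff p f s i h e k = H := by
  unfold residualCoeff
  rw [← hL]
  by_cases hH : (p : ℤ) ∣ H
  · have h1 : ((m + 1 : ℕ) : ℕ∞) ≤ devVal p f s k := by
      refine le_vp_iff.2 ?_
      rw [hk, pow_succ]
      exact mul_dvd_mul_left _ hH
    have h2 : ((e * (m + 1) + h * k : ℕ) : ℕ∞) ≤ e * devVal p f s k + (h * k : ℕ) := by
      push_cast at h1 ⊢
      gcongr
    have h3 : ((e * m + h * k : ℕ) : ℕ∞) < (e * (m + 1) + h * k : ℕ) := by
      exact_mod_cast (by nlinarith : e * m + h * k < e * (m + 1) + h * k)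
    rw [if_neg (h3.trans_le h2).ne', (ZMod.intCast_zmod_eq_zero_iff_dvd _ _).2 hH]
  · have h1 : devVal p f s k = m := (vp_eq_iff hp).2 ⟨H, hk, hH⟩
    rw [h1, if_pos (by push_cast; rfl), hk]
    simp only [ENat.toNat_natCast]
    rw [Int.mul_ediv_cancel_left _ (pow_ne_zero _ (by exact_mod_cast hp.ne_zero))]

/-- The side drops by h(j − i)/e, an integer, and h is prime to e. -/
lemma IsPrincipalSide.eq_add_mul {p : ℕ} {f : ℤ[X]} {s : ℤ} {i j h e : ℕ}
    (hs : IsPrincipalSide p f s i j h e) : ∃ d, j = i + d * e := by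
  obtain ⟨u, hu⟩ := ENat.ne_top_iff_exists.1 hs.finite_left
  obtain ⟨v, hv⟩ := ENat.ne_top_iff_exists.1 hs.finite_right
  have h1 := hs.on_line
  rw [← hu, ← hv] at h1
  have h2 : e * v + h * j = e * u + h * i := by exact_mod_cast h1
  have hlt := hs.lt
  obtain ⟨r, rfl⟩ := Nat.exists_eq_add_of_lt hlt
  have h3 : e * v + h * (r + 1) = e * u := by linarith
  have h4 : e ∣ h * (r + 1) := (Nat.dvd_add_right (Dvd.intro v rfl)).1 ⟨u, h3⟩
  obtain ⟨d, hd⟩ := hs.coprime.symm.dvd_of_dvd_mul_left h4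
  exact ⟨d, by rw [mul_comm d, ← hd]; ring⟩

/-- For a quadratic q the identity q'² − 4r₂q = discriminant is a Bézout relation; it includes the
linear case r₂ = 0. -/
lemma separable_of_discrim_ne_zero {F : Type*} [Field F] {r₀ r₁ r₂ : F}
    (h : r₁ ^ 2 - 4 * r₀ * r₂ ≠ 0) : (C r₀ + C r₁ * X + C r₂ * X ^ 2).Separable := by
  refine ⟨C (-4 * r₂ / (r₁ ^ 2 - 4 * r₀ * r₂)),
    C (r₁ ^ 2 - 4 * r₀ * r₂)⁻¹ * (C r₁ + 2 * C r₂ * X), ?_⟩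
  have hC : C (r₁ ^ 2 - 4 * r₀ * r₂)⁻¹ * (C r₁ ^ 2 - 4 * C r₀ * C r₂) = 1 := by
    rw [← C_1, ← inv_mul_cancel₀ h]
    simp only [map_mul, map_sub, map_pow, map_ofNat]
  simp only [derivative_add, derivative_C, derivative_C_mul, derivative_X, derivative_X_pow,
    div_eq_mul_inv, map_mul, map_neg, map_ofNat]
  simp only [Nat.cast_ofNat, map_ofNat]
  linear_combination hC

/-- The same identity now says that q divides q'², so coprimality with q' would make q a unit. -/
lemma not_separable_of_discrim_eq_zero {F : Type*} [Field F] {r₀ r₁ r₂ : F}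
    (h : r₁ ^ 2 - 4 * r₀ * r₂ = 0) (h2 : r₂ ≠ 0) :
    ¬ (C r₀ + C r₁ * X + C r₂ * X ^ 2).Separable := by
  intro hs
  have hcop := hs.pow_right (n := 2)
  have hd : C r₀ + C r₁ * X + C r₂ * X ^ 2 ∣
      (derivative (C r₀ + C r₁ * X + C r₂ * X ^ 2)) ^ 2 := by
    refine ⟨C (4 * r₂), ?_⟩
    have hC : C r₁ ^ 2 - 4 * C r₀ * C r₂ = 0 := by
      rw [← C_0, ← h]
      simp only [map_mul, map_sub, map_pow, map_ofNat]
    simp only [derivative_add, derivative_C, derivative_C_mul, derivative_X, derivative_X_pow,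
      map_mul, map_ofNat]
    simp only [Nat.cast_ofNat, map_ofNat]
    linear_combination hC
  have hu := hcop.isUnit_of_dvd' dvd_rfl hd
  have hdeg : (C r₀ + C r₁ * X + C r₂ * X ^ 2).natDegree = 2 := by compute_degree!
  have := natDegree_eq_zero_of_isUnit hu
  omega

end Polygon

/-! ### Regular shifts in terms of f(s) and f'(s) -/

section Regular

/-- `s` is a shift for which the principal polygon is a single side without ramification, or
two sides with integral slopes. -/
def UnramifiedShift (p ε : ℕ) (a b c s : ℤ) (m : ℕ) : Prop :=
  ∃ H₀ H₁ g₂ : ℤ, s ^ 4 + a * s ^ 2 + b * s + c = p ^ (2 * m + ε) * H₀ ∧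
    4 * s ^ 3 + 2 * a * s + b = p ^ (m + ε) * H₁ ∧ 6 * s ^ 2 + a = p ^ ε * g₂ ∧
    ¬ (p : ℤ) ∣ H₁ ^ 2 - 4 * H₀ * g₂

/-- `s` is a shift for which the principal polygon is a single side with ramification. -/
def RamifiedShift (p ε : ℕ) (a b c s : ℤ) (m : ℕ) : Prop :=
  ∃ H₀ H₁ : ℤ, s ^ 4 + a * s ^ 2 + b * s + c = p ^ (2 * m + ε + 1) * H₀ ∧
    4 * s ^ 3 + 2 * a * s + b = p ^ (m + ε + 1) * H₁ ∧ ¬ (p : ℤ) ∣ H₀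

/-- The dominant quadratic coefficient of the quartic at `s` has valuation `ε ≤ 1`. -/
structure DominantAt (p ε : ℕ) (a s : ℤ) : Prop where
  le_one : ε ≤ 1
  two : ∃ g₂, 6 * s ^ 2 + a = p ^ ε * g₂ ∧ ¬ (p : ℤ) ∣ g₂
  three : (p : ℤ) ^ ε ∣ 4 * s

variable {p ε : ℕ} {a b c s : ℤ}

lemma residualPoly_zero_two (p : ℕ) (f : ℤ[X]) (s : ℤ) (h : ℕ) :
    residualPoly p f s 0 2 h 1 = C (residualCoeff p f s 0 h 1 0) +
      C (residualCoeff p f s 0 h 1 1) * X + C (residualCoeff p f s 0 h 1 2) * X ^ 2 := by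
  simp [residualPoly, Finset.sum_range_succ]

lemma DominantAt.devVal_two (hp : p.Prime) (hd : DominantAt p ε a s) (b c : ℤ) :
    devVal p (quartic a b c) s 2 = ε := by
  obtain ⟨g₂, h2, h2'⟩ := hd.two
  exact (vp_eq_iff hp).2 ⟨g₂, by rw [devCoeff_quartic_two, h2], h2'⟩

lemma DominantAt.le_devVal_three (hd : DominantAt p ε a s) (b c : ℤ) :
    (ε : ℕ∞) ≤ devVal p (quartic a b c) s 3 :=
  le_vp_iff.2 (by rw [devCoeff_quartic_three]; exact hd.three)

lemma devVal_four (hp : p.Prime) (a b c s : ℤ) : devVal p (quartic a b c) s 4 = 0 := by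
  have := (vp_eq_iff hp (n := 0) (x := devCoeff (quartic a b c) s 4)).2
    ⟨1, by simp [devCoeff_quartic_four], by
      intro h; exact hp.one_lt.ne' (by exact_mod_cast Int.eq_one_of_dvd_one (by positivity) h)⟩
  exact_mod_cast this

/-- Since m ≥ 1 and ε ≤ 1, the points at abscissas 3 and 4 lie strictly above the line of slope −m
through (2, ε). -/
lemma DominantAt.isPrincipalSide_zero_two (hp : p.Prime) (hd : DominantAt p ε a s) {m : ℕ}
    (hm : 1 ≤ m) {H₀ H₁ : ℤ} (h0 : s ^ 4 + a * s ^ 2 + b * s + c = p ^ (2 * m + ε) * H₀)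
    (h0' : ¬ (p : ℤ) ∣ H₀) (h1 : 4 * s ^ 3 + 2 * a * s + b = p ^ (m + ε) * H₁) :
    IsPrincipalSide p (quartic a b c) s 0 2 m 1 := by
  have v0 : devVal p (quartic a b c) s 0 = (2 * m + ε : ℕ) :=
    (vp_eq_iff hp).2 ⟨H₀, by rw [devCoeff_quartic_zero, h0], h0'⟩
  have v1 : ((m + ε : ℕ) : ℕ∞) ≤ devVal p (quartic a b c) s 1 :=
    le_vp_iff.2 ⟨H₁, by rw [devCoeff_quartic_one, h1]⟩
  have v2 := hd.devVal_two hp b c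
  have v3 := hd.le_devVal_three b c
  have hε := hd.le_one
  have key : ∀ k : ℕ, ∀ n : ℕ, (n : ℕ∞) ≤ devVal p (quartic a b c) s k → 2 * m + ε < n + m * k →
      ((2 * m + ε : ℕ) : ℕ∞) < devVal p (quartic a b c) s k + (m * k : ℕ) := by
    intro k n hn hlt
    calc ((2 * m + ε : ℕ) : ℕ∞) < ((n + m * k : ℕ) : ℕ∞) := by exact_mod_cast hlt
      _ = (n : ℕ∞) + (m * k : ℕ) := by push_cast; rfl
      _ ≤ _ := by gcongr
  have above : ∀ k : ℕ, 2 < k →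
      ((2 * m + ε : ℕ) : ℕ∞) < devVal p (quartic a b c) s k + (m * k : ℕ) := by
    intro k hk
    obtain rfl | hk : k = 3 ∨ 4 ≤ k := by omega
    · exact key 3 ε v3 (by omega)
    · exact key k 0 (by simp) (by nlinarith)
  refine ⟨by norm_num, by omega, by norm_num, by simp, by rw [v0]; exact ENat.natCast_ne_top _,
    by rw [v2]; exact ENat.natCast_ne_top _, ?_, fun k => ?_, fun k hk => ?_⟩
  · rw [v0, v2]
    push_cast
    ring
  · rw [v0]
    simp only [Nat.cast_one, one_mul, mul_zero, Nat.cast_zero, add_zero]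
    obtain rfl | rfl | rfl | hk : k = 0 ∨ k = 1 ∨ k = 2 ∨ 2 < k := by omega
    · rw [v0]; simp
    · calc ((2 * m + ε : ℕ) : ℕ∞) = (m + ε : ℕ) + (m * 1 : ℕ) := by push_cast; ring
        _ ≤ _ := by gcongr
    · rw [v2]; push_cast; apply le_of_eq; ring
    · exact (above k hk).le
  · rw [v0]
    simp only [Nat.cast_one, one_mul, mul_zero, Nat.cast_zero, add_zero]
    exact above k (by omega)

lemma DominantAt.residualPoly_eq (hp : p.Prime) (hd : DominantAt p ε a s) {m : ℕ} {H₀ H₁ g₂ : ℤ}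
    (hs : IsPrincipalSide p (quartic a b c) s 0 2 m 1)
    (h0 : s ^ 4 + a * s ^ 2 + b * s + c = p ^ (2 * m + ε) * H₀)
    (h1 : 4 * s ^ 3 + 2 * a * s + b = p ^ (m + ε) * H₁) (h2 : 6 * s ^ 2 + a = p ^ ε * g₂) :
    residualPoly p (quartic a b c) s 0 2 m 1 =
      C (H₀ : ZMod p) + C (H₁ : ZMod p) * X + C (g₂ : ZMod p) * X ^ 2 := by
  have hL : ((2 * m + ε : ℕ) : ℕ∞) = (1 : ℕ) * devVal p (quartic a b c) s 0 + (m * 0 : ℕ) := by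
    rw [← hs.on_line, hd.devVal_two hp]
    push_cast
    ring
  rw [residualPoly_zero_two,
    residualCoeff_eq hp (m := 2 * m + ε) (H := H₀) one_pos
      (by rw [devCoeff_quartic_zero, h0]) (by rw [← hL]; push_cast; ring),
    residualCoeff_eq hp (m := m + ε) (H := H₁) one_pos
      (by rw [devCoeff_quartic_one, h1]) (by rw [← hL]; push_cast; ring),
    residualCoeff_eq hp (m := ε) (H := g₂) one_pos
      (by rw [devCoeff_quartic_two, h2]) (by rw [← hL]; push_cast; ring)]

lemma dvd_discrim_iff {H₀ H₁ g₂ : ℤ} : (p : ℤ) ∣ H₁ ^ 2 - 4 * H₀ * g₂ ↔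
    (H₁ : ZMod p) ^ 2 - 4 * (H₀ : ZMod p) * g₂ = 0 := by
  rw [← ZMod.intCast_zmod_eq_zero_iff_dvd]
  push_cast
  rfl

/-- A side of degree at least two is the side of integral slope over `[0, 2]`. -/
lemma DominantAt.isPrincipalSide_cases (hp : p.Prime) (hd : DominantAt p ε a s)
    (h0 : (p : ℤ) ^ (2 + ε) ∣ s ^ 4 + a * s ^ 2 + b * s + c) {i j h e : ℕ}
    (hs : IsPrincipalSide p (quartic a b c) s i j h e) :
    j = i + e ∨ i = 0 ∧ j = 2 ∧ e = 1 := by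
  obtain ⟨d, hd'⟩ := hs.eq_add_mul
  have hlt := hs.lt
  have he := hs.e_pos
  have hh := hs.h_pos
  have hε := hd.le_one
  obtain ⟨u, hu⟩ := ENat.ne_top_iff_exists.1 hs.finite_left
  obtain ⟨v, hv⟩ := ENat.ne_top_iff_exists.1 hs.finite_right
  have h1 := hs.on_line
  have h2 := hs.above 2
  have h4 := hs.above 4
  rw [hd.devVal_two hp, ← hu] at h2
  rw [devVal_four hp, ← hu] at h4
  rw [← hu, ← hv] at h1
  have h1' : e * v + h * j = e * u + h * i := by exact_mod_cast h1
  have h2' : e * u + h * i ≤ e * ε + h * 2 := by exact_mod_cast h2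
  have h4' : e * u + h * i ≤ h * 4 := by
    rw [mul_zero, zero_add] at h4
    exact_mod_cast h4
  have hj4 : j ≤ 4 := by
    by_contra! hj
    nlinarith [Nat.zero_le (e * v)]
  have hd0 : d ≠ 0 := by rintro rfl; omega
  obtain rfl | hd2 : d = 1 ∨ 2 ≤ d := by omega
  · exact Or.inl (by omega)
  refine Or.inr ?_
  have h3 : j = 3 → ε ≤ v := by
    rintro rfl
    have := hd.le_devVal_three b c
    rw [← hv] at this
    exact_mod_cast this
  have he2 : e = 1 ∨ e = 2 := by
    have : 2 * e ≤ d * e := Nat.mul_le_mul_right _ hd2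
    omega
  -- With the points at abscissas 2, 3 and 4, this bound leaves finitely many cases for a side of
  -- degree at least 2, all contradictory except the side over [0, 2] with e = 1.
  have h00 : i = 0 → 2 + ε ≤ u := by
    rintro rfl
    have : ((2 + ε : ℕ) : ℕ∞) ≤ devVal p (quartic a b c) s 0 :=
      le_vp_iff.2 (by rw [devCoeff_quartic_zero]; exact h0)
    rw [← hu] at this
    exact_mod_cast this
  rcases he2 with rfl | rfl
  · interval_cases ε <;> interval_cases j <;> interval_cases i <;> omega
  · obtain rfl : d = 2 := by omega
    obtain rfl : i = 0 := by omega
    obtain rfl : j = 4 := by omega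
    omega

/-- Sides of degree 1 have linear, hence separable, residual polynomials. A side over [0, 2] of
integral slope −h' compares with the given shift: in the unramified case h' = m and the residual
discriminant is nonzero, in the ramified case no such side exists. -/
lemma DominantAt.isRegularInt_of (hp : p.Prime) (hd : DominantAt p ε a s) {m : ℕ} (hm : 1 ≤ m)
    (h : UnramifiedShift p ε a b c s m ∨ RamifiedShift p ε a b c s m) :
    IsRegularInt p (quartic a b c) s := by
  have := Fact.mk hp
  have hpZ := Nat.prime_iff_prime_int.1 hp
  intro i j h' e hs
  have h0 : (p : ℤ) ^ (2 + ε) ∣ s ^ 4 + a * s ^ 2 + b * s + c := by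
    rcases h with ⟨H₀, H₁, g₂, h0, -⟩ | ⟨H₀, H₁, h0, -⟩
    · exact (pow_dvd_pow _ (by omega)).trans ⟨_, h0⟩
    · exact (pow_dvd_pow _ (by omega)).trans ⟨_, h0⟩
  have coeff_ne : ∀ k, devVal p (quartic a b c) s k ≠ ⊤ →
      (e : ℕ∞) * devVal p (quartic a b c) s k + (h' * k : ℕ) =
        e * devVal p (quartic a b c) s i + (h' * i : ℕ) →
      residualCoeff p (quartic a b c) s i h' e k ≠ 0 := by
    intro k hk hL
    obtain ⟨u, hu⟩ := ENat.ne_top_iff_exists.1 hk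
    obtain ⟨H, hH, hH'⟩ := (vp_eq_iff hp).1 hu.symm
    rw [residualCoeff_eq hp hs.e_pos hH (by rw [← hL, ← hu]; push_cast; rfl)]
    exact intCast_ne_zero_of_not_dvd hH'
  rcases hd.isPrincipalSide_cases hp h0 hs with rfl | ⟨rfl, rfl, rfl⟩
  · have := separable_of_discrim_ne_zero (r₀ := residualCoeff p (quartic a b c) s i h' e i)
      (r₁ := residualCoeff p (quartic a b c) s i h' e (i + e)) (r₂ := 0) (by
        rw [mul_zero, sub_zero]
        exact pow_ne_zero 2 (coeff_ne _ hs.finite_right hs.on_line))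
    rw [residualPoly, Nat.add_sub_cancel_left, Nat.div_self hs.e_pos]
    simpa [Finset.sum_range_succ] using this
  · obtain ⟨u, hu⟩ := ENat.ne_top_iff_exists.1 hs.finite_left
    have hline := hs.on_line
    have habove := hs.above 1
    rw [hd.devVal_two hp, ← hu] at hline
    rw [← hu] at habove
    obtain rfl : u = 2 * h' + ε := by
      have : 1 * ε + h' * 2 = 1 * u + h' * 0 := by exact_mod_cast hline
      omega
    obtain ⟨G₀, hG₀, hG₀'⟩ := (vp_eq_iff hp).1 hu.symm
    rw [devCoeff_quartic_zero] at hG₀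
    have hu1 : ((h' + ε : ℕ) : ℕ∞) ≤ devVal p (quartic a b c) s 1 := by
      by_contra! hcon
      obtain ⟨w, hw⟩ := ENat.ne_top_iff_exists.1 hcon.ne_top
      rw [← hw] at hcon habove
      have hcon' : w < h' + ε := by exact_mod_cast hcon
      have : 1 * (2 * h' + ε) + h' * 0 ≤ 1 * w + h' * 1 := by exact_mod_cast habove
      omega
    obtain ⟨G₁, hG₁⟩ := le_vp_iff.1 hu1
    rw [devCoeff_quartic_one] at hG₁
    obtain ⟨g₂, hg₂, hg₂'⟩ := hd.two
    rw [hd.residualPoly_eq hp hs hG₀ hG₁ hg₂]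
    refine separable_of_discrim_ne_zero ?_
    rw [Ne, ← dvd_discrim_iff]
    have hpow : ∀ n, ((p : ℤ) ^ n) ≠ 0 := fun n => pow_ne_zero _ hpZ.ne_zero
    have cancel : ∀ {n k l : ℕ} {x y : ℤ}, (p : ℤ) ^ n * x = p ^ k * y → n = k + l →
        y = p ^ l * x := by
      rintro n k l x y hxy rfl
      refine mul_left_cancel₀ (hpow k) ?_
      rw [← hxy]
      ring
    rcases h with ⟨H₀, H₁, g₂', h0, h1, h2, hdisc⟩ | ⟨H₀, H₁, h0, h1, hH₀⟩
    · obtain rfl : g₂' = g₂ := mul_left_cancel₀ (hpow ε) (h2.symm.trans hg₂)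
      -- If h' < m, too high a power of p divides f(s); if h' > m, p divides both H₀ and H₁, hence
      -- the discriminant.
      obtain hlt | rfl | hlt := lt_trichotomy h' m
      · exfalso
        obtain ⟨l, rfl⟩ := Nat.exists_eq_add_of_lt hlt
        have := cancel (h0.symm.trans hG₀) (l := 2 * l + 1 + 1) (by ring)
        exact hG₀' (this ▸ Dvd.intro _ (by rw [pow_succ' (p : ℤ) (2 * l + 1), mul_assoc]))
      · have e0 := cancel (h0.symm.trans hG₀) (l := 0) (by ring)
        have e1 := cancel (h1.symm.trans hG₁) (l := 0) (by ring)
        simp only [pow_zero, one_mul] at e0 e1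
        rwa [e0, e1]
      · exfalso
        obtain ⟨l, rfl⟩ := Nat.exists_eq_add_of_lt hlt
        have e0 := cancel (hG₀.symm.trans h0) (l := 2 * l + 1 + 1) (by ring)
        have e1 := cancel (hG₁.symm.trans h1) (l := l + 1) (by ring)
        refine hdisc ?_
        rw [e0, e1]
        exact ⟨p ^ (2 * l + 1) * G₁ ^ 2 - 4 * p ^ (2 * l + 1) * G₀ * g₂', by ring⟩
    · exfalso
      obtain hlt | hlt := le_or_gt h' m
      · obtain ⟨l, rfl⟩ := Nat.exists_eq_add_of_le hlt
        have := cancel (h0.symm.trans hG₀) (l := 2 * l + 1) (by ring)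
        exact hG₀' (this ▸ Dvd.intro _ (by rw [pow_succ' (p : ℤ) (2 * l), mul_assoc]))
      · obtain ⟨l, rfl⟩ := Nat.exists_eq_add_of_lt hlt
        have := cancel (hG₀.symm.trans h0) (l := 2 * l + 1) (by ring)
        exact hH₀ (this ▸ Dvd.intro _ (by rw [pow_succ' (p : ℤ) (2 * l), mul_assoc]))

/-- Take the greatest m with p^(2m+ε) ∣ f(s) and p^(m+ε) ∣ f'(s); it exists because f(s) ≠ 0. If the
discriminant H₁² − 4H₀g₂ vanishes modulo p, then either p ∣ H₀, and then p ∣ H₁ and maximality gives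
the ramified type, or there is a side over [0, 2] with inseparable residual polynomial, against
regularity. -/
lemma DominantAt.exists_shift_of_isRegularInt (hp : p.Prime) (hd : DominantAt p ε a s)
    (hne : s ^ 4 + a * s ^ 2 + b * s + c ≠ 0)
    (h0 : (p : ℤ) ^ (2 + ε) ∣ s ^ 4 + a * s ^ 2 + b * s + c)
    (h1 : (p : ℤ) ^ (1 + ε) ∣ 4 * s ^ 3 + 2 * a * s + b)
    (hreg : IsRegularInt p (quartic a b c) s) :
    ∃ m, 1 ≤ m ∧ (UnramifiedShift p ε a b c s m ∨ RamifiedShift p ε a b c s m) := by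
  have := Fact.mk hp
  have hpZ := Nat.prime_iff_prime_int.1 hp
  let P : ℕ → Prop := fun m => (p : ℤ) ^ (2 * m + ε) ∣ s ^ 4 + a * s ^ 2 + b * s + c ∧
    (p : ℤ) ^ (m + ε) ∣ 4 * s ^ 3 + 2 * a * s + b
  obtain ⟨u, hu⟩ := ENat.ne_top_iff_exists.1 (fun h => hne ((vp_eq_top_iff hp).1 h))
  have hbound : ∀ m, P m → m ≤ u := by
    intro m hm
    have := le_vp_iff.2 hm.1
    rw [← hu] at this
    have : 2 * m + ε ≤ u := by exact_mod_cast this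
    omega
  classical
  have h1P : P 1 := ⟨h0, h1⟩
  have hmax := Nat.findGreatest_spec (hbound 1 h1P) h1P
  have hmax' : ¬ P (Nat.findGreatest P u + 1) := fun h =>
    absurd (Nat.le_findGreatest (hbound _ h) h) (by omega)
  have hm1 : 1 ≤ Nat.findGreatest P u := Nat.le_findGreatest (hbound 1 h1P) h1P
  generalize Nat.findGreatest P u = m at hmax hmax' hm1
  obtain ⟨⟨H₀, hH₀⟩, H₁, hH₁⟩ := hmax
  obtain ⟨g₂, hg₂, hg₂'⟩ := hd.two
  refine ⟨m, hm1, ?_⟩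
  by_cases hD : (p : ℤ) ∣ H₁ ^ 2 - 4 * H₀ * g₂
  swap
  · exact Or.inl ⟨H₀, H₁, g₂, hH₀, hH₁, hg₂, hD⟩
  refine Or.inr ?_
  by_cases hp0 : (p : ℤ) ∣ H₀
  · obtain ⟨G₀, rfl⟩ := hp0
    have hp1 : (p : ℤ) ∣ H₁ := by
      refine hpZ.dvd_of_dvd_pow (n := 2) ?_
      have := dvd_add hD (Dvd.intro (4 * G₀ * g₂) rfl)
      convert this using 1
      ring
    obtain ⟨G₁, rfl⟩ := hp1
    refine ⟨G₀, G₁, by rw [hH₀]; ring, by rw [hH₁]; ring, fun ⟨F₀, hF₀⟩ => hmax' ?_⟩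
    exact ⟨⟨F₀, by rw [hH₀, hF₀]; ring⟩, ⟨G₁, by rw [hH₁]; ring⟩⟩
  · exfalso
    have hs := hd.isPrincipalSide_zero_two hp hm1 hH₀ hp0 hH₁
    have hsep := hreg _ _ _ _ hs
    rw [hd.residualPoly_eq hp hs hH₀ hH₁ hg₂] at hsep
    exact not_separable_of_discrim_eq_zero (dvd_discrim_iff.1 hD)
      (intCast_ne_zero_of_not_dvd hg₂') hsep

end Regular

/-! ### The discriminant of the quartic -/

section Discriminant

lemma sylvester_two_three {R : Type*} [CommRing R] (r₀ r₁ r₂ d₀ d₁ d₂ d₃ : R) :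
    sylvester (C r₂ * X ^ 2 + C r₁ * X + C r₀) (C d₃ * X ^ 3 + C d₂ * X ^ 2 + C d₁ * X + C d₀) 2 3 =
      !![d₀, 0, r₀, 0, 0;
         d₁, d₀, r₁, r₀, 0;
         d₂, d₁, r₂, r₁, r₀;
         d₃, d₂, 0, r₂, r₁;
         0, d₃, 0, 0, r₂] := by
  ext i j
  fin_cases i <;> fin_cases j <;>
    simp [sylvester, Fin.addCases, coeff_X, coeff_C]

/-- Writing 4f = xf' + r with r quadratic replaces the resultant of f and f' by that of r and f', a
5 × 5 determinant. -/
lemma discr_quartic (a b c : ℤ) : (quartic a b c).discr =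
    16 * a ^ 4 * c - 4 * a ^ 3 * b ^ 2 - 128 * a ^ 2 * c ^ 2 + 144 * a * b ^ 2 * c - 27 * b ^ 4 +
      256 * c ^ 3 := by
  have hdeg := quartic_natDegree a b c
  have h1 : resultant (quartic a b c) (derivative (quartic a b c)) 4 3 = (quartic a b c).discr := by
    have := resultant_deriv (f := quartic a b c)
      (natDegree_pos_iff_degree_pos.1 (by rw [hdeg]; norm_num))
    rw [hdeg, (quartic_monic a b c).leadingCoeff] at this
    simpa using this
  set r : ℤ[X] := C (2 * a) * X ^ 2 + C (3 * b) * X + C (4 * c) with hr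
  have hd : derivative (quartic a b c) = C 4 * X ^ 3 + C 0 * X ^ 2 + C (2 * a) * X + C b := by
    simp only [quartic, derivative_add, derivative_mul, derivative_C, derivative_X_pow,
      derivative_X, map_mul, map_zero]
    simp
    ring
  have h4 : C 4 * quartic a b c = r + derivative (quartic a b c) * X := by
    rw [hd, hr]
    simp only [quartic, map_mul, map_zero, map_ofNat]
    ring
  have h2 := resultant_C_mul_left (quartic a b c) (derivative (quartic a b c)) 4 3 4
  rw [h4, resultant_add_mul_left _ _ _ _ _ (by rw [natDegree_X])
    (by rw [hd]; compute_degree), resultant_add_left_deg r _ 2 3 2 (by rw [hr]; compute_degree),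
    h1, hd, hr, resultant, sylvester_two_three] at h2
  simp only [coeff_add, coeff_C_mul, coeff_X_pow, coeff_X, coeff_C] at h2
  simp [Matrix.det_succ_row_zero (n := 4), Matrix.det_succ_row_zero (n := 3), Fin.succAbove,
    Matrix.det_fin_three, Finset.sum_fin_eq_sum_range, Finset.sum_range_succ] at h2
  linarith

end Discriminant

/-! ### The discriminant at a shift, and existence of regular shifts -/

section DiscriminantShift

/-- The translation invariant discriminant is grouped by f(s) and f'(s)², so that high powers of p
dividing both pass to it. -/
lemma discr_quartic_shift {a b c s g₀ g₁ : ℤ} (h0 : s ^ 4 + a * s ^ 2 + b * s + c = g₀)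
    (h1 : 4 * s ^ 3 + 2 * a * s + b = g₁) {g₂ g₃ : ℤ} (h2 : 6 * s ^ 2 + a = g₂) (h3 : 4 * s = g₃) :
    (quartic a b c).discr = g₀ * (16 * g₂ ^ 4 - 4 * g₃ ^ 2 * g₂ ^ 3 +
        g₁ * (18 * g₃ ^ 3 * g₂ - 80 * g₃ * g₂ ^ 2) +
        g₀ * (-27 * g₃ ^ 4 + 144 * g₃ ^ 2 * g₂ - 128 * g₂ ^ 2 - 192 * g₃ * g₁ + 256 * g₀)) +
      g₁ ^ 2 * (g₃ ^ 2 * g₂ ^ 2 - 4 * g₂ ^ 3 - 4 * g₃ ^ 3 * g₁ + 18 * g₃ * g₂ * g₁ - 27 * g₁ ^ 2 +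
        g₀ * (-6 * g₃ ^ 2 + 144 * g₂)) := by
  subst h0 h1 h2 h3
  rw [discr_quartic]
  ring

lemma discr_quartic_ne_zero {a b c : ℤ} (hf : Irreducible (quartic a b c)) :
    (quartic a b c).discr ≠ 0 := by
  intro h0
  have hdeg := quartic_natDegree a b c
  have hmon := quartic_monic a b c
  have hres : resultant (quartic a b c) (derivative (quartic a b c)) 4 3 = 0 := by
    have := resultant_deriv (f := quartic a b c)
      (natDegree_pos_iff_degree_pos.1 (by rw [hdeg]; norm_num))
    rw [hdeg, h0, mul_zero] at this
    exact this
  have hirr := (hmon.irreducible_iff_irreducible_map_fraction_map (K := ℚ)).1 hf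
  have hsep := hirr.separable
  have hd : ((quartic a b c).map (algebraMap ℤ ℚ)).natDegree = 4 := by
    rw [hmon.natDegree_map, hdeg]
  have hd' : (derivative ((quartic a b c).map (algebraMap ℤ ℚ))).natDegree = 3 := by
    rw [natDegree_derivative, hd]
  have hu := (isUnit_resultant_iff_isCoprime (hmon.map (algebraMap ℤ ℚ))).2 hsep
  rw [hd, hd', derivative_map, resultant_map_map, hres, map_zero] at hu
  exact not_isUnit_zero hu

lemma eq_zero_of_forall_pow_dvd {p : ℕ} (hp : p.Prime) {x : ℤ}
    (h : ∀ m : ℕ, 1 ≤ m → (p : ℤ) ^ (2 * m) ∣ x) : x = 0 := by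
  by_contra hx
  obtain ⟨u, hu⟩ := ENat.ne_top_iff_exists.1 (fun h => hx ((vp_eq_top_iff hp).1 h))
  have := le_vp_iff.2 (h (u + 1) (by omega))
  rw [← hu] at this
  have : 2 * (u + 1) ≤ u := by exact_mod_cast this
  omega

/-- A quadratic of discriminant 0 has the double root −H₁/(2g₂) if p is odd. If p = 2, then H₁ and
the derivative vanish, and t = H₀ is a root because g₂ = 1. -/
lemma exists_double_root_mod {p : ℕ} (hp : p.Prime) {H₀ H₁ g₂ : ℤ}
    (h : (p : ℤ) ∣ H₁ ^ 2 - 4 * H₀ * g₂) (h2 : ¬ (p : ℤ) ∣ g₂) :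
    ∃ t : ℤ, (p : ℤ) ∣ H₀ + H₁ * t + g₂ * t ^ 2 ∧ (p : ℤ) ∣ H₁ + 2 * g₂ * t := by
  have key : ∀ h₀ h₁ q : ZMod 2, h₁ ^ 2 - 4 * h₀ * q = 0 → q ≠ 0 →
      h₀ + h₁ * h₀ + q * h₀ ^ 2 = 0 ∧ h₁ + 2 * q * h₀ = 0 := by decide
  have := Fact.mk hp
  rw [dvd_discrim_iff] at h
  have h2' := intCast_ne_zero_of_not_dvd h2
  obtain rfl | hp2 := hp.eq_two_or_odd'
  · obtain ⟨e0, e1⟩ := key _ _ _ h h2'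
    refine ⟨H₀, ?_, ?_⟩ <;> rw [← ZMod.intCast_zmod_eq_zero_iff_dvd] <;> push_cast <;> assumption
  · have h2p : (2 : ZMod p) ≠ 0 := by
      have := hp.not_dvd_four (by
        have := hp.two_le
        have : p ≠ 2 := by rintro rfl; exact absurd hp2 (by decide)
        omega)
      intro h'
      exact intCast_ne_zero_of_not_dvd this (by push_cast; linear_combination 2 * h')
    obtain ⟨t, ht⟩ := ZMod.intCast_surjective (n := p) (-(H₁ : ZMod p) / (2 * (g₂ : ZMod p)))
    rw [eq_div_iff (mul_ne_zero h2p h2')] at ht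
    refine ⟨t, ?_, ?_⟩ <;> rw [← ZMod.intCast_zmod_eq_zero_iff_dvd] <;> push_cast
    · refine (mul_eq_zero.1 ?_).resolve_left (mul_ne_zero (mul_ne_zero h2p h2p) h2')
      linear_combination (2 * g₂ * t + H₁) * ht - h
    · linear_combination ht

/-- A regular shift is found by successive translations that increase the valuations. -/
theorem exists_shift {p ε : ℕ} (hp : p.Prime) {a b c s₁ : ℤ}
    (hdom : ∀ s, s ≡ s₁ [ZMOD p] → DominantAt p ε a s)
    (h0 : (p : ℤ) ^ (2 + ε) ∣ s₁ ^ 4 + a * s₁ ^ 2 + b * s₁ + c)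
    (h1 : (p : ℤ) ^ (1 + ε) ∣ 4 * s₁ ^ 3 + 2 * a * s₁ + b)
    (hdisc : (quartic a b c).discr ≠ 0) :
    ∃ s, s ≡ s₁ [ZMOD p] ∧ ∃ m, 1 ≤ m ∧
      (UnramifiedShift p ε a b c s m ∨ RamifiedShift p ε a b c s m) := by
  by_contra! hno
  have key : ∀ m : ℕ, 1 ≤ m → ∃ s, s ≡ s₁ [ZMOD p] ∧
      (p : ℤ) ^ (2 * m + ε) ∣ s ^ 4 + a * s ^ 2 + b * s + c ∧
      (p : ℤ) ^ (m + ε) ∣ 4 * s ^ 3 + 2 * a * s + b := by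
    intro m hm
    induction m, hm using Nat.le_induction with
    | base => exact ⟨s₁, Int.ModEq.refl _, h0, h1⟩
    | succ m hm ih =>
      obtain ⟨s, hs, ⟨H₀, hH₀⟩, H₁, hH₁⟩ := ih
      obtain ⟨g₂, hg₂, hg₂'⟩ := (hdom s hs).two
      obtain ⟨g₃, hg₃⟩ := (hdom s hs).three
      by_cases hD : (p : ℤ) ∣ H₁ ^ 2 - 4 * H₀ * g₂
      swap
      · exact absurd ⟨H₀, H₁, g₂, hH₀, hH₁, hg₂, hD⟩ (hno s hs m hm).1
      obtain ⟨t, ⟨q₀, hq₀⟩, q₁, hq₁⟩ := exists_double_root_mod hp hD hg₂'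
      obtain ⟨n, rfl⟩ : ∃ n, m = n + 1 := ⟨m - 1, by omega⟩
      have hs' : s + p ^ (n + 1) * t ≡ s₁ [ZMOD p] := by
        refine Int.ModEq.trans ?_ hs
        exact (Int.modEq_iff_dvd.2 ⟨-(p ^ n * t), by ring⟩)
      have hε := (hdom s hs).le_one
      obtain ⟨δ, hδ⟩ : ∃ δ, δ + ε = 1 := ⟨1 - ε, by omega⟩
      have hpε : (p : ℤ) ^ δ * p ^ ε = p := by rw [← pow_add, hδ, pow_one]
      -- Taylor expansion at s: the part H₀ + H₁t + g₂t² gains a factor p by the choice of t. The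
      -- cubic and quartic terms are divisible too, by p^ε ∣ 4s and because 4(n + 1) ≥ 2(n + 1) + ε
      -- + 1.
      have e0 : (s + p ^ (n + 1) * t) ^ 4 + a * (s + p ^ (n + 1) * t) ^ 2 +
          b * (s + p ^ (n + 1) * t) + c = p ^ (2 * (n + 1) + ε + 1) *
            (q₀ + p ^ n * g₃ * t ^ 3 + p ^ (2 * n) * p ^ δ * t ^ 4) := by
        linear_combination hH₀ + p ^ (n + 1) * t * hH₁ + p ^ (2 * (n + 1)) * t ^ 2 * hg₂ +
          p ^ (3 * (n + 1)) * t ^ 3 * hg₃ + p ^ (2 * (n + 1) + ε) * hq₀ -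
          p ^ (4 * n + 3) * t ^ 4 * hpε
      have e1 : 4 * (s + p ^ (n + 1) * t) ^ 3 + 2 * a * (s + p ^ (n + 1) * t) + b =
          p ^ (n + 1 + ε + 1) *
            (q₁ + 3 * p ^ n * g₃ * t ^ 2 + 4 * p ^ (2 * n) * p ^ δ * t ^ 3) := by
        linear_combination hH₁ + 2 * p ^ (n + 1) * t * hg₂ +
          3 * p ^ (2 * (n + 1)) * t ^ 2 * hg₃ + p ^ (n + 1 + ε) * hq₁ -
          4 * p ^ (3 * n + 2) * t ^ 3 * hpε
      refine ⟨_, hs', ?_, ?_⟩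
      -- If this cofactor is not divisible by p, the new shift is of the ramified type.
      · by_cases hd : (p : ℤ) ∣ q₀ + p ^ n * g₃ * t ^ 3 + p ^ (2 * n) * p ^ δ * t ^ 4
        · obtain ⟨k, hk⟩ := hd
          exact ⟨k, by rw [e0, hk]; ring⟩
        · exact absurd ⟨_, _, e0, e1, hd⟩ (hno _ hs' (n + 1) hm).2
      · rw [e1, show n + 1 + ε + 1 = n + 1 + 1 + ε by ring]
        exact Dvd.intro _ rfl
  -- Arbitrarily good shifts make the discriminant divisible by all powers p²ᵐ, hence zero.
  refine hdisc (eq_zero_of_forall_pow_dvd hp fun m hm => ?_)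
  obtain ⟨s, -, h0, h1⟩ := key m hm
  rw [discr_quartic_shift rfl rfl rfl rfl]
  refine dvd_add (((pow_dvd_pow _ (by omega)).trans h0).mul_right _) (Dvd.dvd.mul_right ?_ _)
  have := pow_dvd_pow_of_dvd ((pow_dvd_pow _ (by omega : m ≤ m + ε)).trans h1) 2
  rwa [← pow_mul, mul_comm m 2] at this

end DiscriminantShift

/-! ### The element δ = (f(θ) − f(s))/(P(θ − s)) at a double root -/

section Quotient

variable {K : Type*} [Field K] [NumberField K]

/-- In characteristic 2 the mixed terms cancel and squares of coefficients are the coefficients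
themselves. -/
lemma MulTable.mul_self_zmod_two (t : MulTable) (x : Fin 4 → ℤ) (i : Fin 4) :
    (t.mul x x i : ZMod 2) = (![(x 0 : ZMod 2), 0, 0, 0] : Fin 4 → ZMod 2) i +
      x 1 * (t.t11 i : ZMod 2) + x 2 * (t.t22 i : ZMod 2) + x 3 * (t.t33 i : ZMod 2) := by
  have sq : ∀ z : ZMod 2, z * z = z := by decide
  have two' : ∀ u v : ZMod 2, u * v + v * u = 0 := by decide
  fin_cases i <;> simp [MulTable.mul, sq, two']

/-- The relations between `y` and `δ = (f(y) - f(0))/(Py)`. -/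
lemma quotient_relations {y δ : K} {g₀ g₁ g₂ g₃ P G H₁ : ℤ} (hP : P ≠ 0)
    (hy : y ^ 4 + g₃ * y ^ 3 + g₂ * y ^ 2 + g₁ * y + g₀ = 0)
    (hδ : P * δ = y ^ 3 + g₃ * y ^ 2 + g₂ * y + g₁) (h0 : g₀ = P * G) (h1 : g₁ = P * H₁) :
    y * δ = -G ∧ P * (δ * δ) = P * (H₁ * δ) - G * (y ^ 2 + g₃ * y + g₂) := by
  have hP' : (P : K) ≠ 0 := by exact_mod_cast hP
  have h0' : (g₀ : K) = P * G := by exact_mod_cast congrArg (Int.cast : ℤ → K) h0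
  have h1' : (g₁ : K) = P * H₁ := by exact_mod_cast congrArg (Int.cast : ℤ → K) h1
  have e : y * δ = -G := by
    refine mul_left_cancel₀ hP' ?_
    linear_combination y * hδ + hy - h0'
  refine ⟨e, ?_⟩
  linear_combination δ * hδ + (y ^ 2 + g₃ * y + g₂) * e + δ * h1'

lemma quotient_sq {y δ : K} {g₀ g₁ g₂ g₃ P H₀ H₁ : ℤ} (hP : P ≠ 0)
    (hy : y ^ 4 + g₃ * y ^ 3 + g₂ * y ^ 2 + g₁ * y + g₀ = 0)
    (hδ : P * δ = y ^ 3 + g₃ * y ^ 2 + g₂ * y + g₁) (h0 : g₀ = P ^ 2 * H₀) (h1 : g₁ = P * H₁) :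
    y * δ = -P * H₀ ∧ δ * δ = H₁ * δ - H₀ * (y ^ 2 + g₃ * y + g₂) := by
  have hP' : (P : K) ≠ 0 := by exact_mod_cast hP
  obtain ⟨e1, e2⟩ := quotient_relations hP hy hδ (G := P * H₀) (by rw [h0]; ring) h1
  push_cast at e1 e2
  exact ⟨by linear_combination e1, mul_left_cancel₀ hP' (by linear_combination e2)⟩

/-- The multiplication table of `1, y, y², δ`. -/
def quotTable (g₂ g₃ P H₀ H₁ : ℤ) : MulTable where
  t11 := ![0, 0, 1, 0]
  t12 := ![-P * H₁, -g₂, -g₃, P]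
  t13 := ![-P * H₀, 0, 0, 0]
  t22 := ![g₃ * (P * H₁) - P ^ 2 * H₀, g₃ * g₂ - P * H₁, g₃ ^ 2 - g₂, -g₃ * P]
  t23 := ![0, -P * H₀, 0, 0]
  t33 := ![-H₀ * g₂, -H₀ * g₃, -H₀, H₁]

lemma quotTable_holds {y δ : K} {g₂ g₃ P H₀ H₁ : ℤ} (hP : P ≠ 0)
    (hy : y ^ 4 + g₃ * y ^ 3 + g₂ * y ^ 2 + (P * H₁ : ℤ) * y + (P ^ 2 * H₀ : ℤ) = 0)
    (hδ : P * δ = y ^ 3 + g₃ * y ^ 2 + g₂ * y + (P * H₁ : ℤ)) :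
    (quotTable g₂ g₃ P H₀ H₁).Holds y (y ^ 2) δ := by
  obtain ⟨e1, e2⟩ := quotient_sq hP hy hδ rfl rfl
  push_cast at hy hδ
  constructor <;> simp only [evalCoord, quotTable, Matrix.cons_val] <;> push_cast
  · ring
  · linear_combination -hδ
  · linear_combination e1
  · linear_combination hy + g₃ * hδ
  · linear_combination y * e1
  · linear_combination e2

/-- The case of an odd unramified double root. -/
theorem isPIntegralBasis_quot_of_unramified {p : ℕ} (hp : p.Prime)
    (hfr : Module.finrank ℚ K = 4) {y δ : K} (hli : LinearIndependent ℚ ![1, y, y ^ 2, δ])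
    {g₂ g₃ P H₀ H₁ : ℤ} (hP : P ≠ 0)
    (hy : y ^ 4 + g₃ * y ^ 3 + g₂ * y ^ 2 + (P * H₁ : ℤ) * y + (P ^ 2 * H₀ : ℤ) = 0)
    (hδ : P * δ = y ^ 3 + g₃ * y ^ 2 + g₂ * y + (P * H₁ : ℤ)) (hP0 : (P : ZMod p) = 0)
    (hH₁ : (H₁ : ZMod p) = 0) (hH₀ : (H₀ : ZMod p) ≠ 0) (hg₂ : (g₂ : ZMod p) ≠ 0)
    (h2 : (2 : ZMod p) ≠ 0) (hdisc : (g₃ : ZMod p) ^ 2 - 4 * g₂ ≠ 0) :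
    IsPIntegralBasis p ![1, y, y ^ 2, δ] := by
  have := Fact.mk hp
  refine isPIntegralBasis_of_mulTable hp hli hfr (quotTable_holds hP hy hδ) Finset.univ []
    ?_ ?_ ?_ ?_ ?_
  · intro x y hy i _
    simp only [Finset.mem_univ, forall_const, forall_fin_four] at hy
    obtain ⟨h0, h1, h2, h3⟩ := hy
    revert i
    simp [MulTable.mul, quotTable, forall_fin_four, h0, h1, h2, h3]
  · intro x hx
    simp [MulTable.mul, quotTable, forall_fin_four, hP0, hH₁] at hx
    simp only [Finset.mem_univ, forall_const]
    obtain ⟨h0, h1, h2', h3⟩ := hx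
    -- Modulo p, yδ = 0 and the ring is the product of F_p[δ]/(δ² + H₀g₂) and F_p[y]/(y² + g₃y +
    -- g₂). It is reduced as both discriminants are nonzero.
    have h03 : (x 0 : ZMod p) * x 3 = 0 := by
      refine (mul_eq_zero.1 ?_).resolve_left h2
      linear_combination h3
    have f3 : (x 3 : ZMod p) = 0 := by
      rcases mul_eq_zero.1 h03 with f | f
      · rw [f] at h0
        simpa [hH₀, hg₂] using h0
      · exact f
    have f0 : (x 0 : ZMod p) = 0 := by simpa [f3] using h0
    rw [f0, f3] at h1 h2'
    have h12 : (x 2 : ZMod p) * (g₃ * x 2 - 2 * x 1) = 0 := by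
      refine (mul_eq_zero.1 ?_).resolve_left hg₂
      linear_combination h1
    have f2 : (x 2 : ZMod p) = 0 := by
      rcases mul_eq_zero.1 h12 with f | f
      · exact f
      · refine pow_eq_zero_iff two_ne_zero |>.1 ((mul_eq_zero.1 ?_).resolve_left hdisc)
        linear_combination 4 * h2' + (2 * x 1 - 3 * g₃ * x 2) * f
    have f1 : (x 1 : ZMod p) = 0 := by simpa [f2] using h2'
    simp [forall_fin_four, f0, f1, f2, f3]
  · simp
  · simp
  · intro l hl _
    simp only [Finset.mem_univ, forall_const] at hl
    exact fun i => (ZMod.intCast_zmod_eq_zero_iff_dvd _ _).2 (hl i)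

/-- The case of an odd ramified double root. -/
theorem isPIntegralBasis_quot_of_ramified {p : ℕ} (hp : p.Prime)
    (hfr : Module.finrank ℚ K = 4) {y δ : K} (hli : LinearIndependent ℚ ![1, y, y ^ 2, δ])
    {g₂ g₃ P H₀ H₁ : ℤ} (hP : P ≠ 0)
    (hy : y ^ 4 + g₃ * y ^ 3 + g₂ * y ^ 2 + (P * H₁ : ℤ) * y + (P ^ 2 * (p * H₀) : ℤ) = 0)
    (hδ : P * δ = y ^ 3 + g₃ * y ^ 2 + g₂ * y + (P * H₁ : ℤ))
    (hH₁ : (H₁ : ZMod p) = 0) (hH₀ : (H₀ : ZMod p) ≠ 0) (hg₂ : (g₂ : ZMod p) ≠ 0)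
    (hdisc : (g₃ : ZMod p) ^ 2 - 4 * g₂ ≠ 0) :
    IsPIntegralBasis p ![1, y, y ^ 2, δ] := by
  have := Fact.mk hp
  refine isPIntegralBasis_of_mulTable hp hli hfr (quotTable_holds hP hy hδ) {0, 1, 2}
    [![0, 0, 0, 1]] ?_ ?_ ?_ ?_ ?_
  · intro x y hy
    simp at hy
    obtain ⟨h0, h1, h2⟩ := hy
    simp [MulTable.mul, quotTable, h0, h1, h2]
  · intro x hx
    simp [MulTable.mul, quotTable, hH₁] at hx
    obtain ⟨f0, h1, h2'⟩ := hx
    rw [f0] at h1 h2'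
    have h12 : (x 2 : ZMod p) * (g₃ * x 2 - 2 * x 1) = 0 := by
      refine (mul_eq_zero.1 ?_).resolve_left hg₂
      linear_combination h1
    have f2 : (x 2 : ZMod p) = 0 := by
      rcases mul_eq_zero.1 h12 with f | f
      · exact f
      · refine pow_eq_zero_iff two_ne_zero |>.1 ((mul_eq_zero.1 ?_).resolve_left hdisc)
        linear_combination 4 * h2' + (2 * x 1 - 3 * g₃ * x 2) * f
    have f1 : (x 1 : ZMod p) = 0 := by simpa [f2] using h2'
    simp [f0, f1, f2]
  · simp
  · simp [MulTable.mul, quotTable, forall_fin_four, hH₁]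
  · intro l hl he
    simp [MulTable.mul, quotTable, forall_fin_four] at hl he ⊢
    obtain ⟨hl0, hl1, hl2⟩ := hl
    obtain ⟨k, ⟨hk0, hk1, hk2, hk3⟩, k0, k1, k2⟩ := he
    have c3 := ZMod.eq_zero_of_mul_eq hp (x := -(H₀ * l 3)) (y := k 2) (by linear_combination hk2) k2
    push_cast at c3
    exact ⟨(ZMod.intCast_zmod_eq_zero_iff_dvd _ _).2 hl0,
      (ZMod.intCast_zmod_eq_zero_iff_dvd _ _).2 hl1,
      (ZMod.intCast_zmod_eq_zero_iff_dvd _ _).2 hl2, by simpa [hH₀] using c3⟩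

end Quotient

/-! ### Quotient bases at 2 in the presence of a second double root -/

section TwoDoubleRoots

variable {K : Type*} [Field K] [NumberField K]

/-- The multiplication table of `1, y, y² + y, δ`. -/
def quotAddTable (g₂ g₃ P H₀ H₁ : ℤ) : MulTable where
  t11 := ![0, -1, 1, 0]
  t12 := ![-P * H₁, g₃ - 1 - g₂, 1 - g₃, P]
  t13 := ![-P * H₀, 0, 0, 0]
  t22 := ![-(2 - g₃) * (P * H₁) - P ^ 2 * H₀,
    -((2 - g₃) * (g₂ - g₃) + P * H₁ + (1 - g₂)), 1 - g₂ - (2 - g₃) * g₃, (2 - g₃) * P]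
  t23 := ![-P * H₀, -P * H₀, 0, 0]
  t33 := ![-H₀ * g₂, -H₀ * (g₃ - 1), -H₀, H₁]

lemma quotAddTable_holds {y δ : K} {g₂ g₃ P H₀ H₁ : ℤ} (hP : P ≠ 0)
    (hy : y ^ 4 + g₃ * y ^ 3 + g₂ * y ^ 2 + (P * H₁ : ℤ) * y + (P ^ 2 * H₀ : ℤ) = 0)
    (hδ : P * δ = y ^ 3 + g₃ * y ^ 2 + g₂ * y + (P * H₁ : ℤ)) :
    (quotAddTable g₂ g₃ P H₀ H₁).Holds y (y ^ 2 + y) δ := by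
  obtain ⟨e1, e2⟩ := quotient_sq hP hy hδ rfl rfl
  push_cast at hy hδ
  constructor <;> simp only [evalCoord, quotAddTable, Matrix.cons_val] <;> push_cast
  · ring
  · linear_combination -hδ
  · linear_combination e1
  · linear_combination hy - (2 - g₃) * hδ
  · linear_combination (y + 1) * e1
  · linear_combination e2

theorem isPIntegralBasis_quotAdd_of_unramified (hfr : Module.finrank ℚ K = 4) {y δ : K}
    (hli : LinearIndependent ℚ ![1, y, y ^ 2 + y, δ]) {γ η P H₀ H₁ τ : ℤ} (hP : P ≠ 0)
    (hy : y ^ 4 + (2 * γ : ℤ) * y ^ 3 + (2 * η + 1 : ℤ) * y ^ 2 + (2 * P * H₁ : ℤ) * y +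
      ((2 * P) ^ 2 * H₀ : ℤ) = 0)
    (hδ : (2 * P : ℤ) * δ = y ^ 3 + (2 * γ : ℤ) * y ^ 2 + (2 * η + 1 : ℤ) * y + (2 * P * H₁ : ℤ))
    (hτ : (2 - 2 * γ) * (2 * η + 1 - 2 * γ) + 2 * P * H₁ + (1 - (2 * η + 1)) = 2 * τ)
    (hτ' : (τ : ZMod 2) = 1) (hH₁ : (H₁ : ZMod 2) = 1) :
    IsPIntegralBasis 2 ![1, y, y ^ 2 + y, δ] := by
  have hp := Nat.prime_two
  have two : (2 : ZMod 2) = 0 := rfl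
  refine isPIntegralBasis_of_mulTable hp hli hfr
    (quotAddTable_holds (mul_ne_zero two_ne_zero hP) hy hδ) {0, 1, 3} [![0, 0, 1, 0]] ?_ ?_ ?_ ?_ ?_
  · intro x y hy
    simp at hy
    obtain ⟨h0, h1, h3⟩ := hy
    simp [MulTable.mul, quotAddTable, h0, h1, h3, two]
  · intro x hx
    simp only [MulTable.mul_self_zmod_two] at hx
    simp [quotAddTable, two, hH₁] at hx
    obtain ⟨h0, h1, h3⟩ := hx
    simp only [h3, zero_mul, add_zero] at h0 h1
    simp [h0, h1, h3]
  · simp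
  · simp [MulTable.mul, quotAddTable, forall_fin_four, two]
  · intro l hl he
    simp [MulTable.mul, quotAddTable, forall_fin_four] at hl he ⊢
    obtain ⟨hl0, hl1, hl3⟩ := hl
    obtain ⟨k, ⟨hk0, hk1, hk2, hk3⟩, k0, k1, k3⟩ := he
    have f1 : (l 1 : ZMod 2) = 0 := (ZMod.intCast_zmod_eq_zero_iff_dvd _ _).2 hl1
    have f3 : (l 3 : ZMod 2) = 0 := (ZMod.intCast_zmod_eq_zero_iff_dvd _ _).2 hl3
    -- The number −2τ is the y-coordinate of (y² + y)²; an odd τ therefore detects l₂, so that no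
    -- further division by 2 is needed at the other double root.
    have c := ZMod.eq_zero_of_mul_eq hp (x := l 1 * (γ - 1 - η) - τ * l 2 - P * H₀ * l 3) (y := k 1)
      (by push_cast; linear_combination hk1 + l 2 * hτ) k1
    push_cast at c
    rw [f1, f3, hτ'] at c
    exact ⟨(ZMod.intCast_zmod_eq_zero_iff_dvd _ _).2 hl0, f1, by linear_combination -c, f3⟩

theorem isPIntegralBasis_quotAdd_of_ramified (hfr : Module.finrank ℚ K = 4) {y δ : K}
    (hli : LinearIndependent ℚ ![1, y, y ^ 2 + y, δ]) {γ η P H₀ H₁ τ : ℤ} (hP : P ≠ 0)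
    (hy : y ^ 4 + (2 * γ : ℤ) * y ^ 3 + (2 * η + 1 : ℤ) * y ^ 2 + (P * H₁ : ℤ) * y +
      (P ^ 2 * (2 * H₀) : ℤ) = 0)
    (hδ : P * δ = y ^ 3 + (2 * γ : ℤ) * y ^ 2 + (2 * η + 1 : ℤ) * y + (P * H₁ : ℤ))
    (hτ : (2 - 2 * γ) * (2 * η + 1 - 2 * γ) + P * H₁ + (1 - (2 * η + 1)) = 2 * τ)
    (hτ' : (τ : ZMod 2) = 1 - P) (hH₁ : (H₁ : ZMod 2) = 0) (hH₀ : (H₀ : ZMod 2) = 1) :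
    IsPIntegralBasis 2 ![1, y, y ^ 2 + y, δ] := by
  have hp := Nat.prime_two
  have two : (2 : ZMod 2) = 0 := rfl
  refine isPIntegralBasis_of_mulTable hp hli hfr
    (quotAddTable_holds hP hy hδ) {0, 1} [![0, 0, 1, 0], ![0, 0, 0, 1]] ?_ ?_ ?_ ?_ ?_
  · intro x y hy
    simp at hy
    obtain ⟨h0, h1⟩ := hy
    simp [MulTable.mul, quotAddTable, h0, h1, hH₁, two]
  · intro x hx
    simp only [MulTable.mul_self_zmod_two] at hx
    simpa [quotAddTable, two, hH₁] using hx
  · simp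
  · simp [MulTable.mul, quotAddTable, forall_fin_four, two, hH₁]
  · intro l hl he
    simp [MulTable.mul, quotAddTable, forall_fin_four] at hl he ⊢
    obtain ⟨hl0, hl1⟩ := hl
    obtain ⟨⟨k, ⟨-, hk1, -, -⟩, -, k1⟩, ⟨k', ⟨hk0, -, -, -⟩, k0, -⟩⟩ := he
    have f1 : (l 1 : ZMod 2) = 0 := (ZMod.intCast_zmod_eq_zero_iff_dvd _ _).2 hl1
    have c := ZMod.eq_zero_of_mul_eq hp (x := l 1 * (γ - 1 - η) - τ * l 2 - P * H₀ * l 3) (y := k 1)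
      (by push_cast; linear_combination hk1 + l 2 * hτ) k1
    have d := ZMod.eq_zero_of_mul_eq hp
      (x := -P * H₀ * l 1 - P * H₀ * l 2 - H₀ * (2 * η + 1) * l 3) (y := k' 0)
      (by push_cast; linear_combination hk0) k0
    push_cast at c d
    rw [f1, hτ', hH₀] at c
    rw [f1, hH₀, two] at d
    -- The two conditions on l₂ and l₃ are independent for either parity of P; the odd case is
    -- needed for P = 1.
    have key : ∀ P x y : ZMod 2, 0 * (γ - 1 - η : ZMod 2) - (1 - P) * x - P * 1 * y = 0 →
        -P * 1 * 0 - P * 1 * x - 1 * (0 * (η : ZMod 2) + 1) * y = 0 → x = 0 ∧ y = 0 := by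
      simp only [zero_mul]
      decide
    obtain ⟨f2, f3⟩ := key _ _ _ c d
    exact ⟨(ZMod.intCast_zmod_eq_zero_iff_dvd _ _).2 hl0, f1, f2, f3⟩

/-- The multiplication table of `1, y, (y² + y)/2, δ`. -/
def quotHalfTable (σ η h P H₀ H₁ : ℤ) : MulTable where
  t11 := ![0, -1, 2, 0]
  t12 := ![-2 * h, 2 * σ - 2 * η - 2, 1 - 4 * σ, P]
  t13 := ![-2 * P * H₀, 0, 0, 0]
  t22 := ![-(2 - 4 * σ) * h - P ^ 2 * H₀, -(η + 1 - 4 * σ * η - 5 * σ + h + 4 * σ ^ 2),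
    8 * σ ^ 2 - 4 * σ - 2 * η - 1, (1 - 2 * σ) * P]
  t23 := ![-P * H₀, -P * H₀, 0, 0]
  t33 := ![-H₀ * (4 * η + 3), -H₀ * (4 * σ - 1), -2 * H₀, H₁]

/-- The element t = (y² + y)/2 has integral products because 4 ∣ g₃, g₂ ≡ 3 modulo 4 and PH₁ is
even; they are checked after clearing denominators 2 and 4. -/
lemma quotHalfTable_holds {y δ t : K} {σ η h P H₀ H₁ : ℤ} (hP : P ≠ 0) (ht : 2 * t = y ^ 2 + y)
    (hh : P * H₁ = 2 * h)
    (hy : y ^ 4 + (4 * σ : ℤ) * y ^ 3 + (4 * η + 3 : ℤ) * y ^ 2 + (2 * P * H₁ : ℤ) * y +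
      ((2 * P) ^ 2 * H₀ : ℤ) = 0)
    (hδ : (2 * P : ℤ) * δ = y ^ 3 + (4 * σ : ℤ) * y ^ 2 + (4 * η + 3 : ℤ) * y +
      (2 * P * H₁ : ℤ)) :
    (quotHalfTable σ η h P H₀ H₁).Holds y t δ := by
  obtain ⟨e1, e2⟩ := quotient_sq (mul_ne_zero two_ne_zero hP) hy hδ rfl rfl
  have hh' : (P * H₁ : K) = 2 * h := by exact_mod_cast congrArg (Int.cast : ℤ → K) hh
  push_cast at hy hδ e1 e2
  constructor <;> simp only [evalCoord, quotHalfTable, Matrix.cons_val] <;> push_cast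
  · linear_combination -ht
  · refine mul_left_cancel₀ (two_ne_zero (α := K)) ?_
    linear_combination (y - 1 + 4 * σ) * ht - hδ - 2 * hh'
  · linear_combination e1
  · refine mul_left_cancel₀ (by norm_num : (4 : K) ≠ 0) ?_
    linear_combination (2 * t + y ^ 2 + y - (16 * σ ^ 2 - 8 * σ - 4 * η - 2)) * ht + hy -
      (2 - 4 * σ) * hδ + (-2 * y - 4 + 8 * σ) * hh'
  · refine mul_left_cancel₀ (two_ne_zero (α := K)) ?_
    linear_combination δ * ht + (y + 1) * e1
  · linear_combination e2 + H₀ * ht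

theorem isPIntegralBasis_quotHalf_of_unramified (hfr : Module.finrank ℚ K = 4) {y δ t : K}
    (hli : LinearIndependent ℚ ![1, y, t, δ]) {σ η h P H₀ H₁ : ℤ} (hP : P ≠ 0)
    (ht : 2 * t = y ^ 2 + y) (hh : P * H₁ = 2 * h)
    (hy : y ^ 4 + (4 * σ : ℤ) * y ^ 3 + (4 * η + 3 : ℤ) * y ^ 2 + (2 * P * H₁ : ℤ) * y +
      ((2 * P) ^ 2 * H₀ : ℤ) = 0)
    (hδ : (2 * P : ℤ) * δ = y ^ 3 + (4 * σ : ℤ) * y ^ 2 + (4 * η + 3 : ℤ) * y +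
      (2 * P * H₁ : ℤ)) (hH₁ : (H₁ : ZMod 2) = 1) :
    IsPIntegralBasis 2 ![1, y, t, δ] := by
  have hp := Nat.prime_two
  have two : (2 : ZMod 2) = 0 := rfl
  have four : (4 : ZMod 2) = 0 := rfl
  have eight : (8 : ZMod 2) = 0 := rfl
  have hP0 : (P : ZMod 2) = 0 := by
    have := congrArg (Int.cast : ℤ → ZMod 2) hh
    push_cast at this
    simpa [hH₁, two] using this
  refine isPIntegralBasis_of_mulTable hp hli hfr (quotHalfTable_holds hP ht hh hy hδ)
    Finset.univ [] ?_ ?_ ?_ ?_ ?_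
  · intro x y hy i _
    simp only [Finset.mem_univ, forall_const, forall_fin_four] at hy
    obtain ⟨h0, h1, h2, h3⟩ := hy
    revert i
    simp [MulTable.mul, quotHalfTable, forall_fin_four, h0, h1, h2, h3]
  · intro x hx
    simp only [MulTable.mul_self_zmod_two] at hx
    simp [quotHalfTable, forall_fin_four, two, four, eight, hH₁, hP0] at hx
    simp only [Finset.mem_univ, forall_const]
    obtain ⟨h0, h1, h2, h3⟩ := hx
    simp only [h2, h3, zero_mul, add_zero] at h0 h1
    simp [forall_fin_four, h0, h1, h2, h3]
  · simp
  · simp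
  · intro l hl _
    simp only [Finset.mem_univ, forall_const] at hl
    exact fun i => (ZMod.intCast_zmod_eq_zero_iff_dvd _ _).2 (hl i)

theorem isPIntegralBasis_quotHalf_of_ramified (hfr : Module.finrank ℚ K = 4) {y δ t : K}
    (hli : LinearIndependent ℚ ![1, y, t, δ]) {σ η h P H₀ H₁ : ℤ} (hP : P ≠ 0)
    (ht : 2 * t = y ^ 2 + y) (hh : P * H₁ = 2 * h)
    (hy : y ^ 4 + (4 * σ : ℤ) * y ^ 3 + (4 * η + 3 : ℤ) * y ^ 2 + (2 * P * H₁ : ℤ) * y +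
      ((2 * P) ^ 2 * (2 * H₀) : ℤ) = 0)
    (hδ : (2 * P : ℤ) * δ = y ^ 3 + (4 * σ : ℤ) * y ^ 2 + (4 * η + 3 : ℤ) * y +
      (2 * P * H₁ : ℤ)) (hH₁ : (H₁ : ZMod 2) = 0) (hH₀ : (H₀ : ZMod 2) = 1) :
    IsPIntegralBasis 2 ![1, y, t, δ] := by
  have hp := Nat.prime_two
  have two : (2 : ZMod 2) = 0 := rfl
  have three : (3 : ZMod 2) = 1 := rfl
  have four : (4 : ZMod 2) = 0 := rfl
  have eight : (8 : ZMod 2) = 0 := rfl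
  refine isPIntegralBasis_of_mulTable hp hli hfr (quotHalfTable_holds hP ht hh hy hδ)
    {0, 1, 2} [![0, 0, 0, 1]] ?_ ?_ ?_ ?_ ?_
  · intro x y hy
    simp at hy
    obtain ⟨h0, h1, h2⟩ := hy
    simp [MulTable.mul, quotHalfTable, h0, h1, h2, two]
  · intro x hx
    simp only [MulTable.mul_self_zmod_two] at hx
    simp [quotHalfTable, two, four, eight] at hx
    obtain ⟨h0, h1, h2⟩ := hx
    simp only [h2, zero_mul, add_zero] at h0 h1
    simp [h0, h1, h2]
  · simp
  · simp [MulTable.mul, quotHalfTable, forall_fin_four, two, hH₁]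
  · intro l hl he
    simp [MulTable.mul, quotHalfTable, forall_fin_four] at hl he ⊢
    obtain ⟨hl0, hl1, hl2⟩ := hl
    obtain ⟨k, ⟨hk0, -, -, -⟩, k0, -, -⟩ := he
    have f1 : (l 1 : ZMod 2) = 0 := (ZMod.intCast_zmod_eq_zero_iff_dvd _ _).2 hl1
    have f2 : (l 2 : ZMod 2) = 0 := (ZMod.intCast_zmod_eq_zero_iff_dvd _ _).2 hl2
    have d := ZMod.eq_zero_of_mul_eq hp
      (x := -2 * P * H₀ * l 1 - P * H₀ * l 2 - H₀ * (4 * η + 3) * l 3) (y := k 0)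
      (by push_cast; linear_combination hk0) k0
    push_cast at d
    rw [f1, f2, hH₀, four, three] at d
    exact ⟨(ZMod.intCast_zmod_eq_zero_iff_dvd _ _).2 hl0, f1, f2, by linear_combination -d⟩

end TwoDoubleRoots

/-! ### Quotient bases at a quadruple root modulo p -/

section QuadrupleRootQuotient

variable {K : Type*} [Field K] [NumberField K]

/-- The multiplication table of `1, y, y²/p, δ`. -/
def quotDivTable (p g₂ g₃ P H₀ H₁ : ℤ) : MulTable where
  t11 := ![0, 0, p, 0]
  t12 := ![-p * P * H₁, -g₂, -p * g₃, p * P]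
  t13 := ![-p * P * H₀, 0, 0, 0]
  t22 := ![p * (g₃ * P * H₁ - P ^ 2 * H₀), g₃ * g₂ - P * H₁, p * g₃ ^ 2 - g₂, -p * (g₃ * P)]
  t23 := ![0, -P * H₀, 0, 0]
  t33 := ![-H₀ * g₂, -H₀ * g₃, -H₀, H₁]

lemma quotDivTable_holds {p : ℤ} (hp : p ≠ 0) {y z δ : K} {g₂ g₃ P H₀ H₁ : ℤ} (hP : P ≠ 0)
    (hz : p * z = y ^ 2)
    (hy : y ^ 4 + (p * g₃ : ℤ) * y ^ 3 + (p * g₂ : ℤ) * y ^ 2 + (p ^ 2 * P * H₁ : ℤ) * y +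
      (p ^ 3 * P ^ 2 * H₀ : ℤ) = 0)
    (hδ : (p ^ 2 * P : ℤ) * δ = y ^ 3 + (p * g₃ : ℤ) * y ^ 2 + (p * g₂ : ℤ) * y +
      (p ^ 2 * P * H₁ : ℤ)) :
    (quotDivTable p g₂ g₃ P H₀ H₁).Holds y z δ := by
  obtain ⟨e1, e2⟩ := quotient_relations (mul_ne_zero (pow_ne_zero 2 hp) hP) hy hδ
    (G := p * P * H₀) (H₁ := H₁) (by ring) (by ring)
  have hp' : (p : K) ≠ 0 := by exact_mod_cast hp
  have hP' : (P : K) ≠ 0 := by exact_mod_cast hP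
  push_cast at hy hδ e1 e2
  constructor <;> simp only [evalCoord, quotDivTable, Matrix.cons_val] <;> push_cast
  · linear_combination -hz
  · refine mul_left_cancel₀ hp' ?_
    linear_combination (y + p * g₃) * hz - hδ
  · linear_combination e1
  · refine mul_left_cancel₀ (pow_ne_zero 2 hp') ?_
    linear_combination (p * z + y ^ 2 - p * (p * g₃ ^ 2 - g₂)) * hz + hy + p * g₃ * hδ
  · refine mul_left_cancel₀ hp' ?_
    linear_combination δ * hz + y * e1
  · refine mul_left_cancel₀ (mul_ne_zero (pow_ne_zero 2 hp') hP') ?_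
    linear_combination e2 + p * P * H₀ * hz

theorem isPIntegralBasis_quotDiv_of_unramified {p : ℕ} (hp : p.Prime)
    (hfr : Module.finrank ℚ K = 4) {y z δ : K} (hli : LinearIndependent ℚ ![1, y, z, δ])
    {g₂ g₃ P H₀ H₁ : ℤ} (hP : P ≠ 0) (hz : p * z = y ^ 2)
    (hy : y ^ 4 + (p * g₃ : ℤ) * y ^ 3 + (p * g₂ : ℤ) * y ^ 2 + (p ^ 2 * P * H₁ : ℤ) * y +
      (p ^ 3 * P ^ 2 * H₀ : ℤ) = 0)
    (hδ : (p ^ 2 * P : ℤ) * δ = y ^ 3 + (p * g₃ : ℤ) * y ^ 2 + (p * g₂ : ℤ) * y +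
      (p ^ 2 * P * H₁ : ℤ)) (hg₂ : (g₂ : ZMod p) ≠ 0)
    (hdisc : (H₁ : ZMod p) ^ 2 - 4 * H₀ * g₂ ≠ 0) :
    IsPIntegralBasis p ![1, y, z, δ] := by
  have := Fact.mk hp
  refine isPIntegralBasis_of_mulTable hp hli hfr
    (quotDivTable_holds (by exact_mod_cast hp.ne_zero) hP (by exact_mod_cast hz) hy hδ)
    {0, 2, 3} [![0, 1, 0, 0]] ?_ ?_ ?_ ?_ ?_
  · intro x y hy
    simp at hy
    obtain ⟨h0, h2, h3⟩ := hy
    simp [MulTable.mul, quotDivTable, h0, h2, h3]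
  · intro x hx
    simp [MulTable.mul, quotDivTable] at hx
    obtain ⟨h0, h2, h3⟩ := hx
    -- Coordinates 0 and 3 of the square are governed by δ² = H₁δ − H₀g₂, of nonzero discriminant.
    -- The remaining coordinate belongs to z = y²/p, which satisfies z² = −g₂z and contributes a
    -- further factor F_p.
    have f3 : (x 3 : ZMod p) = 0 := by
      have h3' : (x 3 : ZMod p) * (2 * x 0 + H₁ * x 3) = 0 := by linear_combination h3
      rcases mul_eq_zero.1 h3' with f | f
      · exact f
      · refine pow_eq_zero_iff two_ne_zero |>.1 ((mul_eq_zero.1 ?_).resolve_left hdisc)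
        linear_combination 4 * h0 + (H₁ * x 3 - 2 * x 0) * f
    have f0 : (x 0 : ZMod p) = 0 := by simpa [f3] using h0
    have f2 : (x 2 : ZMod p) = 0 := by simpa [f0, f3, hg₂] using h2
    simp [f0, f2, f3]
  · simp
  · simp [MulTable.mul, quotDivTable, forall_fin_four]
  · intro l hl he
    simp [MulTable.mul, quotDivTable, forall_fin_four] at hl he ⊢
    obtain ⟨hl0, hl2, hl3⟩ := hl
    obtain ⟨k, ⟨-, -, hk2, -⟩, -, k2, -⟩ := he
    have f2 : (l 2 : ZMod p) = 0 := (ZMod.intCast_zmod_eq_zero_iff_dvd _ _).2 hl2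
    have d := ZMod.eq_zero_of_mul_eq hp (x := l 1 - g₃ * l 2) (y := k 2)
      (by linear_combination hk2) k2
    push_cast at d
    exact ⟨(ZMod.intCast_zmod_eq_zero_iff_dvd _ _).2 hl0, by linear_combination d + g₃ * f2, f2,
      (ZMod.intCast_zmod_eq_zero_iff_dvd _ _).2 hl3⟩

theorem isPIntegralBasis_quotDiv_of_ramified {p : ℕ} (hp : p.Prime)
    (hfr : Module.finrank ℚ K = 4) {y z δ : K} (hli : LinearIndependent ℚ ![1, y, z, δ])
    {g₂ g₃ P H₀ H₁ : ℤ} (hP : P ≠ 0) (hz : p * z = y ^ 2)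
    (hy : y ^ 4 + (p * g₃ : ℤ) * y ^ 3 + (p * g₂ : ℤ) * y ^ 2 + (p ^ 2 * P * H₁ : ℤ) * y +
      (p ^ 3 * P ^ 2 * (p * H₀) : ℤ) = 0)
    (hδ : (p ^ 2 * P : ℤ) * δ = y ^ 3 + (p * g₃ : ℤ) * y ^ 2 + (p * g₂ : ℤ) * y +
      (p ^ 2 * P * H₁ : ℤ)) (hg₂ : (g₂ : ZMod p) ≠ 0) (hH₁ : (H₁ : ZMod p) = 0)
    (hH₀ : (H₀ : ZMod p) ≠ 0) :
    IsPIntegralBasis p ![1, y, z, δ] := by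
  have := Fact.mk hp
  refine isPIntegralBasis_of_mulTable hp hli hfr
    (quotDivTable_holds (by exact_mod_cast hp.ne_zero) hP (by exact_mod_cast hz) hy hδ)
    {0, 2} [![0, 1, 0, 0], ![0, 0, 0, 1]] ?_ ?_ ?_ ?_ ?_
  · intro x y hy
    simp at hy
    obtain ⟨h0, h2⟩ := hy
    simp [MulTable.mul, quotDivTable, h0, h2]
  · intro x hx
    simp [MulTable.mul, quotDivTable] at hx
    obtain ⟨f0, h2⟩ := hx
    have f2 : (x 2 : ZMod p) = 0 := by simpa [f0, hg₂] using h2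
    simp [f0, f2]
  · simp
  · simp [MulTable.mul, quotDivTable, forall_fin_four, hH₁]
  · intro l hl he
    simp [MulTable.mul, quotDivTable, forall_fin_four] at hl he ⊢
    obtain ⟨hl0, hl2⟩ := hl
    obtain ⟨⟨k, ⟨-, -, hk2, -⟩, -, k2⟩, ⟨k', ⟨hk0, -, -, -⟩, k0, -⟩⟩ := he
    have f2 : (l 2 : ZMod p) = 0 := (ZMod.intCast_zmod_eq_zero_iff_dvd _ _).2 hl2
    have d := ZMod.eq_zero_of_mul_eq hp (x := l 1 - g₃ * l 2) (y := k 2)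
      (by linear_combination hk2) k2
    have d' := ZMod.eq_zero_of_mul_eq hp (x := -p * P * H₀ * l 1 - H₀ * g₂ * l 3) (y := k' 0)
      (by linear_combination hk0) k0
    push_cast at d d'
    rw [CharP.cast_eq_zero] at d'
    have f3 : (l 3 : ZMod p) = 0 := by simpa [hH₀, hg₂] using d'
    exact ⟨(ZMod.intCast_zmod_eq_zero_iff_dvd _ _).2 hl0, by linear_combination d + g₃ * f2, f2, f3⟩

end QuadrupleRootQuotient

/-! ### Expansion around θ − s -/

section Shift

variable {K : Type*} [Field K] [NumberField K]

lemma IsQuarticRoot.shift_eq_zero {a b c : ℤ} {θ : K} (hθ : IsQuarticRoot a b c θ) (s : ℤ) :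
    (θ - s) ^ 4 + ((4 * s : ℤ) : K) * (θ - s) ^ 3 + ((6 * s ^ 2 + a : ℤ) : K) * (θ - s) ^ 2 +
      ((4 * s ^ 3 + 2 * a * s + b : ℤ) : K) * (θ - s) +
      ((s ^ 4 + a * s ^ 2 + b * s + c : ℤ) : K) = 0 := by
  push_cast
  linear_combination hθ.eq_zero

/-- The element α_s is the value at θ of (f(x) − f(s))/(x − s), so its coefficients in θ − s are the
Taylor coefficients of f at s beyond f(s). -/
lemma quotElt_eq {K : Type*} [Field K] (a b s : ℤ) (θ : K) : quotElt a b s θ =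
    (θ - s) ^ 3 + ((4 * s : ℤ) : K) * (θ - s) ^ 2 + ((6 * s ^ 2 + a : ℤ) : K) * (θ - s) +
      ((4 * s ^ 3 + 2 * a * s + b : ℤ) : K) := by
  unfold quotElt
  push_cast
  ring

lemma IsQuarticRoot.linearIndependent_shift {a b c : ℤ} {θ : K} (hθ : IsQuarticRoot a b c θ)
    (s : ℤ) {d P e₁ e₀ : ℤ} (hd : d ≠ 0) (hP : P ≠ 0) {w : K} (hw : d * w = θ ^ 2 + e₁ * θ + e₀) :
    LinearIndependent ℚ ![1, θ - s, w, quotElt a b s θ / (P : K)] := by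
  have hP' : (P : K) ≠ 0 := by exact_mod_cast hP
  refine hθ.linearIndependent_of_triangular hd hP (-s) e₀ e₁ (s ^ 3 + a * s + b) (a + s ^ 2) s
    (by push_cast; ring) hw ?_
  rw [mul_div_cancel₀ _ hP']
  unfold quotElt
  push_cast
  ring

end Shift

/-! ### A single double root modulo p -/

section OnlyDoubleRoot

/-- As f has no cubic term, g = x² + 2s₀x + d modulo p. For p = 2 this would be inseparable; for odd
p the values of f, f', f''/2 at s₀ and the discriminant of g are read off. -/
lemma separable_coeffs_of_isOnlyDoubleRootMod {p : ℕ} (hp : p.Prime) {a b c s₀ : ℤ}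
    (h : IsOnlyDoubleRootMod p (quartic a b c) s₀) :
    2 < p ∧ (s₀ ^ 4 + a * s₀ ^ 2 + b * s₀ + c : ZMod p) = 0 ∧
      (4 * s₀ ^ 3 + 2 * a * s₀ + b : ZMod p) = 0 ∧ (6 * s₀ ^ 2 + a : ZMod p) ≠ 0 ∧
      (4 * s₀ : ZMod p) ^ 2 - 4 * (6 * s₀ ^ 2 + a) ≠ 0 := by
  have := Fact.mk hp
  obtain ⟨g, hsep, hg, hf⟩ := h
  have hg0 : g ≠ 0 := hsep.ne_zero
  have hdeg : g.natDegree = 2 := by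
    have h4 : ((quartic a b c).map (Int.castRingHom (ZMod p))).natDegree = 4 := by
      rw [(quartic_monic a b c).natDegree_map, quartic_natDegree]
    rw [hf, natDegree_mul (pow_ne_zero 2 (X_sub_C_ne_zero _)) hg0, natDegree_pow,
      natDegree_X_sub_C] at h4
    omega
  obtain ⟨u, e, d, rfl⟩ : ∃ u e d : ZMod p, g = C d + C e * X + C u * X ^ 2 :=
    ⟨g.coeff 2, g.coeff 1, g.coeff 0, by
      conv_lhs => rw [g.as_sum_range_C_mul_X_pow, hdeg]
      simp [Finset.sum_range_succ]⟩
  generalize (s₀ : ZMod p) = r at *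
  rw [quartic_map] at hf
  have e2 : (X - C r) ^ 2 * (C d + C e * X + C u * X ^ 2) = C u * X ^ 4 + C (e - 2 * r * u) * X ^ 3 +
      C (d - 2 * r * e + r ^ 2 * u) * X ^ 2 + C (r ^ 2 * e - 2 * r * d) * X + C (r ^ 2 * d) := by
    simp only [map_add, map_sub, map_mul, map_pow, map_ofNat]
    ring
  rw [e2] at hf
  obtain ⟨h4, h3, h2, h1, h0⟩ := eq_of_degree_four_eq hf
  subst h4
  have hdisc : e ^ 2 - 4 * d * 1 ≠ 0 := fun h =>
    not_separable_of_discrim_eq_zero h one_ne_zero hsep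
  have he : e = 2 * r := by linear_combination -h3
  have hge : (C d + C e * X + C 1 * X ^ 2).eval r = d + e * r + r ^ 2 := by simp
  rw [hge] at hg
  refine ⟨?_, ?_, ?_, ?_, ?_⟩
  · by_contra hlt
    have h2le := hp.two_le
    have hp2 : p = 2 := by omega
    subst hp2
    refine hdisc ?_
    have two : (2 : ZMod 2) = 0 := rfl
    rw [he]
    linear_combination (2 * r ^ 2 - 2 * d) * two
  · rw [h2, h1, h0, he]; ring
  · rw [h2, h1, he]; ring
  · rw [h2, he]
    rw [he] at hg
    intro h
    exact hg (by linear_combination h)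
  · rw [h2]
    rw [he] at hdisc ⊢
    intro h
    exact hdisc (by linear_combination h)

/-- Hensel lifting for f', whose derivative at s₀ is 2(6s₀² + a), a unit for odd p. -/
lemma exists_pow_dvd_derivative {p : ℕ} (hp : p.Prime) (h2 : 2 < p) {a b s₀ : ℤ}
    (h1 : (4 * s₀ ^ 3 + 2 * a * s₀ + b : ZMod p) = 0) (hg₂ : (6 * s₀ ^ 2 + a : ZMod p) ≠ 0)
    (n : ℕ) : ∃ s : ℤ, s ≡ s₀ [ZMOD p] ∧ (p : ℤ) ^ (n + 1) ∣ 4 * s ^ 3 + 2 * a * s + b := by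
  have := Fact.mk hp
  have h2' : (2 : ZMod p) ≠ 0 := fun h =>
    intCast_ne_zero_of_not_dvd (hp.not_dvd_four h2) (by push_cast; linear_combination 2 * h)
  induction n with
  | zero =>
    refine ⟨s₀, Int.ModEq.refl _, ?_⟩
    rw [zero_add, pow_one, ← ZMod.intCast_zmod_eq_zero_iff_dvd]
    push_cast
    exact h1
  | succ n ih =>
    obtain ⟨s, hs, k, hk⟩ := ih
    have hs' : (s : ZMod p) = s₀ := (ZMod.intCast_eq_intCast_iff s s₀ p).2 hs
    obtain ⟨t, ht⟩ := ZMod.intCast_surjective (n := p)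
      (-(k : ZMod p) / (2 * (6 * (s₀ : ZMod p) ^ 2 + a)))
    rw [eq_div_iff (mul_ne_zero h2' hg₂)] at ht
    obtain ⟨q, hq⟩ := (ZMod.intCast_zmod_eq_zero_iff_dvd (k + 2 * (6 * s ^ 2 + a) * t) p).1 (by
      push_cast
      rw [hs']
      linear_combination ht)
    refine ⟨s + p ^ (n + 1) * t, ?_, q + 12 * s * p ^ n * t ^ 2 + 4 * p ^ (2 * n + 1) * t ^ 3, ?_⟩
    · refine Int.ModEq.trans ?_ hs
      exact Int.modEq_iff_dvd.2 ⟨-(p ^ n * t), by ring⟩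
    · linear_combination hk + p ^ (n + 1) * hq

variable {K : Type*} [Field K] [NumberField K]

lemma IsPIntegralBasis.of_shift_sq {p : ℕ} (hp : p.Prime) {θ δ : K} {s : ℤ}
    (h : IsPIntegralBasis p ![1, θ - s, (θ - s) ^ 2, δ]) :
    IsPIntegralBasis p ![1, θ, θ ^ 2, δ] :=
  h.of_unipotent_int hp s (s ^ 2) (2 * s) 0 0 0 (by ring) (by push_cast; ring) (by simp)

theorem IsQuarticRoot.basis_of_isOnlyDoubleRootMod {p : ℕ} (hp : p.Prime) {a b c : ℤ} {θ : K}
    (hθ : IsQuarticRoot a b c θ) (hdisc : (quartic a b c).discr ≠ 0) {s₀ s : ℤ}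
    (h : IsOnlyDoubleRootMod p (quartic a b c) s₀) (hs : s ≡ s₀ [ZMOD p])
    (hv : (discVal p (quartic a b c) : ℕ∞) <
      2 * vp p ((derivative (quartic a b c)).eval s)) :
    IsPIntegralBasis p
      ![1, θ, θ ^ 2, quotElt a b s θ / (p : K) ^ (discVal p (quartic a b c) / 2)] := by
  have := Fact.mk hp
  have hpZ := Nat.prime_iff_prime_int.1 hp
  have hp0 : (p : ZMod p) = 0 := CharP.cast_eq_zero _ _
  obtain ⟨h2, h0, h1, hg₂, hD⟩ := separable_coeffs_of_isOnlyDoubleRootMod hp h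
  rw [← (ZMod.intCast_eq_intCast_iff s s₀ p).2 hs] at h0 h1 hg₂ hD
  have h2' : (2 : ZMod p) ≠ 0 := fun h =>
    intCast_ne_zero_of_not_dvd (hp.not_dvd_four h2) (by push_cast; linear_combination 2 * h)
  have hΔ : vp p (quartic a b c).discr = (discVal p (quartic a b c) : ℕ) :=
    (ENat.natCast_toNat (fun h => hdisc ((vp_eq_top_iff hp).1 h))).symm
  generalize discVal p (quartic a b c) = Δ at *
  rw [quartic_derivative_eval, ← hΔ] at hv
  obtain ⟨D, hD', hDp⟩ := (vp_eq_iff hp).1 hΔ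
  obtain ⟨n, hn⟩ : ∃ n, n = Δ / 2 := ⟨_, rfl⟩
  obtain ⟨k, hk⟩ := pow_dvd_of_lt_two_mul (m := n) (Or.inl hv)
    (hD' ▸ (pow_dvd_pow _ (by omega)).mul_right _)
  have hg₁ : (p : ℤ) ^ (Δ + 1) ∣ (4 * s ^ 3 + 2 * a * s + b) ^ 2 := by
    rw [hk, mul_pow, ← pow_mul]
    exact (pow_dvd_pow _ (by omega)).mul_right _
  have hshift := discr_quartic_shift (a := a) (b := b) (c := c) (s := s) rfl rfl rfl rfl
  obtain ⟨X, hX⟩ : ∃ X, X = 16 * (6 * s ^ 2 + a) ^ 4 - 4 * (4 * s) ^ 2 * (6 * s ^ 2 + a) ^ 3 +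
      (4 * s ^ 3 + 2 * a * s + b) * (18 * (4 * s) ^ 3 * (6 * s ^ 2 + a) -
        80 * (4 * s) * (6 * s ^ 2 + a) ^ 2) + (s ^ 4 + a * s ^ 2 + b * s + c) *
      (-27 * (4 * s) ^ 4 + 144 * (4 * s) ^ 2 * (6 * s ^ 2 + a) - 128 * (6 * s ^ 2 + a) ^ 2 -
        192 * (4 * s) * (4 * s ^ 3 + 2 * a * s + b) + 256 * (s ^ 4 + a * s ^ 2 + b * s + c)) :=
    ⟨_, rfl⟩
  rw [← hX] at hshift
  -- Modulo p only 4g₂³(4g₂ − g₃²) survives in X, a unit by separability of g.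
  have hXp : ¬ (p : ℤ) ∣ X := by
    rw [← ZMod.intCast_zmod_eq_zero_iff_dvd, hX]
    push_cast
    rw [h0, h1]
    intro h
    refine mul_ne_zero (mul_ne_zero (mul_ne_zero h2' h2') (pow_ne_zero 3 hg₂)) hD ?_
    linear_combination -h
  -- Since disc f = f(s)X + f'(s)²Y with X a unit modulo p and v(f'(s)²) > Δ, the valuation of f(s)
  -- equals Δ.
  have hdvd : ∀ m, m ≤ Δ + 1 → ((p : ℤ) ^ m ∣ s ^ 4 + a * s ^ 2 + b * s + c ↔
      (p : ℤ) ^ m ∣ (quartic a b c).discr) := by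
    intro m hm
    have hY := ((pow_dvd_pow (p : ℤ) hm).trans hg₁)
    rw [hshift, dvd_add_left (hY.mul_right _)]
    exact ⟨fun h => h.mul_right _, fun h =>
      IsCoprime.dvd_of_dvd_mul_right ((hpZ.coprime_iff_not_dvd.2 hXp).pow_left) h⟩
  obtain ⟨G, hG, hG'⟩ := exists_of_pow_dvd
    ((hdvd Δ (by omega)).2 (hD' ▸ Dvd.intro _ rfl))
  have hGp : ¬ (p : ℤ) ∣ G := hG' (by
    rw [hdvd _ le_rfl, ← lt_vp_iff, hΔ]
    exact lt_irrefl _)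
  have hG0 := intCast_ne_zero_of_not_dvd hGp
  rw [← hn]
  have hP : ((p : ℤ) ^ n) ≠ 0 := pow_ne_zero _ hpZ.ne_zero
  have hli := hθ.linearIndependent_shift s (w := (θ - s) ^ 2) (e₁ := -2 * s) (e₀ := s ^ 2)
    one_ne_zero hP (by push_cast; ring)
  have hy := hθ.shift_eq_zero s
  have hδ := quotElt_eq a b s θ
  have hPδ : (((p : ℤ) ^ n : ℤ) : K) * (quotElt a b s θ / (((p : ℤ) ^ n : ℤ) : K)) =
      _ := (mul_div_cancel₀ _ (by exact_mod_cast hP)).trans hδ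
  have ePK : (((p : ℤ) ^ n : ℤ) : K) = (p : K) ^ n := by push_cast; rfl
  have e1 : 4 * s ^ 3 + 2 * a * s + b = p ^ n * (p * k) := by rw [hk]; ring
  rw [← ePK]
  refine IsPIntegralBasis.of_shift_sq hp (s := s) ?_
  obtain hΔn | hΔn : Δ = 2 * n ∨ Δ = 2 * n + 1 := by omega
  -- For Δ = 0 the value f(s) would be a unit, but s is a root modulo p. In the odd case n = 0 is
  -- allowed.
  · have hn0 : n ≠ 0 := by
      rintro rfl
      refine hGp ((ZMod.intCast_zmod_eq_zero_iff_dvd _ _).1 ?_)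
      have := congrArg (Int.cast : ℤ → ZMod p) hG
      push_cast at this
      rw [h0, hΔn] at this
      simpa using this.symm
    have e0 : s ^ 4 + a * s ^ 2 + b * s + c = (p ^ n) ^ 2 * G := by rw [hG, hΔn]; ring
    rw [e0, e1] at hy
    rw [e1] at hPδ
    exact isPIntegralBasis_quot_of_unramified hp hθ.finrank_eq hli hP hy hPδ
      (by push_cast; rw [hp0, zero_pow hn0]) (by push_cast; rw [hp0, zero_mul]) hG0
      (by push_cast; exact hg₂) h2' (by push_cast; exact hD)
  · have e0 : s ^ 4 + a * s ^ 2 + b * s + c = (p ^ n) ^ 2 * (p * G) := by rw [hG, hΔn]; ring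
    rw [e0, e1] at hy
    rw [e1] at hPδ
    exact isPIntegralBasis_quot_of_ramified hp hθ.finrank_eq hli hP hy hPδ
      (by push_cast; rw [hp0, zero_mul]) hG0 (by push_cast; exact hg₂) (by push_cast; exact hD)

lemma exists_shift_of_isOnlyDoubleRootMod {p : ℕ} (hp : p.Prime) {a b c s₀ : ℤ}
    (h : IsOnlyDoubleRootMod p (quartic a b c) s₀) :
    ∃ s : ℤ, s ≡ s₀ [ZMOD p] ∧ (discVal p (quartic a b c) : ℕ∞) <
      2 * vp p ((derivative (quartic a b c)).eval s) := by
  obtain ⟨h2, h0, h1, hg₂, hD⟩ := separable_coeffs_of_isOnlyDoubleRootMod hp h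
  generalize discVal p (quartic a b c) = Δ at *
  obtain ⟨s, hs, hdvd⟩ := exists_pow_dvd_derivative hp h2 h1 hg₂ Δ
  refine ⟨s, hs, ?_⟩
  rw [quartic_derivative_eval]
  calc (Δ : ℕ∞) < ((2 * (Δ + 1) : ℕ) : ℕ∞) := by exact_mod_cast (by omega : Δ < 2 * (Δ + 1))
    _ = 2 * ((Δ + 1 : ℕ) : ℕ∞) := by push_cast; rfl
    _ ≤ _ := by gcongr; exact le_vp_iff.2 hdvd

end OnlyDoubleRoot

/-! ### Regular shifts at 2 and the floor of ν -/

section ShiftTwo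

variable {a b c s : ℤ} {ε m : ℕ}

/-- Modulo 2 the discriminant H₁² − 4H₀g₂ is H₁². -/
lemma UnramifiedShift.exists_odd (h : UnramifiedShift 2 ε a b c s m) :
    ∃ H₀ H₁ : ℤ, s ^ 4 + a * s ^ 2 + b * s + c = 2 ^ (2 * m + ε) * H₀ ∧
      4 * s ^ 3 + 2 * a * s + b = 2 ^ (m + ε) * H₁ ∧ (H₁ : ZMod 2) = 1 := by
  obtain ⟨H₀, H₁, g₂, h0, h1, -, hd⟩ := h
  refine ⟨H₀, H₁, by exact_mod_cast h0, by exact_mod_cast h1, ?_⟩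
  rw [dvd_discrim_iff] at hd
  have key : ∀ x y z : ZMod 2, x ^ 2 - 4 * y * z ≠ 0 → x = 1 := by decide
  exact key _ _ _ hd

lemma RamifiedShift.exists_odd (h : RamifiedShift 2 ε a b c s m) :
    ∃ H₀ H₁ : ℤ, s ^ 4 + a * s ^ 2 + b * s + c = 2 ^ (2 * m + ε + 1) * H₀ ∧
      4 * s ^ 3 + 2 * a * s + b = 2 ^ (m + ε + 1) * H₁ ∧ (H₀ : ZMod 2) = 1 := by
  obtain ⟨H₀, H₁, h0, h1, hd⟩ := h
  refine ⟨H₀, H₁, by exact_mod_cast h0, by exact_mod_cast h1, ?_⟩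
  have key : ∀ x : ZMod 2, x ≠ 0 → x = 1 := by decide
  exact key _ (fun h => hd ((ZMod.intCast_zmod_eq_zero_iff_dvd _ 2).1 h))

/-- In the unramified type the minimum is attained by 2v(f'(s)) = 2(m + ε), in the ramified type by
v(f(s)) + ε = 2(m + ε) + 1. Both ν of the two double roots (ε = 0) and ν of row 8 (ε = 1) are
covered. -/
lemma floor_halfMin_of_shift
    (h : UnramifiedShift 2 ε a b c s m ∨ RamifiedShift 2 ε a b c s m) :
    ⌊halfMin (vp 2 ((quartic a b c).eval s) + ε)
      (2 * vp 2 ((derivative (quartic a b c)).eval s))⌋₊ = m + ε := by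
  have odd_ndvd : ∀ H : ℤ, (H : ZMod 2) = 1 → ¬ ((2 : ℕ) : ℤ) ∣ H := fun H h hd => by
    rw [(ZMod.intCast_zmod_eq_zero_iff_dvd _ _).2 hd] at h
    exact zero_ne_one h
  rw [quartic_eval, quartic_derivative_eval, halfMin]
  rcases h with h | h
  · obtain ⟨H₀, H₁, h0, h1, hH₁⟩ := h.exists_odd
    have v1 := (vp_eq_iff Nat.prime_two).2 ⟨H₁, h1, odd_ndvd _ hH₁⟩
    have v0 : ((2 * m + ε : ℕ) : ℕ∞) ≤ vp 2 (s ^ 4 + a * s ^ 2 + b * s + c) :=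
      le_vp_iff.2 ⟨H₀, h0⟩
    have : min (vp 2 (s ^ 4 + a * s ^ 2 + b * s + c) + ε)
        (2 * vp 2 (4 * s ^ 3 + 2 * a * s + b)) = ((2 * (m + ε) : ℕ) : ℕ∞) := by
      rw [min_eq_right, v1]
      · push_cast; rfl
      · rw [v1]
        refine le_trans (le_of_eq ?_) (add_le_add_left v0 _)
        push_cast; ring
    rw [this, ENat.toNat_natCast, floor_half_even]
  · obtain ⟨H₀, H₁, h0, h1, hH₀⟩ := h.exists_odd
    have v0 := (vp_eq_iff Nat.prime_two).2 ⟨H₀, h0, odd_ndvd _ hH₀⟩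
    have v1 : ((m + ε + 1 : ℕ) : ℕ∞) ≤ vp 2 (4 * s ^ 3 + 2 * a * s + b) :=
      le_vp_iff.2 ⟨H₁, h1⟩
    have : min (vp 2 (s ^ 4 + a * s ^ 2 + b * s + c) + ε)
        (2 * vp 2 (4 * s ^ 3 + 2 * a * s + b)) = ((2 * (m + ε) + 1 : ℕ) : ℕ∞) := by
      rw [min_eq_left, v0]
      · push_cast; ring
      · rw [v0]
        calc (((2 * m + ε + 1 : ℕ) : ℕ∞) + ε) ≤ ((2 * (m + ε + 1) : ℕ) : ℕ∞) := by
              exact_mod_cast (by omega : 2 * m + ε + 1 + ε ≤ 2 * (m + ε + 1))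
          _ = 2 * ((m + ε + 1 : ℕ) : ℕ∞) := by push_cast; rfl
          _ ≤ _ := by gcongr
    rw [this, ENat.toNat_natCast, floor_half_odd]

end ShiftTwo

/-! ### Two double roots modulo 2 -/

section TwoDoubleRootsRows

variable {K : Type*} [Field K] [NumberField K]

/-- An integral root s would split f, and θ would be a root of a factor of degree 1 or 3. -/
lemma IsQuarticRoot.eval_ne_zero {a b c : ℤ} {θ : K} (hθ : IsQuarticRoot a b c θ) (s : ℤ) :
    s ^ 4 + a * s ^ 2 + b * s + c ≠ 0 := by
  intro h
  have h' : (s ^ 4 + a * s ^ 2 + b * s + c : K) = 0 := by exact_mod_cast congrArg (Int.cast : ℤ → K) h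
  have hmul : (θ - s) * (θ ^ 3 + s * θ ^ 2 + (a + s ^ 2) * θ + (s ^ 3 + a * s + b)) = 0 := by
    linear_combination hθ.eq_zero - h'
  rcases mul_eq_zero.1 hmul with h | h
  · have := hθ.linearIndependent (-s) 1 0 0 (by push_cast; linear_combination h)
    norm_num at this
  · have := hθ.linearIndependent (s ^ 3 + a * s + b) (a + s ^ 2) s 1
      (by push_cast; linear_combination h)
    norm_num at this

/-- The two roots are 0 and 1, so f ≡ x²(x + 1)² = x⁴ + x² modulo 2. -/
lemma parity_of_hasTwoDoubleRootsMod {a b c : ℤ} (h : HasTwoDoubleRootsMod 2 (quartic a b c)) :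
    ∃ A B C : ℤ, a = 2 * A + 1 ∧ b = 2 * B ∧ c = 2 * C := by
  obtain ⟨r, t, hrt, hf⟩ := h
  rw [quartic_map] at hf
  have e : (X - C r) ^ 2 * (X - C t) ^ 2 = C 1 * X ^ 4 + C (-2 * (r + t)) * X ^ 3 +
      C ((r + t) ^ 2 + 2 * r * t) * X ^ 2 + C (-2 * r * t * (r + t)) * X + C (r ^ 2 * t ^ 2) := by
    simp only [map_add, map_mul, map_pow, map_ofNat, map_neg, map_one]
    ring
  rw [e] at hf
  obtain ⟨-, -, h2, h1, h0⟩ := eq_of_degree_four_eq hf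
  have key : ∀ r t : ZMod 2, r ≠ t → (r + t) ^ 2 + 2 * r * t = 1 ∧ -2 * r * t * (r + t) = 0 ∧
      r ^ 2 * t ^ 2 = 0 := by decide
  obtain ⟨k2, k1, k0⟩ := key r t hrt
  have d2 : ((a - 1 : ℤ) : ZMod 2) = 0 := by push_cast; rw [h2, k2, sub_self]
  obtain ⟨A, hA⟩ := (ZMod.intCast_zmod_eq_zero_iff_dvd _ 2).1 d2
  obtain ⟨B, hB⟩ := (ZMod.intCast_zmod_eq_zero_iff_dvd _ 2).1 (h1.trans k1)
  obtain ⟨C, hC⟩ := (ZMod.intCast_zmod_eq_zero_iff_dvd _ 2).1 (h0.trans k0)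
  exact ⟨A, B, C, by push_cast at hA; linarith, by exact_mod_cast hB, by exact_mod_cast hC⟩

lemma dominantAt_two_of_odd (A s : ℤ) : DominantAt 2 0 (2 * A + 1) s where
  le_one := zero_le_one
  two := ⟨6 * s ^ 2 + (2 * A + 1), by simp, by omega⟩
  three := by simp

/-- This is the ramified quotient basis at s = 0 with trivial denominator P = 1. -/
lemma IsQuarticRoot.basis_powers_of_two_double_roots {A B C : ℤ} {θ : K}
    (hθ : IsQuarticRoot (2 * A + 1) (2 * B) (2 * C) θ) (hC : Odd C) (hAB : Odd (A + B)) :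
    IsPIntegralBasis 2 ![1, θ, θ ^ 2, θ ^ 3] := by
  have two : (2 : ZMod 2) = 0 := rfl
  have hli := hθ.linearIndependent_shift 0 (w := θ ^ 2 + θ) (d := 1) (P := 1) (e₁ := 1) (e₀ := 0)
    one_ne_zero one_ne_zero (by push_cast; ring)
  have hδ := quotElt_eq (2 * A + 1) (2 * B) 0 θ
  have hy := hθ.shift_eq_zero 0
  generalize quotElt (2 * A + 1) (2 * B) 0 θ = δ at *
  simp only [Int.cast_zero, sub_zero, Int.cast_one, div_one] at hli hδ hy
  obtain ⟨k, hk⟩ := hAB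
  have key := isPIntegralBasis_quotAdd_of_ramified hθ.finrank_eq hli (γ := 0) (η := A) (P := 1)
    (H₀ := C) (H₁ := 2 * B) (τ := A + B + 1) one_ne_zero
    (by push_cast at hy ⊢; linear_combination hy) (by push_cast at hδ ⊢; linear_combination hδ)
    (by ring) (by
      rw [hk]; push_cast
      linear_combination (k + 1 : ZMod 2) * two) (by push_cast; rw [two, zero_mul])
    (by obtain ⟨l, rfl⟩ := hC; push_cast; rw [two]; ring)
  exact key.of_unipotent_int Nat.prime_two 0 0 (-1) (-(2 * B)) (-(2 * A + 1)) 0 (by simp)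
    (by push_cast; ring) (by push_cast at hδ ⊢; linear_combination -hδ)

/-- The quotient basis for one of two double roots modulo `2`, when the other one contributes
nothing. -/
lemma IsQuarticRoot.basis_quotElt_of_simple {A B c : ℤ} {θ : K}
    (hθ : IsQuarticRoot (2 * A + 1) (2 * B) c θ) {s l : ℤ}
    (h0 : (4 : ℤ) ∣ s ^ 4 + (2 * A + 1) * s ^ 2 + 2 * B * s + c)
    (h0' : (s + 1) ^ 4 + (2 * A + 1) * (s + 1) ^ 2 + 2 * B * (s + 1) + c = 2 * (2 * l + 1))
    (hreg : IsRegularInt 2 (quartic (2 * A + 1) (2 * B) c) s) :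
    IsPIntegralBasis 2 ![1, θ, θ ^ 2,
      quotElt (2 * A + 1) (2 * B) s θ / 2 ^ ⌊nuDouble (2 * A + 1) (2 * B) c s⌋₊] := by
  have two : (2 : ZMod 2) = 0 := rfl
  obtain ⟨m, hm, h⟩ := (dominantAt_two_of_odd A s).exists_shift_of_isRegularInt Nat.prime_two
    (hθ.eval_ne_zero s) (by exact_mod_cast h0)
    ⟨2 * s ^ 3 + (2 * A + 1) * s + B, by push_cast; ring⟩ hreg
  have hν : ⌊nuDouble (2 * A + 1) (2 * B) c s⌋₊ = m := by
    simpa [nuDouble] using floor_halfMin_of_shift h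
  have hP : ((2 : ℤ) ^ m) ≠ 0 := by positivity
  have hli := hθ.linearIndependent_shift s (w := (θ - s) ^ 2 + (θ - s)) (e₁ := 1 - 2 * s)
    (e₀ := s ^ 2 - s) one_ne_zero hP (by push_cast; ring)
  have hy := hθ.shift_eq_zero s
  have hPδ : (((2 : ℤ) ^ m : ℤ) : K) * (quotElt (2 * A + 1) (2 * B) s θ / (((2 : ℤ) ^ m : ℤ) : K)) =
      _ := (mul_div_cancel₀ _ (by exact_mod_cast hP)).trans (quotElt_eq _ _ s θ)
  have ePK : (((2 : ℤ) ^ m : ℤ) : K) = 2 ^ m := by push_cast; rfl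
  obtain ⟨n, rfl⟩ := Nat.exists_eq_add_of_le' hm
  suffices h : IsPIntegralBasis 2 ![1, θ - s, (θ - s) ^ 2 + (θ - s),
      quotElt (2 * A + 1) (2 * B) s θ / (((2 : ℤ) ^ (n + 1) : ℤ) : K)] by
    rw [hν, ← ePK]
    exact h.of_unipotent_int Nat.prime_two s (s ^ 2) (2 * s - 1) 0 0 0 (by ring)
      (by push_cast; ring) (by simp)
  have e2 : 6 * s ^ 2 + (2 * A + 1) = 2 * (3 * s ^ 2 + A) + 1 := by ring
  have e3 : 4 * s = 2 * (2 * s) := by ring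
  obtain ⟨q, hq⟩ := h0
  rw [e2, e3] at hy hPδ
  have hlin : 2 * s ^ 3 + (2 * A + 1) * s + B = 2 * l - 2 * q - 3 * s ^ 2 - 2 * s - A := by
    linarith
  -- That τ is odd follows from f(s + 1) = 2·odd together with 4 ∣ f(s).
  obtain ⟨τ, hτ⟩ : ∃ τ, τ = (1 - 2 * s) * (2 * (3 * s ^ 2 + A) + 1 - 4 * s) +
    (2 * s ^ 3 + (2 * A + 1) * s + B) - (3 * s ^ 2 + A) := ⟨_, rfl⟩
  have hτ' : (τ : ZMod 2) = 1 := by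
    have : τ = 1 + 2 * (3 * s ^ 2 + A - 2 * s - s * (2 * (3 * s ^ 2 + A) + 1 - 4 * s) +
        l - q - s - 3 * s ^ 2 - A) := by linear_combination hτ + hlin
    rw [this]
    push_cast
    rw [two, zero_mul, add_zero]
  rcases h with h | h
  · obtain ⟨H₀, H₁, f0, f1, hH₁⟩ := h.exists_odd
    rw [add_zero] at f0 f1
    rw [f0, f1] at hy
    rw [f1] at hPδ
    exact isPIntegralBasis_quotAdd_of_unramified hθ.finrank_eq hli (P := 2 ^ n) (H₀ := H₀)
      (H₁ := H₁) (γ := 2 * s) (η := 3 * s ^ 2 + A) (τ := τ) (by positivity)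
      (by push_cast at hy ⊢; linear_combination hy)
      (by push_cast at hPδ ⊢; linear_combination hPδ)
      (by rw [hτ]; linear_combination -f1) hτ' hH₁
  · obtain ⟨H₀, H₁, f0, f1, hH₀⟩ := h.exists_odd
    rw [add_zero] at f0 f1
    rw [f0, f1] at hy
    rw [f1] at hPδ
    exact isPIntegralBasis_quotAdd_of_ramified hθ.finrank_eq hli (P := 2 ^ (n + 1)) (H₀ := H₀)
      (H₁ := 2 * H₁) (γ := 2 * s) (η := 3 * s ^ 2 + A) (τ := τ) (by positivity)
      (by push_cast at hy ⊢; linear_combination hy)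
      (by push_cast at hPδ ⊢; linear_combination hPδ)
      (by rw [hτ]; linear_combination -f1)
      (by rw [hτ']; push_cast; rw [two, zero_pow (Nat.succ_ne_zero n), sub_zero])
      (by push_cast; rw [two, zero_mul]) hH₀

/-- The quotient basis for one of two double roots modulo `2`, when the other one contributes
the element `(θ² + θ)/2`. -/
lemma IsQuarticRoot.basis_quotElt_half {A B c : ℤ} {θ : K}
    (hθ : IsQuarticRoot (2 * A + 1) (2 * B) c θ) {s : ℤ}
    (h0 : (4 : ℤ) ∣ s ^ 4 + (2 * A + 1) * s ^ 2 + 2 * B * s + c)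
    (h1 : (4 : ℤ) ∣ 4 * s ^ 3 + 2 * (2 * A + 1) * s + 2 * B)
    (h2 : 6 * s ^ 2 + (2 * A + 1) ≡ 3 [ZMOD 4])
    (hreg : IsRegularInt 2 (quartic (2 * A + 1) (2 * B) c) s) :
    IsPIntegralBasis 2 ![1, θ, (θ ^ 2 + θ) / 2,
      quotElt (2 * A + 1) (2 * B) s θ / 2 ^ ⌊nuDouble (2 * A + 1) (2 * B) c s⌋₊] := by
  have two : (2 : ZMod 2) = 0 := rfl
  obtain ⟨m, hm, h⟩ := (dominantAt_two_of_odd A s).exists_shift_of_isRegularInt Nat.prime_two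
    (hθ.eval_ne_zero s) (by exact_mod_cast h0)
    ⟨2 * s ^ 3 + (2 * A + 1) * s + B, by push_cast; ring⟩ hreg
  have hν : ⌊nuDouble (2 * A + 1) (2 * B) c s⌋₊ = m := by
    simpa [nuDouble] using floor_halfMin_of_shift h
  have hP : ((2 : ℤ) ^ m) ≠ 0 := by positivity
  have ht : 2 * (((θ - s) ^ 2 + (θ - s)) / 2) = (θ - s) ^ 2 + (θ - s) :=
    mul_div_cancel₀ _ two_ne_zero
  have hli := hθ.linearIndependent_shift s (w := ((θ - s) ^ 2 + (θ - s)) / 2) (d := 2)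
    (e₁ := 1 - 2 * s) (e₀ := s ^ 2 - s) two_ne_zero hP (by push_cast; rw [ht]; ring)
  have hy := hθ.shift_eq_zero s
  have hPδ : (((2 : ℤ) ^ m : ℤ) : K) * (quotElt (2 * A + 1) (2 * B) s θ / (((2 : ℤ) ^ m : ℤ) : K)) =
      _ := (mul_div_cancel₀ _ (by exact_mod_cast hP)).trans (quotElt_eq _ _ s θ)
  have ePK : (((2 : ℤ) ^ m : ℤ) : K) = 2 ^ m := by push_cast; rfl
  obtain ⟨n, rfl⟩ := Nat.exists_eq_add_of_le' hm
  -- With y = θ − s one has (θ² + θ)/2 = (y² + y)/2 + sy + (s² + s)/2, an integral change of basis.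
  obtain ⟨q, hq⟩ : ∃ q, s ^ 2 + s = 2 * q := (Int.even_mul_succ_self s).imp fun q hq => by
    linear_combination hq
  have hqK : (s ^ 2 + s : K) = 2 * q := by exact_mod_cast congrArg (Int.cast : ℤ → K) hq
  suffices h : IsPIntegralBasis 2 ![1, θ - s, ((θ - s) ^ 2 + (θ - s)) / 2,
      quotElt (2 * A + 1) (2 * B) s θ / (((2 : ℤ) ^ (n + 1) : ℤ) : K)] by
    rw [hν, ← ePK]
    exact h.of_unipotent_int Nat.prime_two s q s 0 0 0 (by ring)
      (by linear_combination hqK / 2) (by simp)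
  obtain ⟨η, hη⟩ := h2.symm.dvd
  obtain ⟨r, hr⟩ := h1
  have e2 : 6 * s ^ 2 + (2 * A + 1) = 4 * η + 3 := by linear_combination hη
  rw [e2] at hy hPδ
  rcases h with h | h
  · obtain ⟨H₀, H₁, f0, f1, hH₁⟩ := h.exists_odd
    rw [add_zero] at f0 f1
    rw [f0, f1] at hy
    rw [f1] at hPδ
    exact isPIntegralBasis_quotHalf_of_unramified hθ.finrank_eq hli (P := 2 ^ n) (H₀ := H₀)
      (H₁ := H₁) (σ := s) (η := η) (h := r) (by positivity) ht
      (by linarith [f1.symm.trans hr, (by ring : (2 : ℤ) ^ (n + 1) * H₁ = 2 * (2 ^ n * H₁))])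
      (by push_cast at hy ⊢; linear_combination hy)
      (by push_cast at hPδ ⊢; linear_combination hPδ) hH₁
  · obtain ⟨H₀, H₁, f0, f1, hH₀⟩ := h.exists_odd
    rw [add_zero] at f0 f1
    rw [f0, f1] at hy
    rw [f1] at hPδ
    exact isPIntegralBasis_quotHalf_of_ramified hθ.finrank_eq hli (P := 2 ^ n) (H₀ := H₀)
      (H₁ := 2 * H₁) (σ := s) (η := η) (h := 2 ^ n * H₁) (by positivity) ht (by ring)
      (by push_cast at hy ⊢; linear_combination hy)
      (by push_cast at hPδ ⊢; linear_combination hPδ)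
      (by push_cast; rw [two, zero_mul]) hH₀

lemma even_cases_of_vp {x y : ℤ} (h : x = 2 * y) :
    (vp 2 x = 1 ↔ Odd y) ∧ (1 < vp 2 x ↔ Even y) := by
  subst h
  have e : ((1 : ℕ) : ℕ∞) = 1 := Nat.cast_one
  rw [← e, lt_vp_iff, vp_two_eq_iff, even_iff_two_dvd]
  refine ⟨exists_congr fun k => ⟨fun h => by linarith, fun h => by rw [h]; ring⟩, ?_⟩
  push_cast
  exact mul_dvd_mul_iff_left (a := (2 : ℤ)) (b := 2) two_ne_zero

lemma quartic_value_even (A B c k : ℤ) :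
    (2 * k) ^ 4 + (2 * A + 1) * (2 * k) ^ 2 + 2 * B * (2 * k) + c =
      c + 4 * (4 * k ^ 4 + (2 * A + 1) * k ^ 2 + B * k) := by
  ring

lemma quartic_value_odd (A B c k : ℤ) :
    (2 * k + 1) ^ 4 + (2 * A + 1) * (2 * k + 1) ^ 2 + 2 * B * (2 * k + 1) + c =
      2 * A + 1 + 2 * B + c + 1 +
        4 * (4 * k ^ 4 + 8 * k ^ 3 + 6 * k ^ 2 + 2 * k + (2 * A + 1) * (k ^ 2 + k) + B * k) := by
  ring

theorem IsQuarticRoot.basis_of_hasTwoDoubleRootsMod {a b c : ℤ} {θ : K}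
    (hθ : IsQuarticRoot a b c θ) (h : HasTwoDoubleRootsMod 2 (quartic a b c)) {v : Fin 4 → K}
    (hv : TwoDoubleRootsRow a b c θ v) : IsPIntegralBasis 2 v := by
  obtain ⟨A, B, C, rfl, rfl, rfl⟩ := parity_of_hasTwoDoubleRootsMod h
  obtain ⟨c1, c2⟩ := even_cases_of_vp (x := 2 * C) rfl
  obtain ⟨d1, d2⟩ := even_cases_of_vp
    (x := 2 * A + 1 + 2 * B + 2 * C + 1) (y := A + B + C + 1) (by ring)
  cases hv with
  | row1 hc h1 =>
    rw [c1] at hc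
    rw [d1] at h1
    exact hθ.basis_powers_of_two_double_roots hc (by grind)
  | row2 hc h1 s hs hreg =>
    rw [c1] at hc
    rw [d2] at h1
    obtain ⟨k, rfl⟩ := hs
    obtain ⟨u, hu⟩ := hc
    obtain ⟨w, hw⟩ := h1
    refine hθ.basis_quotElt_of_simple
      (l := u + (4 * (k + 1) ^ 4 + (2 * A + 1) * (k + 1) ^ 2 + B * (k + 1))) ?_ ?_ hreg
    · rw [quartic_value_odd]
      exact dvd_add ⟨w, by linarith⟩ (dvd_mul_right _ _)
    · rw [show 2 * k + 1 + 1 = 2 * (k + 1) by ring, quartic_value_even]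
      linarith
  | row3 hc h1 s hs hreg =>
    rw [c2] at hc
    rw [d1] at h1
    obtain ⟨k, rfl⟩ := hs.two_dvd
    obtain ⟨u, hu⟩ := hc
    obtain ⟨w, hw⟩ := h1
    refine hθ.basis_quotElt_of_simple (l := w + (4 * k ^ 4 + 8 * k ^ 3 + 6 * k ^ 2 + 2 * k +
      (2 * A + 1) * (k ^ 2 + k) + B * k)) ?_ ?_ hreg
    · rw [quartic_value_even]
      exact dvd_add ⟨u, by linarith⟩ (dvd_mul_right _ _)
    · rw [quartic_value_odd]
      linarith
  | row4 hc h1 s hs1 hs3 hreg =>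
    rw [c2] at hc
    rw [d2] at h1
    obtain ⟨u, hu⟩ := hc
    obtain ⟨w, hw⟩ := h1
    -- Here a = 2A + 1. The prescribed parity of s makes 6s² + a ≡ 3 modulo 4, as needed to divide
    -- y² + y by 2.
    obtain ⟨e, rfl | rfl⟩ := Int.even_or_odd' A
    · obtain ⟨k, rfl⟩ := hs1 (Int.modEq_iff_dvd.2 ⟨-e, by ring⟩)
      obtain rfl : B = 2 * (w - e - u) - 1 := by linarith
      refine hθ.basis_quotElt_half ?_ ⟨(2 * k + 1) ^ 3 + (4 * e + 1) * k + (e + w - u), by ring⟩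
        (Int.modEq_iff_dvd.2 ⟨-(6 * (k ^ 2 + k) + 1 + e), by ring⟩) hreg
      rw [quartic_value_odd]
      exact dvd_add ⟨w, by linarith⟩ (dvd_mul_right _ _)
    · obtain ⟨k, rfl⟩ := (hs3 (Int.modEq_iff_dvd.2 ⟨-e, by ring⟩)).two_dvd
      obtain rfl : B = 2 * (w - e - u - 1) := by linarith
      refine hθ.basis_quotElt_half ?_ ⟨8 * k ^ 3 + (4 * e + 3) * k + (w - e - u - 1), by ring⟩
        (Int.modEq_iff_dvd.2 ⟨-(6 * k ^ 2 + e), by ring⟩) hreg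
      rw [quartic_value_even]
      exact dvd_add ⟨u, by linarith⟩ (dvd_mul_right _ _)

theorem exists_row_of_hasTwoDoubleRootsMod {K : Type*} [Field K] {a b c : ℤ} (θ : K)
    (hdisc : (quartic a b c).discr ≠ 0) (h : HasTwoDoubleRootsMod 2 (quartic a b c)) :
    ∃ v, TwoDoubleRootsRow a b c θ v := by
  obtain ⟨A, B, C, rfl, rfl, rfl⟩ := parity_of_hasTwoDoubleRootsMod h
  obtain ⟨c1, c2⟩ := even_cases_of_vp (x := 2 * C) rfl
  obtain ⟨d1, d2⟩ := even_cases_of_vp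
    (x := 2 * A + 1 + 2 * B + 2 * C + 1) (y := A + B + C + 1) (by ring)
  have exists_even (hC : Even C) : ∃ s, Even s ∧
      IsRegularInt 2 (quartic (2 * A + 1) (2 * B) (2 * C)) s := by
    obtain ⟨u, rfl⟩ := hC
    obtain ⟨s, hs, m, hm, hshift⟩ := exists_shift Nat.prime_two (s₁ := 0)
      (fun s _ => dominantAt_two_of_odd A s) ⟨u, by push_cast; ring⟩ ⟨B, by push_cast; ring⟩ hdisc
    exact ⟨s, even_iff_two_dvd.2 (Int.modEq_zero_iff_dvd.1 (by exact_mod_cast hs)),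
      (dominantAt_two_of_odd A s).isRegularInt_of Nat.prime_two hm hshift⟩
  have exists_odd (hC : Even (A + B + C + 1)) : ∃ s, Odd s ∧
      IsRegularInt 2 (quartic (2 * A + 1) (2 * B) (2 * C)) s := by
    obtain ⟨u, hu⟩ := hC
    obtain ⟨s, hs, m, hm, hshift⟩ := exists_shift Nat.prime_two (s₁ := 1)
      (fun s _ => dominantAt_two_of_odd A s) ⟨u, by push_cast; linarith⟩
      ⟨2 * A + B + 3, by push_cast; ring⟩ hdisc
    exact ⟨s, Int.odd_iff.2 (by exact_mod_cast hs),
      (dominantAt_two_of_odd A s).isRegularInt_of Nat.prime_two hm hshift⟩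
  rcases Int.even_or_odd C with hC | hC <;> rcases Int.even_or_odd (A + B + C + 1) with hD | hD
  · rcases Int.even_or_odd' A with ⟨e, he | he⟩
    · obtain ⟨s, hs, hreg⟩ := exists_odd hD
      refine ⟨_, .row4 (c2.2 hC) (d2.2 hD) s (fun _ => hs) (fun h => ?_) hreg⟩
      exact absurd h (by rw [he, Int.ModEq]; omega)
    · obtain ⟨s, hs, hreg⟩ := exists_even hC
      refine ⟨_, .row4 (c2.2 hC) (d2.2 hD) s (fun h => ?_) (fun _ => hs) hreg⟩
      exact absurd h (by rw [he, Int.ModEq]; omega)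
  · obtain ⟨s, hs, hreg⟩ := exists_even hC
    exact ⟨_, .row3 (c2.2 hC) (d1.2 hD) s hs hreg⟩
  · obtain ⟨s, hs, hreg⟩ := exists_odd hD
    exact ⟨_, .row2 (c1.2 hC) (d2.2 hD) s hs hreg⟩
  · exact ⟨_, .row1 (c1.2 hC) (d1.2 hD)⟩

end TwoDoubleRootsRows

/-! ### Row 7 and row 8: the discriminant and the basis at a regular shift -/

section QuadrupleRootShift

lemma dominantAt_one {p : ℕ} {A s : ℤ} (hA : ¬ (p : ℤ) ∣ A) (hs : (p : ℤ) ∣ s) :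
    DominantAt p 1 (p * A) s where
  le_one := le_rfl
  two := by
    obtain ⟨S, rfl⟩ := hs
    exact ⟨p * (6 * S ^ 2) + A, by ring, fun h => hA ((dvd_add_right (dvd_mul_right _ _)).1 h)⟩
  three := by rw [pow_one]; exact hs.mul_left 4

/-- After p⁷P² is factored out, the leading term is −4g³ times the residual discriminant H₁² − 4H₀g.
-/
lemma discr_quartic_of_quadruple {a b c s p P H₀ H₁ g h : ℤ}
    (h0 : s ^ 4 + a * s ^ 2 + b * s + c = p ^ 3 * P ^ 2 * H₀)
    (h1 : 4 * s ^ 3 + 2 * a * s + b = p ^ 2 * P * H₁) (h2 : 6 * s ^ 2 + a = p * g)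
    (h3 : 4 * s = p * h) : ∃ U₀ U₁ : ℤ, (quartic a b c).discr =
      p ^ 7 * P ^ 2 * (4 * g ^ 3 * (4 * H₀ * g - H₁ ^ 2) + p * (H₀ * U₀ + H₁ * U₁)) := by
  refine ⟨-4 * h ^ 2 * g ^ 3 + 18 * H₁ * h ^ 3 * g * p * P - 80 * H₁ * h * g ^ 2 * P -
    27 * p ^ 2 * P ^ 2 * h ^ 4 * H₀ + 144 * p * P ^ 2 * H₀ * h ^ 2 * g - 128 * P ^ 2 * H₀ * g ^ 2 -
    192 * p * P ^ 3 * h * H₁ * H₀ + 256 * p * P ^ 4 * H₀ ^ 2 - 6 * p * P ^ 2 * h ^ 2 * H₁ ^ 2 +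
    144 * P ^ 2 * g * H₁ ^ 2, h ^ 2 * g ^ 2 * H₁ - 4 * p * P * h ^ 3 * H₁ ^ 2 +
    18 * P * h * g * H₁ ^ 2 - 27 * P ^ 2 * H₁ ^ 3, ?_⟩
  rw [discr_quartic_shift h0 h1 h2 h3]
  ring

/-- With m = n + 1 the valuation Δ is 2n + 7 in the unramified and 2n + 8 in the ramified type; both
give ⌊(Δ − 1)/2⌋ − 1 = n + 2. -/
lemma discVal_of_shift {p : ℕ} (hp : p.Prime) (h2p : 2 < p) {a b c s g₂ : ℤ} {m : ℕ} (hm : 1 ≤ m)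
    (hs : (p : ℤ) ∣ s) (hg : 6 * s ^ 2 + a = p * g₂) (hg' : ¬ (p : ℤ) ∣ g₂)
    (h : UnramifiedShift p 1 a b c s m ∨ RamifiedShift p 1 a b c s m) :
    (discVal p (quartic a b c) - 1) / 2 - 1 = m + 1 := by
  have hpZ := Nat.prime_iff_prime_int.1 hp
  have hp0 : (p : ℤ) ≠ 0 := hpZ.ne_zero
  have h4 := hp.not_dvd_four h2p
  obtain ⟨n, rfl⟩ := Nat.exists_eq_add_of_le' hm
  obtain ⟨S, rfl⟩ := hs
  suffices h : vp p (quartic a b c).discr = (2 * n + 7 : ℕ) ∨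
      vp p (quartic a b c).discr = (2 * n + 8 : ℕ) by
    unfold discVal
    rcases h with h | h <;> rw [h, ENat.toNat_natCast] <;> omega
  rcases h with ⟨H₀, H₁, g, h0, h1, hg2, hd⟩ | ⟨H₀, H₁, h0, h1, hH₀⟩
  · left
    rw [pow_one] at hg2
    obtain rfl : g = g₂ := mul_left_cancel₀ hp0 (hg2.symm.trans hg)
    obtain ⟨U₀, U₁, hU⟩ := discr_quartic_of_quadruple (P := p ^ n) (H₀ := H₀) (H₁ := H₁)
      (h0.trans (by ring)) (h1.trans (by ring)) hg2 (h := 4 * S) (by ring)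
    refine (vp_eq_iff hp).2 ⟨4 * g ^ 3 * (4 * H₀ * g - H₁ ^ 2) + p * (H₀ * U₀ + H₁ * U₁),
      hU.trans (by ring), fun h => ?_⟩
    rw [add_comm, dvd_add_right (dvd_mul_right _ _)] at h
    refine hd ?_
    rw [← dvd_neg, neg_sub]
    exact (hpZ.dvd_or_dvd h).resolve_left fun h =>
      hg' (hpZ.dvd_of_dvd_pow ((hpZ.dvd_or_dvd h).resolve_left h4))
  · right
    obtain ⟨U₀, U₁, hU⟩ := discr_quartic_of_quadruple (P := p ^ n) (H₀ := p * H₀) (H₁ := p * H₁)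
      (h0.trans (by ring)) (h1.trans (by ring)) hg (h := 4 * S) (by ring)
    refine (vp_eq_iff hp).2 ⟨4 * 4 * g₂ ^ 4 * H₀ + p * (H₀ * U₀ + H₁ * U₁ - 4 * g₂ ^ 3 * H₁ ^ 2),
      hU.trans (by ring), fun h => ?_⟩
    rw [add_comm, dvd_add_right (dvd_mul_right _ _)] at h
    rcases hpZ.dvd_or_dvd ((hpZ.dvd_or_dvd h).resolve_right hH₀) with h | h
    · exact (hpZ.dvd_or_dvd h).elim h4 h4
    · exact hg' (hpZ.dvd_of_dvd_pow h)

variable {K : Type*} [Field K] [NumberField K]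

/-- The Taylor coefficients at s carry the powers p^(2m+1) (one more if ramified), p^(m+1) (one more
if ramified), p and p required by the table of 1, y, y²/p, δ with p²P = p^(m+1). -/
theorem IsQuarticRoot.basis_quotElt_div {p : ℕ} (hp : p.Prime) {a b c : ℤ} {θ : K}
    (hθ : IsQuarticRoot a b c θ) {s g₂ : ℤ} {m : ℕ} (hm : 1 ≤ m)
    (hs : (p : ℤ) ∣ s) (hg : 6 * s ^ 2 + a = p * g₂) (hg' : ¬ (p : ℤ) ∣ g₂)
    (h : UnramifiedShift p 1 a b c s m ∨ RamifiedShift p 1 a b c s m) :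
    IsPIntegralBasis p ![1, θ, θ ^ 2 / (p : K), quotElt a b s θ / (p : K) ^ (m + 1)] := by
  have := Fact.mk hp
  have hpZ := Nat.prime_iff_prime_int.1 hp
  have hp0 : (p : ℤ) ≠ 0 := hpZ.ne_zero
  have hpK : (p : K) ≠ 0 := by exact_mod_cast hp.ne_zero
  obtain ⟨n, rfl⟩ := Nat.exists_eq_add_of_le' hm
  have hP : (p : ℤ) ^ n ≠ 0 := pow_ne_zero _ hp0
  have hP' : (p : ℤ) ^ (n + 1 + 1) ≠ 0 := pow_ne_zero _ hp0
  have hz : p * ((θ - s) ^ 2 / (p : K)) = (θ - s) ^ 2 := mul_div_cancel₀ _ hpK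
  have hli := hθ.linearIndependent_shift s (w := (θ - s) ^ 2 / (p : K)) (d := p) (e₁ := - 2 * s)
    (e₀ := s ^ 2) hp0 hP' (by push_cast; rw [hz]; ring)
  have hy := hθ.shift_eq_zero s
  have hPδ : (((p : ℤ) ^ (n + 1 + 1) : ℤ) : K) *
      (quotElt a b s θ / (((p : ℤ) ^ (n + 1 + 1) : ℤ) : K)) = _ :=
    (mul_div_cancel₀ _ (by exact_mod_cast hP')).trans (quotElt_eq _ _ s θ)
  have ePK : (((p : ℤ) ^ (n + 1 + 1) : ℤ) : K) = p ^ (n + 1 + 1) := by push_cast; rfl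
  obtain ⟨S, hS⟩ := hs
  have hSK : (s : K) = p * S := by exact_mod_cast congrArg (Int.cast : ℤ → K) hS
  suffices h : IsPIntegralBasis p ![1, θ - s, (θ - s) ^ 2 / (p : K),
      quotElt a b s θ / (((p : ℤ) ^ (n + 1 + 1) : ℤ) : K)] by
    rw [← ePK]
    refine h.of_unipotent_int hp s (p * S ^ 2) (2 * S) 0 0 0 (by ring) ?_ (by simp)
    rw [div_eq_iff hpK, hSK]
    push_cast
    field_simp
    ring
  have hg3 : 4 * s = p * (4 * S) := by rw [hS]; ring
  have hg₂ := intCast_ne_zero_of_not_dvd hg'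
  rw [hg, hg3] at hy hPδ
  rcases h with ⟨H₀, H₁, g, h0, h1, hg2, hd⟩ | ⟨H₀, H₁, h0, h1, hH₀⟩
  · rw [pow_one] at hg2
    obtain rfl : g = g₂ := mul_left_cancel₀ hp0 (hg2.symm.trans hg)
    rw [dvd_discrim_iff] at hd
    rw [h0, h1] at hy
    rw [h1] at hPδ
    exact isPIntegralBasis_quotDiv_of_unramified hp hθ.finrank_eq hli hP hz (g₃ := 4 * S)
      (H₀ := H₀) (H₁ := H₁)
      (by push_cast at hy ⊢; linear_combination hy)
      (by push_cast at hPδ ⊢; linear_combination hPδ) hg₂ hd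
  · rw [h0, h1] at hy
    rw [h1] at hPδ
    exact isPIntegralBasis_quotDiv_of_ramified hp hθ.finrank_eq hli hP hz (g₃ := 4 * S) (H₀ := H₀)
      (H₁ := p * H₁) (by push_cast at hy ⊢; linear_combination hy)
      (by push_cast at hPδ ⊢; linear_combination hPδ) hg₂
      (by push_cast; rw [CharP.cast_eq_zero, zero_mul]) (intCast_ne_zero_of_not_dvd hH₀)

end QuadrupleRootShift

/-! ### Assembling the table for a quadruple root -/

section QuadrupleRootRows

variable {p : ℕ} {a b c : ℤ}

lemma dvd_quartic_of_dvd {s : ℤ} (hs : (p : ℤ) ∣ s) (ha : (p : ℤ) ∣ a) (hb : (p : ℤ) ^ 2 ∣ b)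
    (hc : (p : ℤ) ^ 3 ∣ c) : (p : ℤ) ^ (2 + 1) ∣ s ^ 4 + a * s ^ 2 + b * s + c ∧
      (p : ℤ) ^ (1 + 1) ∣ 4 * s ^ 3 + 2 * a * s + b := by
  obtain ⟨S, rfl⟩ := hs
  obtain ⟨A, rfl⟩ := ha
  obtain ⟨B, rfl⟩ := hb
  obtain ⟨C, rfl⟩ := hc
  exact ⟨⟨p * S ^ 4 + A * S ^ 2 + B * S + C, by ring⟩,
    ⟨4 * p * S ^ 3 + 2 * A * S + B, by ring⟩⟩

lemma exists_regular_of_dvd (hp : p.Prime) (hdisc : (quartic a b c).discr ≠ 0) (ha : vp p a = 1)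
    (hb : 1 < vp p b) (hc : 2 < vp p c) :
    ∃ s : ℤ, (p : ℤ) ∣ s ∧ IsRegularInt p (quartic a b c) s := by
  obtain ⟨A, rfl, hA⟩ := (vp_eq_iff hp (n := 1)).1 (by exact_mod_cast ha)
  rw [pow_one] at *
  obtain ⟨d0, d1⟩ := dvd_quartic_of_dvd (s := 0) (a := p * A) (dvd_zero _) (dvd_mul_right _ _)
    (lt_vp_iff (n := 1).1 (by exact_mod_cast hb)) (lt_vp_iff (n := 2).1 (by exact_mod_cast hc))
  have dvd : ∀ s : ℤ, s ≡ 0 [ZMOD p] → (p : ℤ) ∣ s := fun s => Int.modEq_zero_iff_dvd.1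
  obtain ⟨s, hs, m, hm, h⟩ := exists_shift hp (s₁ := 0)
    (fun s hs => dominantAt_one hA (dvd s hs)) d0 d1 hdisc
  exact ⟨s, dvd s hs, (dominantAt_one hA (dvd s hs)).isRegularInt_of hp hm h⟩

lemma exists_shift_of_regular_of_dvd {K : Type*} [Field K] [NumberField K] {θ : K} (hp : p.Prime)
    (hθ : IsQuarticRoot a b c θ) (ha : vp p a = 1)
    (hb : 1 < vp p b) (hc : 2 < vp p c) {s : ℤ} (hs : (p : ℤ) ∣ s)
    (hreg : IsRegularInt p (quartic a b c) s) :
    ∃ m g₂, 1 ≤ m ∧ 6 * s ^ 2 + a = p * g₂ ∧ ¬ (p : ℤ) ∣ g₂ ∧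
      (UnramifiedShift p 1 a b c s m ∨ RamifiedShift p 1 a b c s m) := by
  obtain ⟨A, rfl, hA⟩ := (vp_eq_iff hp (n := 1)).1 (by exact_mod_cast ha)
  rw [pow_one] at *
  obtain ⟨d0, d1⟩ := dvd_quartic_of_dvd hs (a := p * A) (dvd_mul_right _ _)
    (lt_vp_iff (n := 1).1 (by exact_mod_cast hb)) (lt_vp_iff (n := 2).1 (by exact_mod_cast hc))
  have hd := dominantAt_one hA hs
  obtain ⟨m, hm, h⟩ := hd.exists_shift_of_isRegularInt hp (hθ.eval_ne_zero s) d0 d1 hreg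
  obtain ⟨g₂, hg, hg'⟩ := hd.two
  exact ⟨m, g₂, hm, by rw [hg, pow_one], hg', h⟩

variable {K : Type*} [Field K] [NumberField K]

theorem IsQuarticRoot.basis_of_quadrupleRootRow (hp : p.Prime) {θ : K}
    (hθ : IsQuarticRoot a b c θ) (ha : (p : ℤ) ∣ a) (hb : (p : ℤ) ∣ b)
    {v : Fin 4 → K} (hv : QuadrupleRootRow p a b c θ v) : IsPIntegralBasis p v := by
  have e1 {x : ℤ} (h : vp p x = 1) := (vp_eq_iff hp (n := 1)).1 (by exact_mod_cast h)
  have e2 {x : ℤ} (h : vp p x = 2) := (vp_eq_iff hp (n := 2)).1 (by exact_mod_cast h)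
  have e3 {x : ℤ} (h : vp p x = 3) := (vp_eq_iff hp (n := 3)).1 (by exact_mod_cast h)
  have l1 {x : ℤ} (h : 1 < vp p x) := (lt_vp_iff (n := 1)).1 (by exact_mod_cast h)
  have l2 {x : ℤ} (h : 2 < vp p x) := (lt_vp_iff (n := 2)).1 (by exact_mod_cast h)
  cases hv with
  | row1 hc =>
    obtain ⟨A, rfl⟩ := ha
    obtain ⟨B, rfl⟩ := hb
    obtain ⟨C, rfl, hC⟩ := e1 hc
    rw [pow_one] at hθ
    exact hθ.basis_powers hp hC
  | row2 hc hb =>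
    obtain ⟨A, rfl⟩ := ha
    obtain ⟨B, rfl, hB⟩ := e1 hb
    obtain ⟨C, rfl⟩ := l1 hc
    rw [pow_one] at hθ
    exact hθ.basis_powers_of_vp_eq_one hp hB
  | row3 hc hb ha h2 ν hν =>
    subst hν
    exact hθ.basis_half hp h2 ha hb hc
  | row4 hc hb ha h2 =>
    subst h2
    exact hθ.basis_of_vp_eq_two hp hb hc (Or.inl ⟨rfl, ha⟩)
  | row5 hc hb ha h2 => exact hθ.basis_of_vp_eq_two hp hb hc (Or.inr ⟨h2, ha⟩)
  | row6 hc hb ha h2 Q ν hQ =>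
    subst h2
    exact isIrregularBasis_of_row hθ hc ha hQ
  | row7 hc hb ha h2 s hs hreg =>
    obtain ⟨m, g₂, hm, hg, hg', h⟩ := exists_shift_of_regular_of_dvd hp hθ ha hb hc hs hreg
    rw [discVal_of_shift hp h2 hm hs hg hg' h]
    exact hθ.basis_quotElt_div hp hm hs hg hg' h
  | row8 hc hb ha h2 s hs hreg ν hν =>
    subst h2 hν
    obtain ⟨m, g₂, hm, hg, hg', h⟩ := exists_shift_of_regular_of_dvd hp hθ ha hb hc hs hreg
    have hν := floor_halfMin_of_shift h
    rw [Nat.cast_one] at hν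
    rw [hν]
    exact_mod_cast hθ.basis_quotElt_div hp hm hs hg hg' h
  | row9 hc hb ha =>
    obtain ⟨A, rfl⟩ := l1 ha
    obtain ⟨B, rfl, hB⟩ := e2 hb
    obtain ⟨C, rfl⟩ := l2 hc
    exact hθ.basis_powers_of_vp_eq_two hp hB
  | row10 hc hb ha =>
    obtain ⟨A, rfl⟩ := l1 ha
    obtain ⟨B, rfl⟩ := l2 hb
    obtain ⟨C, rfl, hC⟩ := e3 hc
    exact hθ.basis_powers_of_vp_eq_three hp hC

/-- The only valuations outside of the table are v(a) ≥ 2, v(b) ≥ 3, v(c) ≥ 4, where θ/p would be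
integral; these are excluded by hypothesis. -/
theorem IsQuarticRoot.exists_quadrupleRootRow (hp : p.Prime) {θ : K}
    (hθ : IsQuarticRoot a b c θ) (hdisc : (quartic a b c).discr ≠ 0)
    (ha : (p : ℤ) ∣ a) (hb : (p : ℤ) ∣ b) (hc : (p : ℤ) ∣ c)
    (h : vp p a = 1 ∨ vp p b ≤ 2 ∨ vp p c ≤ 3) : ∃ v, QuadrupleRootRow p a b c θ v := by
  have pos {x : ℤ} (h : (p : ℤ) ∣ x) : vp p x = 1 ∨ 1 < vp p x := by
    have := ENat.eq_or_lt_of_lt (n := 0) (x := vp p x) (lt_vp_iff.2 (by simpa using h))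
    exact_mod_cast this
  have two {x : ℕ∞} (h : 1 < x) : x = 2 ∨ 2 < x := by
    have := ENat.eq_or_lt_of_lt (n := 1) (x := x) (by exact_mod_cast h)
    exact_mod_cast this
  have three {x : ℕ∞} (h : 2 < x) : x = 3 ∨ 3 < x := by
    have := ENat.eq_or_lt_of_lt (n := 2) (x := x) (by exact_mod_cast h)
    exact_mod_cast this
  rcases pos hc with hc | hc
  · exact ⟨_, .row1 hc⟩
  rcases pos hb with hb | hb
  · exact ⟨_, .row2 hc hb⟩
  rcases two hc with hc | hc
  · rcases hp.two_le.eq_or_lt' with h2 | h2 <;> rcases pos ha with ha | ha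
    · exact ⟨_, .row4 hc hb ha h2⟩
    · subst h2
      obtain ⟨Q, ν, hQ⟩ := hθ.exists_irregularRow hc ha hb
      exact ⟨_, .row6 hc hb ha rfl Q ν hQ⟩
    · exact ⟨_, .row3 hc hb ha h2 _ rfl⟩
    · exact ⟨_, .row5 hc hb ha h2⟩
  rcases pos ha with ha | ha
  · obtain ⟨s, hs, hreg⟩ := exists_regular_of_dvd hp hdisc ha hb hc
    rcases hp.two_le.eq_or_lt' with h2 | h2
    · exact ⟨_, .row8 hc hb ha h2 s hs hreg _ rfl⟩
    · exact ⟨_, .row7 hc hb ha h2 s hs hreg⟩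
  rcases two hb with hb | hb
  · exact ⟨_, .row9 hc hb ha⟩
  rcases three hc with hc | hc
  · exact ⟨_, .row10 hc hb ha⟩
  · rcases h with h | h | h
    · exact absurd ha h.not_gt
    · exact absurd hb h.not_gt
    · exact absurd hc h.not_gt

end QuadrupleRootRows

theorem mainTheorem9 (p : ℕ) (hp : p.Prime) (a b c : ℤ) (hf : Irreducible (quartic a b c))
    (K : Type*) [Field K] [NumberField K] (θ : K) (hθ : aeval θ (quartic a b c) = 0)
    (hK : IntermediateField.adjoin ℚ {θ} = ⊤) :
    -- `f` is modulo `p > 2` the square of an irreducible quadratic polynomial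
    (2 < p → IsSquareOfIrredQuadMod p (quartic a b c) →
      (∃ s : ℤ, vp p (4 * c - a ^ 2) < 2 * vp p (a - 2 * s) ∨ a = 2 * s) ∧
      ∀ s : ℤ, (vp p (4 * c - a ^ 2) < 2 * vp p (a - 2 * s) ∨ a = 2 * s) →
        ∀ ν : ℚ, ν = halfMin (vp p b) (vp p (4 * c - a ^ 2)) →
          IsPIntegralBasis p
            ![1, θ, (θ ^ 2 + (s : K)) / (p : K) ^ ⌊ν⌋₊,
              (θ ^ 3 + (s : K) * θ) / (p : K) ^ ⌊ν⌋₊]) ∧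
    -- `f` is modulo `p = 2` the square of an irreducible quadratic polynomial
    (p = 2 → IsSquareOfIrredQuadMod p (quartic a b c) →
      (min (vp 2 (b + 1 - a)) (vp 2 (c - a)) = 1 →
        IsPIntegralBasis p ![1, θ, θ ^ 2, θ ^ 3]) ∧
      (min (vp 2 (b + 1 - a)) (vp 2 (c - a)) ≠ 1 →
        1 < min (vp 2 (b + 1 - a)) (vp 2 (c - a)) ∧
        IsPIntegralBasis p ![1, θ, (θ ^ 2 + θ + 1) / 2, (θ ^ 3 + θ ^ 2 + θ) / 2])) ∧
    -- `f` has only one double root `s₀` modulo `p`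
    (∀ s₀ : ℤ, IsOnlyDoubleRootMod p (quartic a b c) s₀ →
      (∃ s : ℤ, s ≡ s₀ [ZMOD p] ∧ (discVal p (quartic a b c) : ℕ∞) <
          2 * vp p ((derivative (quartic a b c)).eval s)) ∧
      ∀ s : ℤ, s ≡ s₀ [ZMOD p] → (discVal p (quartic a b c) : ℕ∞) <
          2 * vp p ((derivative (quartic a b c)).eval s) →
        IsPIntegralBasis p
          ![1, θ, θ ^ 2, quotElt a b s θ / (p : K) ^ (discVal p (quartic a b c) / 2)]) ∧
    -- `f` has two double roots modulo `p = 2`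
    (p = 2 → HasTwoDoubleRootsMod p (quartic a b c) →
      (∃ v : Fin 4 → K, TwoDoubleRootsRow a b c θ v) ∧
      ∀ v : Fin 4 → K, TwoDoubleRootsRow a b c θ v → IsPIntegralBasis p v) ∧
    -- `p` divides `a`, `b`, `c`
    ((p : ℤ) ∣ a → (p : ℤ) ∣ b → (p : ℤ) ∣ c → vp p a = 1 ∨ vp p b ≤ 2 ∨ vp p c ≤ 3 →
      (∃ v : Fin 4 → K, QuadrupleRootRow p a b c θ v) ∧
      ∀ v : Fin 4 → K, QuadrupleRootRow p a b c θ v → IsPIntegralBasis p v) := by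
  have h := isQuarticRoot hf hθ hK
  have hdisc := discr_quartic_ne_zero hf
  refine ⟨fun h2 hs => ⟨exists_shift_square hp h2 a c, ?_⟩, ?_, ?_, ?_, ?_⟩
  · rintro s hs' _ rfl
    exact h.basis_of_isSquareOfIrredQuadMod_odd hp h2 hs hs'
  · rintro rfl hs
    exact h.basis_of_isSquareOfIrredQuadMod_two hs
  · exact fun s₀ hs₀ => ⟨exists_shift_of_isOnlyDoubleRootMod hp hs₀,
      fun s hs hv => h.basis_of_isOnlyDoubleRootMod hp hdisc hs₀ hs hv⟩
  · rintro rfl hs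
    exact ⟨exists_row_of_hasTwoDoubleRootsMod θ hdisc hs,
      fun v hv => h.basis_of_hasTwoDoubleRootsMod hs hv⟩
  · exact fun ha hb hc hv => ⟨h.exists_quadrupleRootRow hp hdisc ha hb hc hv,
      fun v => h.basis_of_quadrupleRootRow hp ha hb⟩
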